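/- Fix $m\ge 1$, vectors $\vec\beta_p\in\mathbb R^m$ ($p\ge 2$) with $\vec\beta_p=0$ for odd $p$ and $\sum_{p\ge2}2^p\vec\beta_p(j)^2<\infty$ for every $j$, a vector $\vec h\in\mathbb R^m$, and a positive semidefinite $m\times m$ matrix $Q$ with entries in $[-1,1]$ and diagonal entries $1$. Write $\odot$ and $A^{\circ k}$ for entrywise products and powers, $\langle A,B\rangle=\mathrm{Tr}(AB)$, $|A|=\det A$, and $$\xi'(A)=\sum_{p\ge2}p\,(\vec\beta_p\vec\beta_p^{T})\odot A^{\circ(p-1)},\qquad \xi''(A)=\sum_{p\ge2}p(p-1)\,(\vec\beta_p\vec\beta_p^{T})\odot A^{\circ(p-2)}.$$ Consider pairs $(x,\Phi)$ where $x(t)=\mu([0,t])$ for a probability measure $\mu$ on $[0,m]$, and $\Phi:[0,m]\to\mathbb R^{m\times m}$ is a path of positive semidefinite matrices, nondecreasing in the Loewner order, with $\Phi(0)=0$ and $\Phi(m)=Q$, such that $t_x:=\inf\{t\in[0,m]:x(t)=1\}<m$ and $|Q-\Phi(t_x)|>0$. For such a pair with $\Phi$ Lipschitz put $\hat\Phi(t)=\int_t^m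 x(s)\Phi'(s)\,ds$ and $$\mathscr C(x,\Phi)=\frac12\Big[\int_0^m x(t)\langle\xi'(\Phi(t))+\vec h\vec h^{T},\Phi'(t)\rangle\,dt+\log|\Phi(m)-\Phi(\hat T)|+\int_0^{\hat T}\langle\hat\Phi(t)^{-1},\Phi'(t)\rangle\,dt\Big],$$ where $\hat T\in(t_x,m)$ is any point with $|Q-\Phi(\hat T)|>0$ (the value does not depend on its choice). Let $\mathscr A_0$ be the class of such pairs for which $\Phi$ is $1$-Lipschitz (with respect to $\max_{i,j}|A_{ij}|$) and $\mathrm{Tr}\,\Phi(t)=t$ for all $t\in[0,m]$, and let $\mathscr A$ be the class of such pairs for which $\Phi$ is Lipschitz and continuously differentiable with Lipschitz derivative and $\mathrm{Tr}\,\Phi(t)=t$ for all $t\in\mathrm{supp}\,\mu$. Proposition (jump discontinuity of $\mu_P$). Let $(x,\Phi)$ minimize $\mathscr C$ over $\mathscr A_0$ or over $\mathscr A$, and let $\mu_P$ be the corresponding Parisi measure, $\mu_P([0,t])=x(t)$. Let $u_0\in\mathrm{supp}\,\mu_P$ be a point at which $\Phi$ is differentiable (relative to $[0,m]$; automatic for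 $\mathscr A$). If $$\langle\xi''(Q),\Phi'(u_0)^{\circ2}\rangle<\langle Q^{-1}\Phi'(u_0),Q^{-1}\Phi'(u_0)\rangle,$$ then $\mu_P$ has a jump discontinuity at $u_0$, that is, the one-sided limits of $t\mapsto\mu_P([0,t])$ at $u_0$ (with $\mu_P([0,t])=0$ for $t<0$) exist and differ. -/

import Mathlib

open Set Filter Topology MeasureTheory
open scoped Matrix NNReal

noncomputable section

namespace VectorSpin

/-- The pairing `⟨A, B⟩ = Tr (A B)`; on symmetric matrices it is the Frobenius inner product. -/
def pairing {m : ℕ} (A B : Matrix (Fin m) (Fin m) ℝ) : ℝ := (A * B).trace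

/-- `ξ'(A) = ∑_{p ≥ 2} p (β_p ⊗ β_p) ⊙ A^{∘(p-1)}`; the summation index is `k = p - 2`. -/
def xiD {m : ℕ} (β : ℕ → Fin m → ℝ) (A : Matrix (Fin m) (Fin m) ℝ) :
    Matrix (Fin m) (Fin m) ℝ :=
  Matrix.of fun i j =>
    ∑' k : ℕ, ((k : ℝ) + 2) * (β (k + 2) i * β (k + 2) j) * A i j ^ (k + 1)

/-- `ξ''(A) = ∑_{p ≥ 2} p (p - 1) (β_p ⊗ β_p) ⊙ A^{∘(p-2)}`; the index is `k = p - 2`. -/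
def xiDD {m : ℕ} (β : ℕ → Fin m → ℝ) (A : Matrix (Fin m) (Fin m) ℝ) :
    Matrix (Fin m) (Fin m) ℝ :=
  Matrix.of fun i j =>
    ∑' k : ℕ, ((k : ℝ) + 2) * ((k : ℝ) + 1) * (β (k + 2) i * β (k + 2) j) * A i j ^ k

/-- Inverse temperatures of a mixed even `p`-spin model (`β p j` is used for `p ≥ 2` only). -/
structure IsMixedEvenModel {m : ℕ} (β : ℕ → Fin m → ℝ) : Prop where
  even : ∀ p, 2 ≤ p → Odd p → ∀ j, β p j = 0
  summable : ∀ j, Summable fun p : ℕ => (2 : ℝ) ^ p * β p j ^ 2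

/-- The space of self-overlap constraints: positive semidefinite matrices with entries in
`[-1, 1]` and diagonal entries `1`. -/
structure IsConstraint {m : ℕ} (Q : Matrix (Fin m) (Fin m) ℝ) : Prop where
  posSemidef : Q.PosSemidef
  mem_Icc : ∀ i j, Q i j ∈ Icc (-1 : ℝ) 1
  diag : ∀ i, Q i i = 1

/-- The function `x(t) = μ([0, t])`. For a probability measure `μ` on `[0, m]` this is the
general nondecreasing right-continuous `x : [0, m] → [0, 1]` with `x(m) = 1`; it vanishes for
`t < 0`. -/
def distr (μ : Measure ℝ) (t : ℝ) : ℝ := μ.real (Icc 0 t)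

/-- `t_x = inf {t ∈ [0, m] | x(t) = 1}`. -/
def topPoint (m : ℕ) (μ : Measure ℝ) : ℝ := sInf {t : ℝ | t ∈ Icc (0 : ℝ) m ∧ distr μ t = 1}

/-- The derivative `Φ'(t)` of a matrix path on `[0, m]` (one-sided at the endpoints). -/
def pathDeriv {m : ℕ} (Φ : ℝ → Matrix (Fin m) (Fin m) ℝ) (t : ℝ) :
    Matrix (Fin m) (Fin m) ℝ :=
  Matrix.of fun i j => derivWithin (fun s => Φ s i j) (Icc (0 : ℝ) m) t

/-- `Φ̂(t) = ∫_t^m x(s) Φ'(s) ds`. -/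
def hatPath {m : ℕ} (μ : Measure ℝ) (Φ : ℝ → Matrix (Fin m) (Fin m) ℝ) (t : ℝ) :
    Matrix (Fin m) (Fin m) ℝ :=
  Matrix.of fun i j => ∫ s in t..(m : ℝ), distr μ s * pathDeriv Φ s i j

/-- The Crisanti-Sommers functional `𝒞(x, Φ)`, written with the auxiliary point `T`. -/
def crisantiSommers {m : ℕ} (β : ℕ → Fin m → ℝ) (h : Fin m → ℝ) (T : ℝ) (μ : Measure ℝ)
    (Φ : ℝ → Matrix (Fin m) (Fin m) ℝ) : ℝ :=
  (1 / 2) *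
    ((∫ t in (0 : ℝ)..m,
        distr μ t * pairing (xiD β (Φ t) + Matrix.vecMulVec h h) (pathDeriv Φ t))
      + Real.log (Φ m - Φ T).det
      + ∫ t in (0 : ℝ)..T, pairing (hatPath μ Φ t)⁻¹ (pathDeriv Φ t))

/-- Monotone paths of positive semidefinite matrices on `[0, m]` from `0` to `Q`. -/
structure IsMonotonePath {m : ℕ} (Q : Matrix (Fin m) (Fin m) ℝ)
    (Φ : ℝ → Matrix (Fin m) (Fin m) ℝ) : Prop where
  posSemidef : ∀ t ∈ Icc (0 : ℝ) m, (Φ t).PosSemidef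
  mono : ∀ s ∈ Icc (0 : ℝ) m, ∀ t ∈ Icc (0 : ℝ) m, s ≤ t → (Φ t - Φ s).PosSemidef
  zero : Φ 0 = 0
  top : Φ m = Q

/-- Monotone paths that are `1`-Lipschitz for the norm `max |A i j|` and have
`Trace Φ(t) = t`. -/
structure IsTracePath {m : ℕ} (Q : Matrix (Fin m) (Fin m) ℝ)
    (Φ : ℝ → Matrix (Fin m) (Fin m) ℝ) : Prop extends IsMonotonePath Q Φ where
  lipschitz : ∀ i j, LipschitzOnWith 1 (fun t => Φ t i j) (Icc (0 : ℝ) m)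
  trace : ∀ t ∈ Icc (0 : ℝ) m, (Φ t).trace = t

/-- Continuously differentiable Lipschitz monotone paths with Lipschitz derivative and
`Trace Φ(t) = t` for `t` in the support of `μ`. -/
structure IsSmoothPath {m : ℕ} (Q : Matrix (Fin m) (Fin m) ℝ) (μ : Measure ℝ)
    (Φ : ℝ → Matrix (Fin m) (Fin m) ℝ) : Prop extends IsMonotonePath Q Φ where
  contDiff : ∀ i j, ContDiffOn ℝ 1 (fun t => Φ t i j) (Icc (0 : ℝ) m)
  lipschitz : ∃ K : ℝ≥0, ∀ i j, LipschitzOnWith K (fun t => Φ t i j) (Icc (0 : ℝ) m)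
  lipschitz_deriv :
    ∃ K : ℝ≥0, ∀ i j, LipschitzOnWith K (fun t => pathDeriv Φ t i j) (Icc (0 : ℝ) m)
  trace : ∀ t ∈ μ.support, (Φ t).trace = t

/-- The standing conditions on a pair: `μ` is a probability measure on `[0, m]`, `t_x < m`
and `|Q - Φ(t_x)| > 0`. -/
structure IsPair {m : ℕ} (Q : Matrix (Fin m) (Fin m) ℝ) (μ : Measure ℝ)
    (Φ : ℝ → Matrix (Fin m) (Fin m) ℝ) : Prop where
  prob : IsProbabilityMeasure μ
  compl : μ (Icc (0 : ℝ) m)ᶜ = 0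
  topPoint_lt : topPoint m μ < m
  det_pos : 0 < (Q - Φ (topPoint m μ)).det

/-- Pairs whose path is `1`-Lipschitz with `Trace Φ(t) = t`. -/
def TracePair {m : ℕ} (Q : Matrix (Fin m) (Fin m) ℝ) (μ : Measure ℝ)
    (Φ : ℝ → Matrix (Fin m) (Fin m) ℝ) : Prop :=
  IsPair Q μ Φ ∧ IsTracePath Q Φ

/-- Pairs whose path is continuously differentiable with Lipschitz derivative. -/
def SmoothPair {m : ℕ} (Q : Matrix (Fin m) (Fin m) ℝ) (μ : Measure ℝ)
    (Φ : ℝ → Matrix (Fin m) (Fin m) ℝ) : Prop :=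
  IsPair Q μ Φ ∧ IsSmoothPath Q μ Φ

/-- The points `T` with `t_x < T < m` at which the functional can be written down. Its value
does not depend on the choice of such a `T`. -/
def IsCutoff {m : ℕ} (Q : Matrix (Fin m) (Fin m) ℝ) (μ : Measure ℝ)
    (Φ : ℝ → Matrix (Fin m) (Fin m) ℝ) (T : ℝ) : Prop :=
  topPoint m μ < T ∧ T < m ∧ 0 < (Q - Φ T).det

/-- `(μ, Φ)` minimizes the Crisanti-Sommers functional over the class `𝒜` of pairs. -/
def IsMinimizer {m : ℕ} (β : ℕ → Fin m → ℝ) (h : Fin m → ℝ) (Q : Matrix (Fin m) (Fin m) ℝ)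
    (𝒜 : Measure ℝ → (ℝ → Matrix (Fin m) (Fin m) ℝ) → Prop)
    (μ : Measure ℝ) (Φ : ℝ → Matrix (Fin m) (Fin m) ℝ) : Prop :=
  𝒜 μ Φ ∧ ∀ ν Ψ, 𝒜 ν Ψ → ∀ T S, IsCutoff Q μ Φ T → IsCutoff Q ν Ψ S →
    crisantiSommers β h T μ Φ ≤ crisantiSommers β h S ν Ψ

/-- `f` has a jump discontinuity at `a`: both one-sided limits exist and they differ. -/
def HasJumpAt (f : ℝ → ℝ) (a : ℝ) : Prop :=
  ∃ l r : ℝ, Tendsto f (𝓝[<] a) (𝓝 l) ∧ Tendsto f (𝓝[>] a) (𝓝 r) ∧ l ≠ r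

end VectorSpin

end

noncomputable section

namespace VectorSpin

/-!
Write `Φ̂(t) = ∫ (Q - Φ(s ∨ t)) dμ(s)` and let `Ξ` be the potential with gradient
`ξ' + h hᵀ`. Integrating by parts, the functional equals, up to a term depending on `Φ(T)` only,
`½ [∫ (Ξ(Q) - Ξ(Φ)) dμ + ∫₀ᵀ ⟨Φ̂⁻¹, Φ'⟩ dt]`, which is invariant under changes of time. There are
two families of variations. Reweighting `μ` shows that the derivative `D(s)` of the functional
with respect to the mass at `s` is constant on the support. Contracting `Φ` towards `Φ(u₀)` near
`u₀`, followed by the change of time that restores `Tr Φ(t) = t`, shows that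
`∫ η(s) ⟨G(s), Φ(u₀) - Φ(s)⟩ dμ(s) ≥ 0` for every bump `η` at `u₀`, where `G` is the gradient of
the functional in the path. Now `⟨G(s), Φ(u₀) - Φ(s)⟩ + D(s) - D(u₀)` is a second order Taylor
remainder, and it is at most half of
`⟨ξ''(Q), Δ ∘ Δ⟩ - ⟨Q⁻¹ Δ, Q⁻¹ Δ⟩` at `Δ = Φ(s) - Φ(u₀)`, up to an error of order `|s - u₀|³`.
By hypothesis this is negative for `s ≠ u₀` near `u₀`, so the integrand is negative on the support
away from `u₀`; as `u₀` is in the support, it must be an atom of `μ`.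
-/

/-! ### Positive semidefinite real matrices -/

section Matrices

variable {n : Type*} {A B D X Y : Matrix n n ℝ}

theorem apply_comm_of_posSemidef (hX : X.PosSemidef) (i j : n) : X i j = X j i := by
  simpa using (hX.isHermitian.apply i j).symm

theorem posDef_of_le (hX : X.PosDef) (h : (Y - X).PosSemidef) : Y.PosDef := by
  simpa using hX.add_posSemidef h

theorem exists_forall_abs_apply_le [Finite n] (A : Matrix n n ℝ) :
    ∃ C, 0 ≤ C ∧ ∀ i j, |A i j| ≤ C := by
  obtain ⟨C, hC⟩ := (finite_range fun p : n × n => |A p.1 p.2|).bddAbove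
  exact ⟨max C 0, le_max_right _ _, fun i j => (hC ⟨(i, j), rfl⟩).trans (le_max_left _ _)⟩

theorem abs_apply_le_of_posSemidef [Finite n] (hX : X.PosSemidef) (i j : n) :
    |X i j| ≤ (X i i + X j j) / 2 := by
  classical
  cases nonempty_fintype n
  have form_nonneg (c : ℝ) : 0 ≤ X i i + c * X i j + c * X j i + c ^ 2 * X j j := by
    have h := hX.dotProduct_mulVec_nonneg (Pi.single i 1 + Pi.single j c)
    simp only [star_trivial, Matrix.mulVec_add, Matrix.mulVec_single, MulOpposite.op_one, one_smul,
      op_smul_eq_smul, dotProduct_add, add_dotProduct, single_dotProduct, Matrix.col_apply, one_mul,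
      Pi.smul_apply, smul_eq_mul] at h
    linarith
  have symm := apply_comm_of_posSemidef hX i j
  rw [abs_le]
  constructor <;> linarith [form_nonneg 1, form_nonneg (-1)]

variable [Fintype n]

theorem abs_mul_apply_le {a b : ℝ} (hA : ∀ i j, |A i j| ≤ a) (hB : ∀ i j, |B i j| ≤ b) (i j : n) :
    |(A * B) i j| ≤ Fintype.card n * (a * b) := by
  rw [Matrix.mul_apply]
  calc |∑ k, A i k * B k j| ≤ ∑ k, |A i k * B k j| := Finset.abs_sum_le_sum_abs _ _
    _ ≤ ∑ _k : n, a * b := by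
        refine Finset.sum_le_sum fun k _ => ?_
        rw [abs_mul]
        exact mul_le_mul (hA i k) (hB k j) (abs_nonneg _) ((abs_nonneg _).trans (hA i k))
    _ = Fintype.card n * (a * b) := by simp

theorem posSemidef_iff_sum_nonneg :
    X.PosSemidef ↔ (∀ i j, X i j = X j i) ∧ ∀ v : n → ℝ, 0 ≤ ∑ i, ∑ j, v i * v j * X i j := by
  have quadForm_eq (v : n → ℝ) : star v ⬝ᵥ (X *ᵥ v) = ∑ i, ∑ j, v i * v j * X i j := by
    simp only [dotProduct, Matrix.mulVec, Finset.mul_sum, Pi.star_apply, star_trivial]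
    exact Finset.sum_congr rfl fun i _ => Finset.sum_congr rfl fun j _ => by ring
  simp only [Matrix.posSemidef_iff_dotProduct_mulVec, quadForm_eq, and_congr_left_iff]
  exact fun _ => ⟨fun h i j => by simpa using (h.apply i j).symm,
    fun h => Matrix.ext fun i j => by simp [h i j]⟩

theorem abs_apply_le_trace_of_posSemidef (hX : X.PosSemidef) (i j : n) : |X i j| ≤ X.trace := by
  have diag_le (k : n) : X k k ≤ X.trace :=
    Finset.single_le_sum (f := fun l => X l l) (fun l _ => hX.diag_nonneg) (Finset.mem_univ k)
  linarith [abs_apply_le_of_posSemidef hX i j, diag_le i, diag_le j]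

theorem trace_mul_nonneg_of_posSemidef (hA : A.PosSemidef) (hB : B.PosSemidef) :
    0 ≤ (A * B).trace := by
  have h := (hA.hadamard hB.transpose).dotProduct_mulVec_nonneg 1
  rw [← Matrix.transpose_transpose B, ← Matrix.sum_hadamard_eq]
  simpa [dotProduct, Matrix.mulVec] using h

theorem measurable_mul_apply {α : Type*} [MeasurableSpace α] {A B : α → Matrix n n ℝ}
    (hA : ∀ i j, Measurable fun x => A x i j) (hB : ∀ i j, Measurable fun x => B x i j) (i j : n) :
    Measurable fun x => (A x * B x) i j := by
  simp only [Matrix.mul_apply]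
  exact Finset.measurable_fun_sum _ fun k _ => (hA i k).mul (hB k j)

variable [DecidableEq n]

theorem posDef_of_posSemidef_of_det_pos (hX : X.PosSemidef) (hd : 0 < X.det) : X.PosDef :=
  hX.posDef_iff_isUnit.mpr ((Matrix.isUnit_iff_isUnit_det _).mpr hd.ne'.isUnit)

theorem inv_sub_inv_of_posDef (hX : X.PosDef) (hY : Y.PosDef) :
    X⁻¹ - Y⁻¹ = X⁻¹ * (Y - X) * Y⁻¹ :=
  Matrix.inv_sub_inv (iff_of_true hX.isUnit hY.isUnit)

/-- Both sides say that the block matrix `[[Y, 1], [1, X⁻¹]]` is positive semidefinite. -/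
theorem posSemidef_inv_sub_inv (hX : X.PosDef) (h : (Y - X).PosSemidef) :
    (X⁻¹ - Y⁻¹).PosSemidef := by
  have hY := posDef_of_le hX h
  let := hY.isUnit.invertible
  let := hX.inv.isUnit.invertible
  have block : (Matrix.fromBlocks Y 1 (1 : Matrix n n ℝ)ᴴ X⁻¹).PosSemidef := by
    rw [Matrix.PosDef.fromBlocks₂₂ Y 1 hX.inv]
    simpa [Matrix.nonsing_inv_nonsing_inv X hX.det_pos.ne'.isUnit] using h
  simpa using (Matrix.PosDef.fromBlocks₁₁ 1 X⁻¹ hY).mp block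

theorem abs_inv_apply_le_of_le (hX : X.PosDef) (h : (Y - X).PosSemidef) (i j : n) :
    |Y⁻¹ i j| ≤ (X⁻¹).trace := by
  have trace_le := (posSemidef_inv_sub_inv hX h).trace_nonneg
  rw [Matrix.trace_sub] at trace_le
  linarith [abs_apply_le_trace_of_posSemidef (posDef_of_le hX h).inv.posSemidef i j]

theorem abs_inv_sub_inv_apply_le {a b d : ℝ} (hX : X.PosDef) (hY : Y.PosDef)
    (ha : ∀ i j, |X⁻¹ i j| ≤ a) (hb : ∀ i j, |Y⁻¹ i j| ≤ b) (hd : ∀ i j, |(Y - X) i j| ≤ d)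
    (i j : n) :
    |(X⁻¹ - Y⁻¹) i j| ≤ Fintype.card n * ((Fintype.card n * (a * d)) * b) := by
  rw [inv_sub_inv_of_posDef hX hY]
  exact abs_mul_apply_le (abs_mul_apply_le ha hd) hb i j

theorem trace_inv_mul_mul_inv_mul_mono (hX : X.PosDef) (h : (Y - X).PosSemidef)
    (hD : D.IsHermitian) : (Y⁻¹ * D * Y⁻¹ * D).trace ≤ (X⁻¹ * D * X⁻¹ * D).trace := by
  have conj_posSemidef {W : Matrix n n ℝ} (hW : W.PosSemidef) : (D * W * D).PosSemidef := by
    simpa only [hD.eq] using hW.mul_mul_conjTranspose_same D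
  have hZ := posSemidef_inv_sub_inv hX h
  have pX := trace_mul_nonneg_of_posSemidef hZ (conj_posSemidef hX.inv.posSemidef)
  have pY := trace_mul_nonneg_of_posSemidef hZ
    (conj_posSemidef (posDef_of_le hX h).inv.posSemidef)
  have swap : (X⁻¹ * D * Y⁻¹ * D).trace = (Y⁻¹ * D * X⁻¹ * D).trace := by
    rw [Matrix.mul_assoc (X⁻¹ * D), Matrix.trace_mul_comm, ← Matrix.mul_assoc]
  simp only [sub_mul, Matrix.trace_sub, ← Matrix.mul_assoc] at pX pY
  linarith

theorem measurable_det {α : Type*} [MeasurableSpace α] {A : α → Matrix n n ℝ}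
    (hA : ∀ i j, Measurable fun x => A x i j) : Measurable fun x => (A x).det := by
  simp only [Matrix.det_apply]
  exact Finset.measurable_fun_sum _ fun σ _ =>
    (Finset.measurable_fun_prod _ fun i _ => hA _ _).const_smul _

theorem measurable_inv_apply {α : Type*} [MeasurableSpace α] {A : α → Matrix n n ℝ}
    (hA : ∀ i j, Measurable fun x => A x i j) (i j : n) : Measurable fun x => (A x)⁻¹ i j := by
  simp only [Matrix.inv_def, Matrix.smul_apply, Ring.inverse_eq_inv', smul_eq_mul,
    Matrix.adjugate_apply]
  refine (measurable_det hA).inv.mul (measurable_det fun k l => ?_)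
  by_cases hkj : k = j
  · simp [hkj]
  · simpa [Matrix.updateRow_apply, hkj] using hA k l

theorem hasDerivAt_inv_apply {A : ℝ → Matrix n n ℝ} {A' : Matrix n n ℝ} {t : ℝ}
    (hA : ∀ i j, HasDerivAt (fun s => A s i j) (A' i j) t) (hu : IsUnit (A t)) (i j : n) :
    HasDerivAt (fun s => (A s)⁻¹ i j) (-((A t)⁻¹ * A' * (A t)⁻¹) i j) t := by
  let := Matrix.linftyOpNormedRing (n := n) (α := ℝ)
  let := Matrix.linftyOpNormedAlgebra (n := n) (R := ℝ) (α := ℝ)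
  obtain ⟨U, hU⟩ := hu
  have hpath : HasDerivAt A A' t := by
    refine hasDerivAt_pi.mpr fun i => hasDerivAt_pi.mpr fun j => hA i j
  have hinv := (hU ▸ hasFDerivAt_ringInverse (𝕜 := ℝ) U).comp_hasDerivAt t hpath
  have := hasDerivAt_pi.mp (hasDerivAt_pi.mp hinv i) j
  simpa [Function.comp_def, ← Matrix.nonsing_inv_eq_ringInverse, ← hU] using this

end Matrices

section EntrywisePowers

variable {n : Type*} {A B D Q : Matrix n n ℝ}

/-- The entrywise power `A^{∘k}`. -/
def hadamardPow (A : Matrix n n ℝ) (k : ℕ) : Matrix n n ℝ := A.map (· ^ k)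

/-- The remainder in the first-order Taylor expansion of the entrywise power `A^{∘(k+2)}` at
`B`. -/
def hadamardPowRem (A B : Matrix n n ℝ) (k : ℕ) : Matrix n n ℝ :=
  Matrix.of fun i j => (k + 2) * B i j ^ (k + 1) * (B i j - A i j)
    - (B i j ^ (k + 2) - A i j ^ (k + 2))

theorem hadamardPowRem_zero (A B : Matrix n n ℝ) :
    hadamardPowRem A B 0 = (B - A) ⊙ (B - A) := by
  ext i j
  simp only [hadamardPowRem, Matrix.of_apply, Matrix.hadamard_apply, Matrix.sub_apply]
  push_cast
  ring

theorem hadamardPowRem_succ (A B : Matrix n n ℝ) (k : ℕ) :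
    hadamardPowRem A B (k + 1) = A ⊙ hadamardPowRem A B k
      + ((k : ℝ) + 2) • (hadamardPow B (k + 1) ⊙ ((B - A) ⊙ (B - A))) := by
  ext i j
  simp only [hadamardPowRem, hadamardPow, Matrix.of_apply, Matrix.hadamard_apply,
    Matrix.sub_apply, Matrix.add_apply, Matrix.smul_apply, Matrix.map_apply, smul_eq_mul]
  push_cast
  ring

theorem posSemidef_hadamard_self (h : D.PosSemidef ∨ (-D).PosSemidef) : (D ⊙ D).PosSemidef := by
  rcases h with h | h
  · exact h.hadamard h
  · have neg_hadamard_neg : (-D) ⊙ (-D) = D ⊙ D := by ext i j; simp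
    exact neg_hadamard_neg ▸ h.hadamard h

variable [Finite n]

theorem posSemidef_hadamardPow (hA : A.PosSemidef) (k : ℕ) : (hadamardPow A k).PosSemidef := by
  induction k with
  | zero =>
    have pow_zero_eq : hadamardPow A 0 = Matrix.vecMulVec 1 (star 1) := by
      ext i j; simp [hadamardPow, Matrix.vecMulVec_apply]
    exact pow_zero_eq ▸ Matrix.posSemidef_vecMulVec_self_star _
  | succ k ih =>
    have pow_succ_eq : hadamardPow A (k + 1) = hadamardPow A k ⊙ A := by
      ext i j; simp [hadamardPow, pow_succ]
    exact pow_succ_eq ▸ ih.hadamard hA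

theorem posSemidef_hadamardPow_sub (hA : A.PosSemidef) (hB : B.PosSemidef)
    (h : (B - A).PosSemidef) (k : ℕ) : (hadamardPow B k - hadamardPow A k).PosSemidef := by
  induction k with
  | zero =>
    have sub_zero_eq : hadamardPow B 0 - hadamardPow A 0 = 0 := by ext i j; simp [hadamardPow]
    exact sub_zero_eq ▸ Matrix.PosSemidef.zero
  | succ k ih =>
    have sub_succ_eq : hadamardPow B (k + 1) - hadamardPow A (k + 1)
        = (hadamardPow B k - hadamardPow A k) ⊙ B + hadamardPow A k ⊙ (B - A) := by
      ext i j
      simp only [hadamardPow, Matrix.add_apply, Matrix.hadamard_apply, Matrix.sub_apply,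
        Matrix.map_apply]
      ring
    exact sub_succ_eq ▸ (ih.hadamard hB).add ((posSemidef_hadamardPow hA k).hadamard h)

theorem posSemidef_hadamardPowRem (hA : A.PosSemidef) (hB : B.PosSemidef)
    (hD : ((B - A) ⊙ (B - A)).PosSemidef) (k : ℕ) : (hadamardPowRem A B k).PosSemidef := by
  induction k with
  | zero => rwa [hadamardPowRem_zero]
  | succ k ih =>
    rw [hadamardPowRem_succ]
    exact (hA.hadamard ih).add
      (((posSemidef_hadamardPow hB _).hadamard hD).smul (by positivity))

theorem posSemidef_smul_hadamard_sub_hadamardPowRem (hA : A.PosSemidef) (hB : B.PosSemidef)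
    (hAQ : (Q - A).PosSemidef) (hBQ : (Q - B).PosSemidef)
    (hD : ((B - A) ⊙ (B - A)).PosSemidef) (k : ℕ) :
    ((((k : ℝ) + 2) * (k + 1) / 2) • (hadamardPow Q k ⊙ ((B - A) ⊙ (B - A)))
      - hadamardPowRem A B k).PosSemidef := by
  have hQ : Q.PosSemidef := by simpa using hAQ.add hA
  induction k with
  | zero =>
    have base : (((0 : ℕ) + 2 : ℝ) * ((0 : ℕ) + 1) / 2) •
        (hadamardPow Q 0 ⊙ ((B - A) ⊙ (B - A))) - hadamardPowRem A B 0 = 0 := by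
      ext i j; simp [hadamardPowRem_zero, hadamardPow]
    exact base ▸ Matrix.PosSemidef.zero
  | succ k ih =>
    have recursion : (((k + 1 : ℕ) + 2 : ℝ) * ((k + 1 : ℕ) + 1) / 2) •
          (hadamardPow Q (k + 1) ⊙ ((B - A) ⊙ (B - A))) - hadamardPowRem A B (k + 1)
        = A ⊙ ((((k : ℝ) + 2) * (k + 1) / 2) • (hadamardPow Q k ⊙ ((B - A) ⊙ (B - A)))
            - hadamardPowRem A B k)
          + (((k : ℝ) + 2) * (k + 1) / 2) •
            ((Q - A) ⊙ (hadamardPow Q k ⊙ ((B - A) ⊙ (B - A))))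
          + ((k : ℝ) + 2) •
            ((hadamardPow Q (k + 1) - hadamardPow B (k + 1)) ⊙ ((B - A) ⊙ (B - A))) := by
      rw [hadamardPowRem_succ]
      ext i j
      simp only [hadamardPow, Matrix.add_apply, Matrix.smul_apply, Matrix.hadamard_apply,
        Matrix.sub_apply, Matrix.map_apply, smul_eq_mul]
      push_cast
      ring
    rw [recursion]
    refine ((hA.hadamard ih).add ?_).add ?_
    · exact (hAQ.hadamard ((posSemidef_hadamardPow hQ k).hadamard hD)).smul (by positivity)
    · exact ((posSemidef_hadamardPow_sub hB hQ hBQ _).hadamard hD).smul (by positivity)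

end EntrywisePowers

section Pairing

variable {m : ℕ}

theorem pairing_eq_sum (A B : Matrix (Fin m) (Fin m) ℝ) :
    pairing A B = ∑ i, ∑ j, A i j * B j i := by
  simp only [pairing, Matrix.trace, Matrix.diag_apply, Matrix.mul_apply]

theorem pairing_sub_left (A B C : Matrix (Fin m) (Fin m) ℝ) :
    pairing (A - B) C = pairing A C - pairing B C := by
  simp [pairing, sub_mul]

theorem pairing_add_right (A B C : Matrix (Fin m) (Fin m) ℝ) :
    pairing A (B + C) = pairing A B + pairing A C := by
  simp [pairing, mul_add]

theorem pairing_sub_right (A B C : Matrix (Fin m) (Fin m) ℝ) :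
    pairing A (B - C) = pairing A B - pairing A C := by
  simp [pairing, mul_sub]

theorem pairing_smul_left (c : ℝ) (A B : Matrix (Fin m) (Fin m) ℝ) :
    pairing (c • A) B = c * pairing A B := by
  simp [pairing]

theorem pairing_smul_right (c : ℝ) (A B : Matrix (Fin m) (Fin m) ℝ) :
    pairing A (c • B) = c * pairing A B := by
  simp [pairing]

theorem pairing_conj_comm (X P B : Matrix (Fin m) (Fin m) ℝ) :
    pairing (X * P * X) B = pairing (X * B * X) P := by
  unfold pairing
  rw [Matrix.mul_assoc (X * P), Matrix.trace_mul_comm (X * P), ← Matrix.mul_assoc]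

theorem abs_pairing_le {A B : Matrix (Fin m) (Fin m) ℝ} {a b : ℝ}
    (hA : ∀ i j, |A i j| ≤ a) (hB : ∀ i j, |B i j| ≤ b) :
    |pairing A B| ≤ m * (m * (a * b)) := by
  calc |pairing A B| = |∑ i, (A * B) i i| := rfl
    _ ≤ ∑ i, |(A * B) i i| := Finset.abs_sum_le_sum_abs _ _
    _ ≤ ∑ _i : Fin m, m * (a * b) := by
        gcongr with i
        simpa using abs_mul_apply_le hA hB i i
    _ = m * (m * (a * b)) := by simp

theorem tendsto_pairing {α : Type*} {l : Filter α} {A B : α → Matrix (Fin m) (Fin m) ℝ}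
    {A₀ B₀ : Matrix (Fin m) (Fin m) ℝ} (hA : ∀ i j, Tendsto (fun t => A t i j) l (𝓝 (A₀ i j)))
    (hB : ∀ i j, Tendsto (fun t => B t i j) l (𝓝 (B₀ i j))) :
    Tendsto (fun t => pairing (A t) (B t)) l (𝓝 (pairing A₀ B₀)) := by
  simp only [pairing_eq_sum]
  exact tendsto_finsetSum _ fun i _ => tendsto_finsetSum _ fun j _ => (hA i j).mul (hB j i)

theorem measurable_pairing {α : Type*} [MeasurableSpace α] {A B : α → Matrix (Fin m) (Fin m) ℝ}
    (hA : ∀ i j, Measurable fun x => A x i j) (hB : ∀ i j, Measurable fun x => B x i j) :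
    Measurable fun x => pairing (A x) (B x) := by
  simp only [pairing_eq_sum]
  exact Finset.measurable_fun_sum _ fun i _ => Finset.measurable_fun_sum _ fun j _ =>
    (hA i j).mul (hB j i)

end Pairing

/-! ### The mixture function and its potential -/

section Mixture

variable {c : ℕ → ℝ} {a : ℝ}

/-- The power series `∑_{p ≥ 2} c_{p-2} a^p`, with the index `k = p - 2` of `xiD`. -/
def mixture (c : ℕ → ℝ) (a : ℝ) : ℝ := ∑' k : ℕ, c k * a ^ (k + 2)

/-- The term by term derivative of `mixture c`; for the coefficients `c = xiCoeff β i j` it is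
the entry `i j` of `xiD`. -/
def mixtureDeriv (c : ℕ → ℝ) (a : ℝ) : ℝ := ∑' k : ℕ, ((k : ℝ) + 2) * c k * a ^ (k + 1)

/-- The bound is used on the open ball of radius `3 / 2`, on which the series can be
differentiated; it contains the closed interval `[-1, 1]` of the entries. -/
theorem norm_mixtureDeriv_term_le (c : ℕ → ℝ) (k : ℕ) (ha : |a| ≤ 3 / 2) :
    ‖((k : ℝ) + 2) * c k * a ^ (k + 1)‖ ≤ 9 * (2 ^ k * |c k|) := by
  have bernoulli := one_add_mul_le_pow (a := (1 / 3 : ℝ)) (by norm_num) k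
  have linear_mul_pow_le : ((k : ℝ) + 2) * |a| ^ (k + 1) ≤ 9 * 2 ^ k :=
    calc ((k : ℝ) + 2) * |a| ^ (k + 1) ≤ ((k : ℝ) + 2) * (3 / 2 : ℝ) ^ (k + 1) := by gcongr
      _ = (3 / 2) ^ k * (3 / 2 * ((k : ℝ) + 2)) := by rw [pow_succ]; ring
      _ ≤ (3 / 2) ^ k * (9 * (1 + 1 / 3) ^ k) := by
          refine mul_le_mul_of_nonneg_left ?_ (by positivity)
          linarith [k.cast_nonneg (α := ℝ)]
      _ = 9 * ((3 / 2) * (1 + 1 / 3)) ^ k := by rw [mul_pow]; ring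
      _ = 9 * 2 ^ k := by norm_num
  calc ‖((k : ℝ) + 2) * c k * a ^ (k + 1)‖ = ((k : ℝ) + 2) * |a| ^ (k + 1) * |c k| := by
        rw [Real.norm_eq_abs, abs_mul, abs_mul, abs_pow,
          abs_of_nonneg (by positivity : (0 : ℝ) ≤ k + 2)]
        ring
    _ ≤ 9 * 2 ^ k * |c k| := by gcongr
    _ = 9 * (2 ^ k * |c k|) := by ring

theorem summable_mixtureDeriv_term (hc : Summable fun k => (2 : ℝ) ^ k * |c k|)
    (ha : |a| ≤ 3 / 2) : Summable fun k : ℕ => ((k : ℝ) + 2) * c k * a ^ (k + 1) :=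
  Summable.of_norm_bounded (hc.mul_left 9) fun k => norm_mixtureDeriv_term_le c k ha

theorem summable_mixture_term (hc : Summable fun k => (2 : ℝ) ^ k * |c k|) (ha : |a| ≤ 1) :
    Summable fun k : ℕ => c k * a ^ (k + 2) := by
  refine Summable.of_norm_bounded hc fun k => ?_
  rw [Real.norm_eq_abs, abs_mul, abs_pow, mul_comm]
  gcongr
  exact (pow_le_one₀ (abs_nonneg a) ha).trans (one_le_pow₀ (by norm_num))

theorem summable_mixture_deriv_deriv_term (hc : Summable fun k => (2 : ℝ) ^ k * |c k|)
    (ha : |a| ≤ 1) : Summable fun k : ℕ => ((k : ℝ) + 2) * ((k : ℝ) + 1) * c k * a ^ k := by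
  refine Summable.of_norm_bounded (hc.mul_left 8) fun k => ?_
  have quadratic_le : ((k : ℝ) + 2) * ((k : ℝ) + 1) ≤ 8 * 2 ^ k := by
    have choose_le : ((k + 2).choose 2 : ℝ) ≤ 2 ^ (k + 2) := by
      exact_mod_cast Nat.choose_le_two_pow (k + 2) 2
    rw [Nat.cast_choose_two, pow_add] at choose_le
    push_cast at choose_le
    linarith
  rw [Real.norm_eq_abs, abs_mul, abs_mul, abs_pow,
    abs_of_nonneg (by positivity : (0 : ℝ) ≤ (k + 2) * (k + 1))]
  calc ((k : ℝ) + 2) * ((k : ℝ) + 1) * |c k| * |a| ^ k ≤ 8 * 2 ^ k * |c k| * 1 := by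
        gcongr
        exact pow_le_one₀ (abs_nonneg a) ha
    _ = 8 * (2 ^ k * |c k|) := by ring

theorem hasDerivAt_mixture (hc : Summable fun k => (2 : ℝ) ^ k * |c k|) (ha : |a| ≤ 1) :
    HasDerivAt (mixture c) (mixtureDeriv c a) a := by
  have mem_ball {y : ℝ} : y ∈ Metric.ball (0 : ℝ) (3 / 2) ↔ |y| < 3 / 2 := by
    rw [mem_ball_zero_iff, Real.norm_eq_abs]
  refine hasDerivAt_tsum_of_isPreconnected (y₀ := 0) (hc.mul_left 9) Metric.isOpen_ball
    (convex_ball (0 : ℝ) (3 / 2)).isPreconnected (fun k y _ => ?_)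
    (fun k y hy => norm_mixtureDeriv_term_le c k (mem_ball.mp hy).le) (by simp) (by simp)
    (mem_ball.mpr (by linarith))
  convert! (hasDerivAt_pow (k + 2) y).const_mul (c k) using 1
  push_cast
  ring

theorem continuousOn_mixtureDeriv (hc : Summable fun k => (2 : ℝ) ^ k * |c k|) :
    ContinuousOn (mixtureDeriv c) (Icc (-1) 1) :=
  continuousOn_tsum (fun k => by fun_prop) (hc.mul_left 9) fun k _ ha =>
    norm_mixtureDeriv_term_le c k ((abs_le.mpr ha).trans (by norm_num))

end Mixture

section Potential

variable {m : ℕ} {β : ℕ → Fin m → ℝ} {A B Q : Matrix (Fin m) (Fin m) ℝ}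

/-- Inverse temperatures of a mixed `p`-spin model that is not necessarily even. -/
def IsMixedModel (β : ℕ → Fin m → ℝ) : Prop := ∀ j, Summable fun p : ℕ => (2 : ℝ) ^ p * β p j ^ 2

/-- The coefficients `β_p(i) β_p(j)` of the entry `i j` of `ξ`; the index is `k = p - 2`. -/
def xiCoeff (β : ℕ → Fin m → ℝ) (i j : Fin m) (k : ℕ) : ℝ := β (k + 2) i * β (k + 2) j

theorem IsMixedModel.summable_xiCoeff (hβ : IsMixedModel β) (i j : Fin m) :
    Summable fun k : ℕ => (2 : ℝ) ^ k * |xiCoeff β i j k| := by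
  have summable_sq (l : Fin m) : Summable fun k : ℕ => (2 : ℝ) ^ (k + 2) * β (k + 2) l ^ 2 :=
    (summable_nat_add_iff 2).mpr (hβ l)
  refine Summable.of_nonneg_of_le (fun k => by positivity) (fun k => ?_)
    ((summable_sq i).add (summable_sq j))
  have abs_coeff_le : |xiCoeff β i j k| ≤ 4 * (β (k + 2) i ^ 2 + β (k + 2) j ^ 2) := by
    rw [xiCoeff, abs_mul]
    nlinarith [sq_nonneg (|β (k + 2) i| - |β (k + 2) j|), sq_abs (β (k + 2) i),
      sq_abs (β (k + 2) j), sq_nonneg (β (k + 2) i), sq_nonneg (β (k + 2) j)]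
  calc (2 : ℝ) ^ k * |xiCoeff β i j k| ≤ 2 ^ k * (4 * (β (k + 2) i ^ 2 + β (k + 2) j ^ 2)) := by
        gcongr
    _ = 2 ^ (k + 2) * β (k + 2) i ^ 2 + 2 ^ (k + 2) * β (k + 2) j ^ 2 := by ring

theorem IsMixedModel.exists_abs_mixtureDeriv_le (hβ : IsMixedModel β) :
    ∃ M : ℝ≥0, ∀ i j a, |a| ≤ 1 → |mixtureDeriv (xiCoeff β i j) a| ≤ M := by
  have bounded (i j : Fin m) : ∃ M, ∀ a ∈ Icc (-1 : ℝ) 1, ‖mixtureDeriv (xiCoeff β i j) a‖ ≤ M :=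
    isCompact_Icc.exists_bound_of_continuousOn (continuousOn_mixtureDeriv (hβ.summable_xiCoeff i j))
  choose M hM using bounded
  obtain ⟨C, hC0, hC⟩ := exists_forall_abs_apply_le (Matrix.of M)
  exact ⟨⟨C, hC0⟩, fun i j a ha =>
    (hM i j a (abs_le.mp ha)).trans ((le_abs_self _).trans (hC i j))⟩

/-- A primitive of `A ↦ ξ'(A) + h hᵀ` on the matrices with entries in `[-1, 1]`, namely
`∑_{ij} ξ_{ij}(A_{ij}) + ⟨h, A h⟩`. -/
def potential (β : ℕ → Fin m → ℝ) (h : Fin m → ℝ) (A : Matrix (Fin m) (Fin m) ℝ) : ℝ :=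
  ∑ i, ∑ j, (mixture (xiCoeff β i j) (A i j) + h i * h j * A i j)

theorem pairing_xiD_add_eq_sum (β : ℕ → Fin m → ℝ) (h : Fin m → ℝ)
    {D : Matrix (Fin m) (Fin m) ℝ} (hD : ∀ i j, D i j = D j i) (A : Matrix (Fin m) (Fin m) ℝ) :
    pairing (xiD β A + Matrix.vecMulVec h h) D
      = ∑ i, ∑ j, (mixtureDeriv (xiCoeff β i j) (A i j) + h i * h j) * D i j := by
  rw [pairing_eq_sum]
  refine Finset.sum_congr rfl fun i _ => Finset.sum_congr rfl fun j _ => ?_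
  rw [← hD i j]
  rfl

theorem hasSum_potential_taylor_remainder (hβ : IsMixedModel β) (h : Fin m → ℝ)
    (hA : ∀ i j, |A i j| ≤ 1) (hB : ∀ i j, |B i j| ≤ 1) (hD : ∀ i j, (B - A) i j = (B - A) j i) :
    HasSum (fun k : ℕ => ∑ i, ∑ j, β (k + 2) i * β (k + 2) j * hadamardPowRem A B k i j)
      (pairing (xiD β B + Matrix.vecMulVec h h) (B - A)
        - (potential β h B - potential β h A)) := by
  have remainder_eq : pairing (xiD β B + Matrix.vecMulVec h h) (B - A)
        - (potential β h B - potential β h A)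
      = ∑ i, ∑ j, (mixtureDeriv (xiCoeff β i j) (B i j) * (B i j - A i j)
          - (mixture (xiCoeff β i j) (B i j) - mixture (xiCoeff β i j) (A i j))) := by
    rw [pairing_xiD_add_eq_sum _ _ hD]
    simp only [potential, ← Finset.sum_sub_distrib]
    refine Finset.sum_congr rfl fun i _ => Finset.sum_congr rfl fun j _ => ?_
    rw [Matrix.sub_apply]
    ring
  rw [remainder_eq]
  refine hasSum_sum fun i _ => hasSum_sum fun j _ => ?_
  have hc := hβ.summable_xiCoeff i j
  have deriv_sum := (summable_mixtureDeriv_term hc ((hB i j).trans (by norm_num))).hasSum.mul_right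
    (B i j - A i j)
  have diff_sum :=
    (summable_mixture_term hc (hB i j)).hasSum.sub (summable_mixture_term hc (hA i j)).hasSum
  refine (deriv_sum.sub diff_sum).congr_fun fun k => ?_
  simp only [hadamardPowRem, xiCoeff, Matrix.of_apply]
  ring

theorem hasSum_pairing_xiDD_half (hβ : IsMixedModel β) (hQ : ∀ i j, |Q i j| ≤ 1)
    {D : Matrix (Fin m) (Fin m) ℝ} (hD : ∀ i j, D i j = D j i) :
    HasSum (fun k : ℕ => ∑ i, ∑ j, β (k + 2) i * β (k + 2) j *
      ((((k : ℝ) + 2) * ((k : ℝ) + 1) / 2) • (hadamardPow Q k ⊙ D)) i j)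
      (pairing (xiDD β Q) D / 2) := by
  simp only [pairing_eq_sum, Finset.sum_div]
  refine hasSum_sum fun i _ => hasSum_sum fun j _ => ?_
  have := ((summable_mixture_deriv_deriv_term (hβ.summable_xiCoeff i j)
    (hQ i j)).hasSum.mul_right (D j i)).div_const 2
  refine this.congr_fun fun k => ?_
  simp only [hadamardPow, xiCoeff, Matrix.smul_apply, Matrix.hadamard_apply, Matrix.map_apply,
    smul_eq_mul, hD i j]
  ring

theorem potential_sub_le_pairing (hβ : IsMixedModel β) (h : Fin m → ℝ) (hA : A.PosSemidef)
    (hB : B.PosSemidef) (hA1 : ∀ i j, |A i j| ≤ 1) (hB1 : ∀ i j, |B i j| ≤ 1)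
    (hD : (B - A).PosSemidef ∨ (-(B - A)).PosSemidef) :
    potential β h B - potential β h A ≤ pairing (xiD β B + Matrix.vecMulVec h h) (B - A) := by
  have rem_nonneg (k : ℕ) := (posSemidef_iff_sum_nonneg.mp
    (posSemidef_hadamardPowRem hA hB (posSemidef_hadamard_self hD) k)).2 (β (k + 2))
  have := (hasSum_potential_taylor_remainder hβ h hA1 hB1 fun i j => by
    rw [Matrix.sub_apply, Matrix.sub_apply, apply_comm_of_posSemidef hA i j,
      apply_comm_of_posSemidef hB i j]).nonneg rem_nonneg
  linarith

theorem pairing_sub_potential_sub_le (hβ : IsMixedModel β) (h : Fin m → ℝ) (hA : A.PosSemidef)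
    (hB : B.PosSemidef) (hAQ : (Q - A).PosSemidef) (hBQ : (Q - B).PosSemidef)
    (hA1 : ∀ i j, |A i j| ≤ 1) (hB1 : ∀ i j, |B i j| ≤ 1) (hQ1 : ∀ i j, |Q i j| ≤ 1)
    (hD : (B - A).PosSemidef ∨ (-(B - A)).PosSemidef) :
    pairing (xiD β B + Matrix.vecMulVec h h) (B - A) - (potential β h B - potential β h A)
      ≤ pairing (xiDD β Q) ((B - A) ⊙ (B - A)) / 2 := by
  have hs (i j : Fin m) : (B - A) i j = (B - A) j i := by
    rw [Matrix.sub_apply, Matrix.sub_apply, apply_comm_of_posSemidef hA i j,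
      apply_comm_of_posSemidef hB i j]
  have hD2 := posSemidef_hadamard_self hD
  refine hasSum_le (fun k => ?_) (hasSum_potential_taylor_remainder hβ h hA1 hB1 hs)
    (hasSum_pairing_xiDD_half hβ hQ1 fun i j => apply_comm_of_posSemidef hD2 i j)
  have := (posSemidef_iff_sum_nonneg.mp
    (posSemidef_smul_hadamard_sub_hadamardPowRem hA hB hAQ hBQ hD2 k)).2 (β (k + 2))
  simp only [Matrix.sub_apply _ (hadamardPowRem A B k), mul_sub, Finset.sum_sub_distrib] at this
  linarith

end Potential

/-! ### Lipschitz functions and averages over a measure on the line -/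

section RealLine

variable {f g : ℝ → ℝ} {K L : ℝ≥0} {a b C : ℝ}

theorem lipschitzWith_finsetSum {ι : Type*} (s : Finset ι) {F : ι → ℝ → ℝ} {k : ι → ℝ≥0}
    (hF : ∀ i ∈ s, LipschitzWith (k i) (F i)) :
    LipschitzWith (∑ i ∈ s, k i) fun t => ∑ i ∈ s, F i t := by
  classical
  induction s using Finset.induction_on with
  | empty => simp
  | insert i s hi ih =>
    simp only [Finset.sum_insert hi]
    exact (hF i (by simp)).add (ih fun j hj => hF j (by simp [hj]))

theorem abs_sub_le_of_lipschitzWith (hf : LipschitzWith K f) (s t : ℝ) :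
    |f s - f t| ≤ K * |s - t| := by
  simpa only [Real.dist_eq] using hf.dist_le_mul s t

theorem abs_deriv_le_of_lipschitzWith (hf : LipschitzWith K f) (t : ℝ) : |deriv f t| ≤ K := by
  simpa using norm_deriv_le_of_lipschitz (x₀ := t) hf

theorem integral_deriv_of_lipschitzWith (hf : LipschitzWith K f) (a b : ℝ) :
    ∫ t in a..b, deriv f t = f b - f a :=
  (hf.lipschitzOnWith (s := uIcc a b)).absolutelyContinuousOnInterval.integral_deriv_eq_sub

theorem intervalIntegrable_of_abs_le (hf : Measurable f) (hC : ∀ t ∈ uIoc a b, |f t| ≤ C) :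
    IntervalIntegrable f volume a b := by
  rw [intervalIntegrable_iff]
  exact Measure.integrableOn_of_bounded (M := C) (by simp [uIoc]) hf.aestronglyMeasurable
    ((ae_restrict_iff' measurableSet_uIoc).mpr (ae_of_all _ hC))

theorem intervalIntegral_indicator_Ici (hab : a ≤ b) {r : ℝ} (hr : r ≤ b) (g : ℝ → ℝ) :
    ∫ t in a..b, (Ici r).indicator g t = ∫ t in max r a..b, g t := by
  rw [intervalIntegral.integral_of_le hab, setIntegral_indicator measurableSet_Ici,
    intervalIntegral.integral_of_le (max_le hr hab)]
  refine setIntegral_congr_set ?_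
  filter_upwards [Measure.ae_ne volume r] with t ht
  refine propext ⟨fun h => ⟨max_lt (lt_of_le_of_ne h.2 ht.symm) h.1.1, h.1.2⟩, fun h => ?_⟩
  exact ⟨⟨(le_max_right _ _).trans_lt h.1, h.2⟩, (le_max_left _ _).trans h.1.le⟩

theorem intervalIntegral_indicator_Iio (g : ℝ → ℝ) {s : ℝ} (ha : a ≤ s) (hb : s ≤ b) :
    ∫ t in a..b, (Iio s).indicator g t = ∫ t in a..s, g t := by
  rw [intervalIntegral.integral_of_le (ha.trans hb), setIntegral_indicator measurableSet_Iio,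
    intervalIntegral.integral_of_le ha]
  refine setIntegral_congr_set ?_
  filter_upwards [Measure.ae_ne volume s] with t ht
  exact propext ⟨fun h => ⟨h.1.1, h.2.le⟩, fun h => ⟨⟨h.1, h.2.trans hb⟩, lt_of_le_of_ne h.2 ht⟩⟩

variable {μ : Measure ℝ}

theorem integrable_of_abs_le [IsFiniteMeasure μ] (hf : Measurable f) (hC : ∀ t, |f t| ≤ C) :
    Integrable f μ :=
  Integrable.of_bound hf.aestronglyMeasurable C (ae_of_all _ hC)

theorem abs_integral_le_of_abs_le [IsProbabilityMeasure μ] (hC : ∀ s, |f s| ≤ C) :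
    |∫ s, f s ∂μ| ≤ C := by
  have norm_le : ∀ᵐ s ∂μ, ‖f s‖ ≤ C := ae_of_all _ hC
  simpa using norm_integral_le_of_norm_le_const norm_le

theorem intervalIntegral_integral_swap_of_abs_le [IsFiniteMeasure μ] {f : ℝ → ℝ → ℝ}
    (hf : Measurable (Function.uncurry f)) (hC : ∀ t ∈ uIoc a b, ∀ s, |f t s| ≤ C) :
    ∫ t in a..b, ∫ s, f t s ∂μ = ∫ s, (∫ t in a..b, f t s) ∂μ := by
  have : IsFiniteMeasure (volume.restrict (uIoc a b)) :=
    isFiniteMeasure_restrict.mpr (by simp [uIoc])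
  refine intervalIntegral_integral_swap (Integrable.of_bound (C := C) hf.aestronglyMeasurable ?_)
  have fst_mem : ∀ᵐ q ∂((volume.restrict (uIoc a b)).prod μ), q.1 ∈ uIoc a b :=
    Measure.quasiMeasurePreserving_fst.ae (ae_restrict_mem measurableSet_uIoc)
  filter_upwards [fst_mem] with q hq using hC _ hq _

end RealLine

section Distr

variable {μ : Measure ℝ} {f g : ℝ → ℝ} {K : ℝ≥0} {a b t C : ℝ}

theorem distr_mono (μ : Measure ℝ) [IsFiniteMeasure μ] : Monotone (distr μ) := fun _ _ hst =>
  measureReal_mono (Icc_subset_Icc_right hst)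

theorem distr_nonneg (μ : Measure ℝ) (t : ℝ) : 0 ≤ distr μ t := measureReal_nonneg

theorem distr_le_one (μ : Measure ℝ) [IsProbabilityMeasure μ] (t : ℝ) : distr μ t ≤ 1 :=
  measureReal_le_one

theorem ae_mem_Icc (h : μ (Icc a b)ᶜ = 0) : ∀ᵐ r ∂μ, r ∈ Icc a b := h

theorem distr_eq_integral_indicator (h : ∀ᵐ r ∂μ, 0 ≤ r) (t : ℝ) :
    distr μ t = ∫ r, (Iic t).indicator (fun _ => (1 : ℝ)) r ∂μ := by
  rw [integral_indicator_const _ measurableSet_Iic, smul_eq_mul, mul_one]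
  refine measureReal_congr ?_
  filter_upwards [h] with r hr
  exact propext ⟨And.right, And.intro hr⟩

theorem integral_distr_mul [IsFiniteMeasure μ] (h : ∀ᵐ r ∂μ, 0 ≤ r) (hg : Measurable g)
    (hC : ∀ t ∈ uIoc a b, |g t| ≤ C) :
    ∫ t in a..b, distr μ t * g t = ∫ s, (∫ t in a..b, (Ici s).indicator g t) ∂μ := by
  have distr_mul_eq (t : ℝ) : distr μ t * g t = ∫ s, (Ici s).indicator g t ∂μ := by
    rw [distr_eq_integral_indicator h, ← integral_mul_const]
    refine integral_congr_ae (ae_of_all _ fun s => ?_)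
    by_cases hs : s ≤ t <;> simp [indicator, hs]
  simp_rw [distr_mul_eq]
  have abs_indicator_le (t s : ℝ) : |(Ici s).indicator g t| ≤ |g t| :=
    norm_indicator_le_norm_self g t
  refine intervalIntegral_integral_swap_of_abs_le ?_ fun t ht s =>
    (abs_indicator_le t s).trans (hC t ht)
  have indicator_eq : Function.uncurry (fun t s => (Ici s).indicator g t)
      = {q : ℝ × ℝ | q.2 ≤ q.1}.indicator fun q => g q.1 := by
    ext q; simp [indicator, Function.uncurry]
  rw [indicator_eq]
  exact (hg.comp measurable_fst).indicator (measurableSet_le measurable_snd measurable_fst)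

theorem integral_distr_mul_deriv [IsFiniteMeasure μ] (h : μ (Icc 0 b)ᶜ = 0)
    (hf : LipschitzWith K f) (ht : t ≤ b) :
    ∫ s in t..b, distr μ s * deriv f s = ∫ r, (f b - f (max r t)) ∂μ := by
  rw [integral_distr_mul ((ae_mem_Icc h).mono fun r hr => hr.1) (measurable_deriv f)
    fun s _ => abs_deriv_le_of_lipschitzWith hf s]
  refine integral_congr_ae ?_
  filter_upwards [ae_mem_Icc h] with r hr
  rw [intervalIntegral_indicator_Ici ht hr.2, integral_deriv_of_lipschitzWith hf]

end Distr

section MatrixAverages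

variable {n : Type*} {μ : Measure ℝ}

theorem posSemidef_integral [Finite n] {F : ℝ → Matrix n n ℝ}
    (hF : ∀ i j, Integrable (fun s => F s i j) μ) (h : ∀ᵐ s ∂μ, (F s).PosSemidef) :
    (Matrix.of fun i j => ∫ s, F s i j ∂μ).PosSemidef := by
  have := Fintype.ofFinite n
  refine posSemidef_iff_sum_nonneg.mpr ⟨fun i j => integral_congr_ae ?_, fun v => ?_⟩
  · filter_upwards [h] with s hs using apply_comm_of_posSemidef hs i j
  · have form_eq : ∑ i, ∑ j, v i * v j * ∫ s, F s i j ∂μ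
        = ∫ s, ∑ i, ∑ j, v i * v j * F s i j ∂μ := by
      rw [integral_finsetSum _ fun i _ => integrable_finsetSum _ fun j _ => (hF i j).const_mul _]
      refine Finset.sum_congr rfl fun i _ => ?_
      rw [integral_finsetSum _ fun j _ => (hF i j).const_mul _]
      simp only [integral_const_mul]
    simp only [Matrix.of_apply, form_eq]
    refine integral_nonneg_of_ae ?_
    filter_upwards [h] with s hs using (posSemidef_iff_sum_nonneg.mp hs).2 v

/-- The weighted average `∫ w(s) F(s ∨ t) dμ(s)` of a matrix path. -/
def tail (μ : Measure ℝ) (w : ℝ → ℝ) (F : ℝ → Matrix n n ℝ) (t : ℝ) : Matrix n n ℝ :=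
  Matrix.of fun i j => ∫ s, w s * F (max s t) i j ∂μ

variable {w : ℝ → ℝ} {W C : ℝ} {K : ℝ≥0} {F : ℝ → Matrix n n ℝ}

theorem abs_mul_apply_max_le (hW : ∀ s, |w s| ≤ W) (hC : ∀ t i j, |F t i j| ≤ C) (s t : ℝ)
    (i j : n) : |w s * F (max s t) i j| ≤ W * C := by
  rw [abs_mul]
  exact mul_le_mul (hW s) (hC _ i j) (abs_nonneg _) ((abs_nonneg _).trans (hW s))

theorem integrable_tail [IsFiniteMeasure μ] (hw : Measurable w) (hW : ∀ s, |w s| ≤ W)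
    (hF : ∀ i j, Measurable fun t => F t i j) (hC : ∀ t i j, |F t i j| ≤ C) (t : ℝ) (i j : n) :
    Integrable (fun s => w s * F (max s t) i j) μ :=
  integrable_of_abs_le (hw.mul ((hF i j).comp (measurable_id.max measurable_const)))
    fun s => abs_mul_apply_max_le hW hC s t i j

theorem abs_tail_le [IsProbabilityMeasure μ] (hW : ∀ s, |w s| ≤ W) (hC : ∀ t i j, |F t i j| ≤ C)
    (t : ℝ) (i j : n) : |tail μ w F t i j| ≤ W * C :=
  abs_integral_le_of_abs_le fun s => abs_mul_apply_max_le hW hC s t i j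

theorem measurable_tail [SFinite μ] (hw : Measurable w) (hF : ∀ i j, Measurable fun t => F t i j)
    (i j : n) : Measurable fun t => tail μ w F t i j :=
  StronglyMeasurable.measurable (StronglyMeasurable.integral_prod_right'
    (f := fun p : ℝ × ℝ => w p.2 * F (max p.2 p.1) i j) (Measurable.stronglyMeasurable
      ((hw.comp measurable_snd).mul ((hF i j).comp (measurable_snd.max measurable_fst)))))

theorem lipschitzWith_tail [IsProbabilityMeasure μ] {W : ℝ≥0} (hw : Measurable w)
    (hW : ∀ s, |w s| ≤ W) (hC : ∀ t i j, |F t i j| ≤ C)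
    (hF : ∀ i j, LipschitzWith K fun t => F t i j) (i j : n) :
    LipschitzWith (W * K) fun t => tail μ w F t i j := by
  have integrable (t : ℝ) := integrable_tail (μ := μ) hw hW
    (fun i j => (hF i j).continuous.measurable) hC t i j
  refine LipschitzWith.of_dist_le_mul fun s t => ?_
  rw [Real.dist_eq, Real.dist_eq, tail, tail, Matrix.of_apply, Matrix.of_apply,
    ← integral_sub (integrable s) (integrable t)]
  refine abs_integral_le_of_abs_le fun r => ?_
  have abs_max_sub_le : |max r s - max r t| ≤ |s - t| :=
    (abs_max_sub_max_le_max r s r t).trans (by simp)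
  rw [← mul_sub, abs_mul, NNReal.coe_mul, mul_assoc]
  refine mul_le_mul (hW r) ?_ (abs_nonneg _) W.2
  exact (abs_sub_le_of_lipschitzWith (hF i j) _ _).trans (by gcongr)

end MatrixAverages

section PairingTail

variable {m : ℕ} {μ : Measure ℝ} {w : ℝ → ℝ} {W C : ℝ} {F : ℝ → Matrix (Fin m) (Fin m) ℝ}

theorem pairing_tail [IsFiniteMeasure μ] (hw : Measurable w) (hW : ∀ s, |w s| ≤ W)
    (hF : ∀ i j, Measurable fun t => F t i j) (hC : ∀ t i j, |F t i j| ≤ C)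
    (N : Matrix (Fin m) (Fin m) ℝ) (t : ℝ) :
    pairing N (tail μ w F t) = ∫ s, w s * pairing N (F (max s t)) ∂μ := by
  have integrable (i j : Fin m) : Integrable (fun s => w s * (N i j * F (max s t) j i)) μ := by
    simpa only [mul_left_comm] using (integrable_tail hw hW hF hC t j i).const_mul (N i j)
  simp only [pairing_eq_sum, tail, Matrix.of_apply, Finset.mul_sum]
  rw [integral_finsetSum _ fun i _ => integrable_finsetSum _ fun j _ => integrable i j]
  refine Finset.sum_congr rfl fun i _ => ?_
  rw [integral_finsetSum _ fun j _ => integrable i j]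
  simp only [mul_left_comm (w _), integral_const_mul]

theorem integral_pairing_tail [IsFiniteMeasure μ] (hw : Measurable w) (hW : ∀ s, |w s| ≤ W)
    (hF : ∀ i j, Measurable fun t => F t i j) (hC : ∀ t i j, |F t i j| ≤ C)
    {N : ℝ → Matrix (Fin m) (Fin m) ℝ} (hN : ∀ i j, Measurable fun t => N t i j) {a b c : ℝ}
    (hc : ∀ t ∈ uIoc a b, ∀ i j, |N t i j| ≤ c) :
    ∫ t in a..b, pairing (N t) (tail μ w F t)
      = ∫ s, w s * (∫ t in a..b, pairing (N t) (F (max s t))) ∂μ := by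
  simp_rw [pairing_tail hw hW hF hC, ← intervalIntegral.integral_const_mul]
  refine intervalIntegral_integral_swap_of_abs_le (C := W * (m * (m * (c * C)))) ?_
    fun t ht s => ?_
  · refine (hw.comp measurable_snd).mul (measurable_pairing (fun i j => ?_) fun i j => ?_)
    · exact (hN i j).comp measurable_fst
    · exact (hF i j).comp (measurable_snd.max measurable_fst)
  · rw [abs_mul]
    exact mul_le_mul (hW s) (abs_pairing_le (hc t ht) (hC _)) (abs_nonneg _)
      ((abs_nonneg _).trans (hW s))

end PairingTail

/-! ### Matrix paths on the line -/

section EntryDeriv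

variable {m : ℕ} {F : ℝ → Matrix (Fin m) (Fin m) ℝ} {K : ℝ≥0} {a b : ℝ}

/-- The two-sided entrywise derivative of a matrix path on the line. -/
def entryDeriv (F : ℝ → Matrix (Fin m) (Fin m) ℝ) (t : ℝ) : Matrix (Fin m) (Fin m) ℝ :=
  Matrix.of fun i j => deriv (fun s => F s i j) t

theorem pathDeriv_eq_entryDeriv (F : ℝ → Matrix (Fin m) (Fin m) ℝ) {t : ℝ}
    (ht : t ∈ Ioo (0 : ℝ) m) : pathDeriv F t = entryDeriv F t := by
  ext i j
  exact derivWithin_of_mem_nhds (Icc_mem_nhds ht.1 ht.2)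

theorem ae_pathDeriv_eq_entryDeriv (F : ℝ → Matrix (Fin m) (Fin m) ℝ) (ha : 0 ≤ a) (hab : a ≤ b)
    (hb : b ≤ m) : ∀ᵐ t : ℝ, t ∈ uIoc a b → pathDeriv F t = entryDeriv F t := by
  filter_upwards [Measure.ae_ne volume b] with s hs hmem
  rw [uIoc_of_le hab] at hmem
  exact pathDeriv_eq_entryDeriv F
    ⟨ha.trans_lt hmem.1, (lt_of_le_of_ne hmem.2 hs).trans_le hb⟩

theorem entryDeriv_apply_comm (h : ∀ t i j, F t i j = F t j i) (t : ℝ) (i j : Fin m) :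
    entryDeriv F t i j = entryDeriv F t j i := by
  simp only [entryDeriv, Matrix.of_apply, h _ i j]

theorem measurable_entryDeriv (F : ℝ → Matrix (Fin m) (Fin m) ℝ) (i j : Fin m) :
    Measurable fun t => entryDeriv F t i j := measurable_deriv _

theorem abs_entryDeriv_le (hF : ∀ i j, LipschitzWith K fun t => F t i j) (t : ℝ) (i j : Fin m) :
    |entryDeriv F t i j| ≤ K :=
  abs_deriv_le_of_lipschitzWith (hF i j) t

theorem ae_differentiableAt_apply (hF : ∀ i j, LipschitzWith K fun t => F t i j) :
    ∀ᵐ t : ℝ, ∀ i j, DifferentiableAt ℝ (fun s => F s i j) t :=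
  ae_all_iff.mpr fun i => ae_all_iff.mpr fun j => (hF i j).ae_differentiableAt_real

end EntryDeriv

section GlobalPath

variable {m : ℕ} {Q : Matrix (Fin m) (Fin m) ℝ} {Φ : ℝ → Matrix (Fin m) (Fin m) ℝ}

/-- Matrix paths on the whole line, constant outside `[0, m]`, increasing from `0` to `Q`, with
Lipschitz entries. Extending the paths of the variational problem in this way makes derivatives
two-sided. -/
structure GlobalPath (Q : Matrix (Fin m) (Fin m) ℝ) (Φ : ℝ → Matrix (Fin m) (Fin m) ℝ) :
    Prop where
  lipschitz : ∃ K : ℝ≥0, ∀ i j, LipschitzWith K fun t => Φ t i j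
  mono : ∀ s t, s ≤ t → (Φ t - Φ s).PosSemidef
  eq_zero : ∀ t ≤ 0, Φ t = 0
  eq_top : ∀ t, (m : ℝ) ≤ t → Φ t = Q

namespace GlobalPath

theorem posSemidef (hΦ : GlobalPath Q Φ) (t : ℝ) : (Φ t).PosSemidef := by
  have := hΦ.mono (min t 0) t (min_le_left _ _)
  rwa [hΦ.eq_zero _ (min_le_right _ _), sub_zero] at this

theorem le_top (hΦ : GlobalPath Q Φ) (t : ℝ) : (Q - Φ t).PosSemidef := by
  have := hΦ.mono t (max t m) (le_max_left _ _)
  rwa [hΦ.eq_top _ (le_max_right _ _)] at this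

theorem apply_comm (hΦ : GlobalPath Q Φ) (t : ℝ) (i j : Fin m) : Φ t i j = Φ t j i :=
  apply_comm_of_posSemidef (hΦ.posSemidef t) i j

theorem continuous_apply (hΦ : GlobalPath Q Φ) (i j : Fin m) : Continuous fun t => Φ t i j := by
  obtain ⟨K, hK⟩ := hΦ.lipschitz
  exact (hK i j).continuous

theorem abs_apply_le_one (hΦ : GlobalPath Q Φ) (hQ : ∀ i, Q i i ≤ 1) (t : ℝ) (i j : Fin m) :
    |Φ t i j| ≤ 1 := by
  have diag_le (k : Fin m) : Φ t k k ≤ 1 :=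
    (sub_nonneg.mp ((hΦ.le_top t).diag_nonneg (i := k))).trans (hQ k)
  linarith [abs_apply_le_of_posSemidef (hΦ.posSemidef t) i j, diag_le i, diag_le j]

theorem abs_top_sub_apply_le (hΦ : GlobalPath Q Φ) (t : ℝ) (i j : Fin m) :
    |(Q - Φ t) i j| ≤ Q.trace := by
  have trace_le : (Q - Φ t).trace ≤ Q.trace := by
    rw [Matrix.trace_sub]
    exact sub_le_self _ (hΦ.posSemidef t).trace_nonneg
  exact (abs_apply_le_trace_of_posSemidef (hΦ.le_top t) i j).trans trace_le

end GlobalPath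

/-- The closed form `∫ (Q - Φ(s ∨ t)) dμ(s)` of `Φ̂(t)`. -/
def hatTail (Q : Matrix (Fin m) (Fin m) ℝ) (μ : Measure ℝ) (Φ : ℝ → Matrix (Fin m) (Fin m) ℝ) :
    ℝ → Matrix (Fin m) (Fin m) ℝ :=
  tail μ (fun _ => 1) fun s => Q - Φ s

theorem GlobalPath.hatPath_eq_hatTail (hΦ : GlobalPath Q Φ) {μ : Measure ℝ} [IsFiniteMeasure μ]
    (hμ : μ (Icc (0 : ℝ) m)ᶜ = 0) {t : ℝ} (ht : t ∈ Icc (0 : ℝ) m) :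
    hatPath μ Φ t = hatTail Q μ Φ t := by
  obtain ⟨K, hK⟩ := hΦ.lipschitz
  ext i j
  calc hatPath μ Φ t i j = ∫ s in t..(m : ℝ), distr μ s * deriv (fun s => Φ s i j) s := by
        refine intervalIntegral.integral_congr_ae ?_
        filter_upwards [ae_pathDeriv_eq_entryDeriv Φ ht.1 ht.2 le_rfl] with s hs hmem
        rw [hs hmem, entryDeriv, Matrix.of_apply]
    _ = ∫ r, (Φ m i j - Φ (max r t) i j) ∂μ := integral_distr_mul_deriv hμ (hK i j) ht.2
    _ = hatTail Q μ Φ t i j := by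
        simp only [hΦ.eq_top m le_rfl, hatTail, tail, Matrix.of_apply, one_mul, Matrix.sub_apply]

variable {β : ℕ → Fin m → ℝ} {t : ℝ}

theorem GlobalPath.exists_lipschitzWith_potential (hβ : IsMixedModel β) (h : Fin m → ℝ)
    (hQ : ∀ i, Q i i ≤ 1) (hΦ : GlobalPath Q Φ) :
    ∃ K : ℝ≥0, LipschitzWith K fun t => potential β h (Φ t) := by
  obtain ⟨K, hK⟩ := hΦ.lipschitz
  obtain ⟨M, hM⟩ := hβ.exists_abs_mixtureDeriv_le
  have lipschitz_mixture (i j : Fin m) :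
      LipschitzOnWith M (mixture (xiCoeff β i j)) (Icc (-1) 1) :=
    (convex_Icc _ _).lipschitzOnWith_of_nnnorm_hasDerivWithin_le
      (fun a ha => (hasDerivAt_mixture (hβ.summable_xiCoeff i j)
        (abs_le.mpr ha)).hasDerivWithinAt)
      fun a ha => hM i j a (abs_le.mpr ha)
  have lipschitz_term (i j : Fin m) : LipschitzWith (M * K + ‖h i * h j‖₊ * K) fun t =>
      mixture (xiCoeff β i j) (Φ t i j) + h i * h j * Φ t i j :=
    (lipschitzOnWith_univ.mp ((lipschitz_mixture i j).comp (hK i j).lipschitzOnWith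
      fun t _ => abs_le.mp (hΦ.abs_apply_le_one hQ t i j))).add
      ((lipschitzWith_smul (h i * h j)).comp (hK i j))
  exact ⟨_, lipschitzWith_finsetSum _ fun i _ => lipschitzWith_finsetSum _ fun j _ =>
    lipschitz_term i j⟩

theorem GlobalPath.hasDerivAt_potential_comp (hβ : IsMixedModel β) (h : Fin m → ℝ)
    (hQ : ∀ i, Q i i ≤ 1) (hΦ : GlobalPath Q Φ)
    (ht : ∀ i j, DifferentiableAt ℝ (fun s => Φ s i j) t) :
    HasDerivAt (fun t => potential β h (Φ t))
      (pairing (xiD β (Φ t) + Matrix.vecMulVec h h) (entryDeriv Φ t)) t := by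
  rw [pairing_xiD_add_eq_sum β h (entryDeriv_apply_comm hΦ.apply_comm t)]
  refine HasDerivAt.fun_sum fun i _ => HasDerivAt.fun_sum fun j _ => ?_
  have deriv_mixture := (hasDerivAt_mixture (hβ.summable_xiCoeff i j)
    (hΦ.abs_apply_le_one hQ t i j)).comp t (ht i j).hasDerivAt
  exact (deriv_mixture.add ((ht i j).hasDerivAt.const_mul (h i * h j))).congr_deriv
    (add_mul _ _ _).symm

theorem GlobalPath.integral_distr_mul_pairing_xiD (hβ : IsMixedModel β) (h : Fin m → ℝ)
    (hQ : ∀ i, Q i i ≤ 1) (hΦ : GlobalPath Q Φ) {μ : Measure ℝ} [IsFiniteMeasure μ]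
    (hμ : μ (Icc (0 : ℝ) m)ᶜ = 0) :
    ∫ t in (0 : ℝ)..m, distr μ t * pairing (xiD β (Φ t) + Matrix.vecMulVec h h) (pathDeriv Φ t)
      = ∫ s, (potential β h Q - potential β h (Φ s)) ∂μ := by
  have hm : (0 : ℝ) ≤ m := Nat.cast_nonneg m
  obtain ⟨L, hL⟩ := hΦ.lipschitz
  obtain ⟨K, hK⟩ := hΦ.exists_lipschitzWith_potential hβ h hQ
  calc _ = ∫ t in (0 : ℝ)..m, distr μ t * deriv (fun s => potential β h (Φ s)) t := by
        refine intervalIntegral.integral_congr_ae ?_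
        filter_upwards [ae_pathDeriv_eq_entryDeriv Φ le_rfl hm le_rfl,
          ae_differentiableAt_apply hL] with s hs hd hmem
        rw [hs hmem, (hΦ.hasDerivAt_potential_comp hβ h hQ hd).deriv]
    _ = ∫ s, (potential β h (Φ m) - potential β h (Φ (max s 0))) ∂μ :=
        integral_distr_mul_deriv hμ hK hm
    _ = ∫ s, (potential β h Q - potential β h (Φ s)) ∂μ := by
        refine integral_congr_ae ?_
        filter_upwards [ae_mem_Icc hμ] with s hs
        rw [max_eq_left hs.1, hΦ.eq_top m le_rfl]

/-- The Crisanti-Sommers functional, up to the factor `1/2` and the term `log |Q - Φ(T)|`, after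
integration by parts. -/
def reduced (β : ℕ → Fin m → ℝ) (h : Fin m → ℝ) (Q : Matrix (Fin m) (Fin m) ℝ) (T : ℝ)
    (μ : Measure ℝ) (Φ : ℝ → Matrix (Fin m) (Fin m) ℝ) : ℝ :=
  (∫ s, (potential β h Q - potential β h (Φ s)) ∂μ)
    + ∫ t in (0 : ℝ)..T, pairing (hatTail Q μ Φ t)⁻¹ (entryDeriv Φ t)

theorem GlobalPath.crisantiSommers_eq (hβ : IsMixedModel β) (h : Fin m → ℝ) (hQ : ∀ i, Q i i ≤ 1)
    (hΦ : GlobalPath Q Φ) {μ : Measure ℝ} [IsFiniteMeasure μ] (hμ : μ (Icc (0 : ℝ) m)ᶜ = 0)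
    {T : ℝ} (hT : T ∈ Icc (0 : ℝ) m) :
    crisantiSommers β h T μ Φ = 1 / 2 * (reduced β h Q T μ Φ + Real.log (Q - Φ T).det) := by
  have pairing_hatPath_eq : ∫ t in (0 : ℝ)..T, pairing (hatPath μ Φ t)⁻¹ (pathDeriv Φ t)
      = ∫ t in (0 : ℝ)..T, pairing (hatTail Q μ Φ t)⁻¹ (entryDeriv Φ t) := by
    refine intervalIntegral.integral_congr_ae ?_
    filter_upwards [ae_pathDeriv_eq_entryDeriv Φ le_rfl hT.1 hT.2] with s hs hmem
    have mem_Ioc : s ∈ Ioc 0 T := uIoc_of_le hT.1 ▸ hmem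
    rw [hs hmem, hΦ.hatPath_eq_hatTail hμ ⟨mem_Ioc.1.le, mem_Ioc.2.trans hT.2⟩]
  rw [crisantiSommers, hΦ.integral_distr_mul_pairing_xiD hβ h hQ hμ, pairing_hatPath_eq,
    hΦ.eq_top m le_rfl, reduced]
  ring

end GlobalPath

section HatTail

variable {m : ℕ} {Q : Matrix (Fin m) (Fin m) ℝ} {μ : Measure ℝ}
  {Φ : ℝ → Matrix (Fin m) (Fin m) ℝ} {t : ℝ}

namespace GlobalPath

theorem measurable_top_sub_apply (hΦ : GlobalPath Q Φ) (i j : Fin m) :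
    Measurable fun t => (Q - Φ t) i j :=
  measurable_const.sub (hΦ.continuous_apply i j).measurable

theorem integrable_hatTail [IsFiniteMeasure μ] (hΦ : GlobalPath Q Φ) (t : ℝ) (i j : Fin m) :
    Integrable (fun s => (Q - Φ (max s t)) i j) μ := by
  simpa only [one_mul] using integrable_tail measurable_const (fun _ => abs_one.le)
    hΦ.measurable_top_sub_apply hΦ.abs_top_sub_apply_le t i j

theorem exists_lipschitzWith_hatTail [IsProbabilityMeasure μ] (hΦ : GlobalPath Q Φ) :
    ∃ K : ℝ≥0, ∀ i j, LipschitzWith K fun t => hatTail Q μ Φ t i j := by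
  obtain ⟨K, hK⟩ := hΦ.lipschitz
  exact ⟨_, lipschitzWith_tail (W := 1) measurable_const (fun _ => by simp)
    hΦ.abs_top_sub_apply_le fun i j => (LipschitzWith.const (Q i j)).sub (hK i j)⟩

theorem measurable_hatTail [SFinite μ] (hΦ : GlobalPath Q Φ) (i j : Fin m) :
    Measurable fun t => hatTail Q μ Φ t i j :=
  measurable_tail measurable_const hΦ.measurable_top_sub_apply i j

theorem hatTail_sub [IsProbabilityMeasure μ] (hΦ : GlobalPath Q Φ) (t : ℝ)
    (A : Matrix (Fin m) (Fin m) ℝ) :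
    hatTail Q μ Φ t - A = Matrix.of fun i j => ∫ s, (Q - Φ (max s t) - A) i j ∂μ := by
  ext i j
  simp only [hatTail, tail, one_mul, Matrix.of_apply, Matrix.sub_apply _ A]
  rw [integral_sub (hΦ.integrable_hatTail t i j) (integrable_const _), integral_const,
    probReal_univ, one_smul]

theorem hatTail_sub_posSemidef [IsProbabilityMeasure μ] (hΦ : GlobalPath Q Φ) {T : ℝ}
    (hμ : μ (Icc (0 : ℝ) T)ᶜ = 0) (ht : t ≤ T) : (hatTail Q μ Φ t - (Q - Φ T)).PosSemidef := by
  rw [hΦ.hatTail_sub]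
  refine posSemidef_integral
    (fun i j => (hΦ.integrable_hatTail t i j).sub (integrable_const _)) ?_
  filter_upwards [ae_mem_Icc hμ] with s hs
  rw [sub_sub_sub_cancel_left]
  exact hΦ.mono _ _ (max_le hs.2 ht)

theorem top_sub_hatTail_posSemidef [IsProbabilityMeasure μ] (hΦ : GlobalPath Q Φ) (t : ℝ) :
    (Q - hatTail Q μ Φ t).PosSemidef := by
  have eq_integral : Q - hatTail Q μ Φ t = Matrix.of fun i j => ∫ s, (Φ (max s t)) i j ∂μ := by
    rw [← neg_sub, hΦ.hatTail_sub]
    ext i j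
    simp [integral_neg]
  rw [eq_integral]
  refine posSemidef_integral (fun i j => ?_) (ae_of_all _ fun s => hΦ.posSemidef _)
  simpa [Pi.sub_def] using (integrable_const (μ := μ) (Q i j)).sub (hΦ.integrable_hatTail t i j)

end GlobalPath

/-- A pair given by a path on the line, with a point `T` beyond the support of the measure at
which `Q - Φ(T)` is still invertible. -/
structure CutPair (Q : Matrix (Fin m) (Fin m) ℝ) (μ : Measure ℝ)
    (Φ : ℝ → Matrix (Fin m) (Fin m) ℝ) (T : ℝ) : Prop where
  path : GlobalPath Q Φ
  prob : IsProbabilityMeasure μ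
  compl : μ (Icc (0 : ℝ) T)ᶜ = 0
  pos : 0 < T
  lt : T < m
  posDef : (Q - Φ T).PosDef

/-- The matrix `Φ̂⁻¹ Φ' Φ̂⁻¹`, which is the derivative of `Φ̂⁻¹` up to the factor `x(t)`. -/
def resolv (Q : Matrix (Fin m) (Fin m) ℝ) (μ : Measure ℝ) (Φ : ℝ → Matrix (Fin m) (Fin m) ℝ)
    (t : ℝ) : Matrix (Fin m) (Fin m) ℝ :=
  (hatTail Q μ Φ t)⁻¹ * entryDeriv Φ t * (hatTail Q μ Φ t)⁻¹

namespace CutPair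

variable {T : ℝ}

theorem compl_top (hp : CutPair Q μ Φ T) : μ (Icc (0 : ℝ) m)ᶜ = 0 :=
  measure_mono_null (compl_subset_compl.mpr (Icc_subset_Icc_right hp.lt.le)) hp.compl

theorem measurable_hatTail (hp : CutPair Q μ Φ T) (i j : Fin m) :
    Measurable fun t => hatTail Q μ Φ t i j :=
  have := hp.prob
  hp.path.measurable_hatTail i j

theorem measurable_inv_hatTail (hp : CutPair Q μ Φ T) (i j : Fin m) :
    Measurable fun t => (hatTail Q μ Φ t)⁻¹ i j :=
  measurable_inv_apply hp.measurable_hatTail i j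

theorem hatTail_sub_posSemidef (hp : CutPair Q μ Φ T) (ht : t ≤ T) :
    (hatTail Q μ Φ t - (Q - Φ T)).PosSemidef :=
  have := hp.prob
  hp.path.hatTail_sub_posSemidef hp.compl ht

theorem hatTail_posDef (hp : CutPair Q μ Φ T) (ht : t ≤ T) : (hatTail Q μ Φ t).PosDef :=
  posDef_of_le hp.posDef (hp.hatTail_sub_posSemidef ht)

theorem abs_inv_hatTail_le (hp : CutPair Q μ Φ T) (ht : t ≤ T) (i j : Fin m) :
    |(hatTail Q μ Φ t)⁻¹ i j| ≤ (Q - Φ T)⁻¹.trace :=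
  abs_inv_apply_le_of_le hp.posDef (hp.hatTail_sub_posSemidef ht) i j

theorem measurable_resolv (hp : CutPair Q μ Φ T) (i j : Fin m) :
    Measurable fun t => resolv Q μ Φ t i j :=
  measurable_mul_apply (measurable_mul_apply hp.measurable_inv_hatTail (measurable_entryDeriv Φ))
    hp.measurable_inv_hatTail i j

theorem exists_abs_resolv_le (hp : CutPair Q μ Φ T) :
    ∃ c : ℝ, ∀ t ≤ T, ∀ i j, |resolv Q μ Φ t i j| ≤ c := by
  obtain ⟨K, hK⟩ := hp.path.lipschitz
  exact ⟨_, fun t ht => abs_mul_apply_le (abs_mul_apply_le (hp.abs_inv_hatTail_le ht)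
    (abs_entryDeriv_le hK t)) (hp.abs_inv_hatTail_le ht)⟩

end CutPair

end HatTail

/-! ### First variations -/

section InverseExpansion

variable {m : ℕ} {A B P R : Matrix (Fin m) (Fin m) ℝ} {ε : ℝ}

theorem pairing_inv_add_smul (hA : A.PosDef) (hAε : (A + ε • B).PosDef)
    (P R : Matrix (Fin m) (Fin m) ℝ) :
    pairing (A + ε • B)⁻¹ (P + ε • R) = pairing A⁻¹ P
      + ε * (pairing A⁻¹ R - pairing (A⁻¹ * P * A⁻¹) B)
      + ε ^ 2 * (pairing ((A + ε • B)⁻¹ * B * A⁻¹ * B * A⁻¹) P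
        - pairing ((A + ε • B)⁻¹ * B * A⁻¹) R) := by
  set X := (A + ε • B)⁻¹
  set Y := A⁻¹
  have resolvent_identity : X = Y - ε • (X * B * Y) := by
    have inv_sub_inv : X - Y = X * (A - (A + ε • B)) * Y := inv_sub_inv_of_posDef hAε hA
    have sub_eq : A - (A + ε • B) = -(ε • B) := by abel
    rw [sub_eq, mul_neg, neg_mul, mul_smul_comm, smul_mul_assoc] at inv_sub_inv
    rw [sub_eq_add_neg, ← inv_sub_inv, add_sub_cancel]
  have second_order : X * B * Y = Y * B * Y - ε • (X * B * Y * B * Y) := by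
    conv_lhs => rw [resolvent_identity]
    simp only [sub_mul, smul_mul_assoc]
  have pairing_P : pairing X P = pairing Y P - ε * pairing (Y * P * Y) B
      + ε ^ 2 * pairing (X * B * Y * B * Y) P := by
    conv_lhs => rw [resolvent_identity, second_order]
    rw [pairing_sub_left, pairing_smul_left, pairing_sub_left, pairing_smul_left,
      pairing_conj_comm Y B P]
    ring
  have pairing_R : pairing X R = pairing Y R - ε * pairing (X * B * Y) R := by
    conv_lhs => rw [resolvent_identity]
    rw [pairing_sub_left, pairing_smul_left]
  rw [pairing_add_right, pairing_smul_right, pairing_P, pairing_R]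
  ring

theorem exists_pairing_inv_add_smul_le (m : ℕ) (c b p r : ℝ) : ∃ K : ℝ,
    ∀ (A B P R : Matrix (Fin m) (Fin m) ℝ) (ε : ℝ), A.PosDef → (A + ε • B).PosDef →
      (∀ i j, |A⁻¹ i j| ≤ c) → (∀ i j, |(A + ε • B)⁻¹ i j| ≤ c) → (∀ i j, |B i j| ≤ b) →
      (∀ i j, |P i j| ≤ p) → (∀ i j, |R i j| ≤ r) →
      pairing (A + ε • B)⁻¹ (P + ε • R) ≤ pairing A⁻¹ P
        + ε * (pairing A⁻¹ R - pairing (A⁻¹ * P * A⁻¹) B) + ε ^ 2 * K := by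
  let first := Fintype.card (Fin m) * (Fintype.card (Fin m) * (c * b) * c)
  let second := Fintype.card (Fin m) * (Fintype.card (Fin m) * (first * b) * c)
  refine ⟨m * (m * (second * p)) + m * (m * (first * r)),
    fun A B P R ε hA hAε hc hcε hb hp hr => ?_⟩
  have first_le := abs_mul_apply_le (abs_mul_apply_le hcε hb) hc
  have second_le := abs_mul_apply_le (abs_mul_apply_le first_le hb) hc
  rw [pairing_inv_add_smul hA hAε]
  gcongr
  exact (le_abs_self _).trans ((abs_sub _ _).trans
    (add_le_add (abs_pairing_le second_le hp) (abs_pairing_le first_le hr)))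

end InverseExpansion

theorem nonneg_of_forall_mul_add_sq_mul_nonneg {δ K ε₀ : ℝ} (hε₀ : 0 < ε₀)
    (h : ∀ ε, 0 < ε → ε ≤ ε₀ → 0 ≤ ε * δ + ε ^ 2 * K) : 0 ≤ δ := by
  have tendsto_quotient : Tendsto (fun ε : ℝ => δ + ε * K) (𝓝[>] 0) (𝓝 δ) :=
    tendsto_nhdsWithin_of_tendsto_nhds (Continuous.tendsto' (by fun_prop) _ _ (by simp))
  refine ge_of_tendsto tendsto_quotient ?_
  filter_upwards [Ioc_mem_nhdsGT hε₀] with ε hε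
  refine nonneg_of_mul_nonneg_right ?_ hε.1
  linarith [h ε hε.1 hε.2]

namespace CutPair

variable {m : ℕ} {Q : Matrix (Fin m) (Fin m) ℝ} {μ : Measure ℝ}
  {Φ : ℝ → Matrix (Fin m) (Fin m) ℝ} {T : ℝ}

theorem intervalIntegrable_pairing_inv_hatTail (hp : CutPair Q μ Φ T)
    {R : ℝ → Matrix (Fin m) (Fin m) ℝ} {r : ℝ} (hRm : ∀ i j, Measurable fun t => R t i j)
    (hR : ∀ t i j, |R t i j| ≤ r) {a b : ℝ} (ha : a ≤ T) (hb : b ≤ T) :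
    IntervalIntegrable (fun t => pairing (hatTail Q μ Φ t)⁻¹ (R t)) volume a b :=
  intervalIntegrable_of_abs_le (measurable_pairing hp.measurable_inv_hatTail hRm)
    fun t ht => abs_pairing_le (hp.abs_inv_hatTail_le (ht.2.trans (max_le ha hb))) (hR t)

theorem intervalIntegrable_pairing_resolv (hp : CutPair Q μ Φ T)
    {B : ℝ → Matrix (Fin m) (Fin m) ℝ} {c : ℝ} (hBm : ∀ i j, Measurable fun t => B t i j)
    (hB : ∀ t i j, |B t i j| ≤ c) {a b : ℝ} (ha : a ≤ T) (hb : b ≤ T) :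
    IntervalIntegrable (fun t => pairing (resolv Q μ Φ t) (B t)) volume a b := by
  obtain ⟨n, hn⟩ := hp.exists_abs_resolv_le
  exact intervalIntegrable_of_abs_le (measurable_pairing hp.measurable_resolv hBm)
    fun t ht => abs_pairing_le (hn t (ht.2.trans (max_le ha hb))) (hB t)

theorem exists_integral_pairing_inv_add_smul_le (hp : CutPair Q μ Φ T)
    {B R : ℝ → Matrix (Fin m) (Fin m) ℝ} {b r : ℝ} (hBm : ∀ i j, Measurable fun t => B t i j)
    (hRm : ∀ i j, Measurable fun t => R t i j) (hB : ∀ t i j, |B t i j| ≤ b)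
    (hR : ∀ t i j, |R t i j| ≤ r) :
    ∃ K : ℝ, ∀ ε : ℝ, (∀ t ≤ T, (hatTail Q μ Φ t + ε • B t - (Q - Φ T)).PosSemidef) →
      ∫ t in (0 : ℝ)..T, pairing (hatTail Q μ Φ t + ε • B t)⁻¹ (entryDeriv Φ t + ε • R t)
        ≤ (∫ t in (0 : ℝ)..T, pairing (hatTail Q μ Φ t)⁻¹ (entryDeriv Φ t))
          + ε * ((∫ t in (0 : ℝ)..T, pairing (hatTail Q μ Φ t)⁻¹ (R t))
            - ∫ t in (0 : ℝ)..T, pairing (resolv Q μ Φ t) (B t)) + ε ^ 2 * K := by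
  obtain ⟨L, hL⟩ := hp.path.lipschitz
  obtain ⟨K, hK⟩ := exists_pairing_inv_add_smul_le m (Q - Φ T)⁻¹.trace b L r
  have integrable_main := hp.intervalIntegrable_pairing_inv_hatTail (measurable_entryDeriv Φ)
    (abs_entryDeriv_le hL) hp.pos.le le_rfl
  have integrable_R := hp.intervalIntegrable_pairing_inv_hatTail hRm hR hp.pos.le le_rfl
  have integrable_B := hp.intervalIntegrable_pairing_resolv hBm hB hp.pos.le le_rfl
  refine ⟨T * K, fun ε hε => ?_⟩
  have abs_sum_le (t : ℝ) (i j : Fin m) : |(entryDeriv Φ t + ε • R t) i j| ≤ L + |ε| * r := by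
    refine (abs_add_le _ _).trans (add_le_add (abs_entryDeriv_le hL t i j) ?_)
    rw [Matrix.smul_apply, smul_eq_mul, abs_mul]
    exact mul_le_mul_of_nonneg_left (hR t i j) (abs_nonneg _)
  have integrable_ε : IntervalIntegrable (fun t =>
      pairing (hatTail Q μ Φ t + ε • B t)⁻¹ (entryDeriv Φ t + ε • R t)) volume 0 T :=
    intervalIntegrable_of_abs_le (measurable_pairing
      (measurable_inv_apply fun i j => (hp.measurable_hatTail i j).add ((hBm i j).const_mul ε))
      fun i j => (measurable_entryDeriv Φ i j).add ((hRm i j).const_mul ε))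
      fun t ht => abs_pairing_le (abs_inv_apply_le_of_le hp.posDef
        (hε t (ht.2.trans (max_le hp.pos.le le_rfl)))) (abs_sum_le t)
  have integrable_linear := (integrable_R.sub integrable_B).const_mul ε
  have integral_le := intervalIntegral.integral_mono_on hp.pos.le integrable_ε
    ((integrable_main.add integrable_linear).add (intervalIntegrable_const (c := ε ^ 2 * K)))
    fun t ht => hK _ _ _ _ ε (hp.hatTail_posDef ht.2) (posDef_of_le hp.posDef (hε t ht.2))
      (hp.abs_inv_hatTail_le ht.2) (abs_inv_apply_le_of_le hp.posDef (hε t ht.2)) (hB t)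
      (abs_entryDeriv_le hL t) (hR t)
  refine integral_le.trans_eq ?_
  rw [intervalIntegral.integral_add (integrable_main.add integrable_linear)
    intervalIntegrable_const, intervalIntegral.integral_add integrable_main integrable_linear,
    intervalIntegral.integral_const_mul, intervalIntegral.integral_sub integrable_R integrable_B]
  simp [mul_left_comm]

end CutPair

/-! ### Stationarity in the measure -/

section Tilt

variable {μ : Measure ℝ} {w : ℝ → ℝ} {W ε : ℝ}

/-- The measure `(1 + ε w) μ`. It is positive as soon as `|ε w| ≤ 1`, and it has the same mass as
`μ` when `w` has mean zero. -/
def tilt (μ : Measure ℝ) (w : ℝ → ℝ) (ε : ℝ) : Measure ℝ :=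
  μ.withDensity fun s => ENNReal.ofReal (1 + ε * w s)

theorem one_add_mul_nonneg (hW : ∀ s, |w s| ≤ W) (hε : |ε| * W ≤ 1) (s : ℝ) :
    0 ≤ 1 + ε * w s := by
  have abs_le_one : |ε * w s| ≤ 1 := by
    rw [abs_mul]
    exact (mul_le_mul_of_nonneg_left (hW s) (abs_nonneg ε)).trans hε
  linarith [(abs_le.mp abs_le_one).1]

theorem integral_tilt (hw : Measurable w) (hW : ∀ s, |w s| ≤ W) (hε : |ε| * W ≤ 1) {g : ℝ → ℝ}
    (hg : Integrable g μ) (hwg : Integrable (fun s => w s * g s) μ) :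
    ∫ s, g s ∂(tilt μ w ε) = (∫ s, g s ∂μ) + ε * ∫ s, w s * g s ∂μ := by
  rw [tilt, integral_withDensity_eq_integral_toReal_smul (by fun_prop)
    (ae_of_all _ fun s => ENNReal.ofReal_lt_top), ← integral_const_mul,
    ← integral_add hg (hwg.const_mul ε)]
  refine integral_congr_ae (ae_of_all _ fun s => ?_)
  simp only [smul_eq_mul, ENNReal.toReal_ofReal (one_add_mul_nonneg hW hε s)]
  ring

theorem isProbabilityMeasure_tilt [IsProbabilityMeasure μ] (hw : Measurable w)
    (hW : ∀ s, |w s| ≤ W) (hε : |ε| * W ≤ 1) (hmean : ∫ s, w s ∂μ = 0) :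
    IsProbabilityMeasure (tilt μ w ε) := by
  have integrable_w := (integrable_of_abs_le (μ := μ) hw hW).const_mul ε
  have integrable_density : Integrable (fun s => 1 + ε * w s) μ :=
    (integrable_const 1).add integrable_w
  constructor
  rw [tilt, withDensity_apply _ MeasurableSet.univ, Measure.restrict_univ,
    ← ofReal_integral_eq_lintegral_ofReal integrable_density
      (ae_of_all _ (one_add_mul_nonneg hW hε)),
    integral_add (integrable_const _) integrable_w, integral_const_mul, hmean]
  simp

theorem tilt_absolutelyContinuous (μ : Measure ℝ) (w : ℝ → ℝ) (ε : ℝ) : tilt μ w ε ≪ μ :=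
  withDensity_absolutelyContinuous _ _

end Tilt

/-- A function that correlates nonnegatively with its own negative fluctuation `∫ f dμ - f` has
variance zero. -/
theorem eq_integral_of_mem_support {μ : Measure ℝ} [IsProbabilityMeasure μ] {f : ℝ → ℝ} {C : ℝ}
    (hf : Continuous f) (hC : ∀ s, |f s| ≤ C) (h : 0 ≤ ∫ s, ((∫ r, f r ∂μ) - f s) * f s ∂μ)
    {s : ℝ} (hs : s ∈ μ.support) : f s = ∫ r, f r ∂μ := by
  have memLp : MemLp f 2 μ :=
    .of_bound hf.aestronglyMeasurable C (ae_of_all _ hC)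
  have variance_eq : ProbabilityTheory.variance f μ = -∫ s, ((∫ r, f r ∂μ) - f s) * f s ∂μ := by
    rw [ProbabilityTheory.variance_eq_sub memLp]
    simp_rw [sub_mul, ← pow_two]
    rw [integral_sub ((memLp.integrable one_le_two).const_mul _) memLp.integrable_sq,
      integral_const_mul, neg_sub, pow_two (∫ r, f r ∂μ)]
    rfl
  have variance_eq_zero : ProbabilityTheory.variance f μ = 0 :=
    le_antisymm (by linarith) (ProbabilityTheory.variance_nonneg f μ)
  exact Measure.support_subset_of_isClosed (isClosed_eq hf continuous_const)
    (ProbabilityTheory.ae_eq_integral_of_variance_eq_zero memLp variance_eq_zero) hs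

section MassDeriv

variable {m : ℕ} {β : ℕ → Fin m → ℝ} {Q : Matrix (Fin m) (Fin m) ℝ} {μ : Measure ℝ}
  {Φ : ℝ → Matrix (Fin m) (Fin m) ℝ} {T : ℝ}

theorem GlobalPath.exists_abs_potential_le (hβ : IsMixedModel β) (h : Fin m → ℝ)
    (hQ : ∀ i, Q i i ≤ 1) (hΦ : GlobalPath Q Φ) : ∃ C : ℝ, ∀ s, |potential β h (Φ s)| ≤ C := by
  obtain ⟨K, hK⟩ := hΦ.exists_lipschitzWith_potential hβ h hQ
  obtain ⟨C, hC⟩ := (isCompact_Icc (a := (0 : ℝ)) (b := m)).exists_bound_of_continuousOn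
    hK.continuous.continuousOn
  have hm : (0 : ℝ) ≤ m := Nat.cast_nonneg m
  refine ⟨C, fun s => ?_⟩
  rcases le_total s 0 with hs | hs
  · rw [hΦ.eq_zero s hs, ← hΦ.eq_zero 0 le_rfl]
    exact hC 0 (left_mem_Icc.mpr hm)
  rcases le_total s m with hsm | hsm
  · exact hC s ⟨hs, hsm⟩
  · rw [hΦ.eq_top s hsm, ← hΦ.eq_top m le_rfl]
    exact hC m (right_mem_Icc.mpr hm)

/-- The derivative of `reduced` in the direction of a point mass at `s`. -/
def massDeriv (β : ℕ → Fin m → ℝ) (h : Fin m → ℝ) (Q : Matrix (Fin m) (Fin m) ℝ) (T : ℝ)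
    (μ : Measure ℝ) (Φ : ℝ → Matrix (Fin m) (Fin m) ℝ) (s : ℝ) : ℝ :=
  potential β h Q - potential β h (Φ s)
    - ∫ t in (0 : ℝ)..T, pairing (resolv Q μ Φ t) (Q - Φ (max s t))

namespace CutPair

theorem le_of_mem_uIoc (hp : CutPair Q μ Φ T) {t : ℝ} (ht : t ∈ uIoc 0 T) : t ≤ T :=
  ht.2.trans (max_le hp.pos.le le_rfl)

theorem measurable_top_sub_max (hp : CutPair Q μ Φ T) (s : ℝ) (i j : Fin m) :
    Measurable fun t => (Q - Φ (max s t)) i j :=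
  (hp.path.measurable_top_sub_apply i j).comp (measurable_const.max measurable_id)

theorem continuous_massDeriv (hβ : IsMixedModel β) (h : Fin m → ℝ) (hQ : ∀ i, Q i i ≤ 1)
    (hp : CutPair Q μ Φ T) : Continuous (massDeriv β h Q T μ Φ) := by
  obtain ⟨K, hK⟩ := hp.path.exists_lipschitzWith_potential hβ h hQ
  obtain ⟨c, hc⟩ := hp.exists_abs_resolv_le
  refine (continuous_const.sub hK.continuous).sub
    (intervalIntegral.continuous_of_dominated_interval
      (bound := fun _ => m * (m * (c * Q.trace)))
      (fun s => (measurable_pairing hp.measurable_resolv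
        (hp.measurable_top_sub_max s)).aestronglyMeasurable)
      (fun s => ae_of_all _ fun t ht =>
        abs_pairing_le (hc t (hp.le_of_mem_uIoc ht)) (hp.path.abs_top_sub_apply_le _))
      intervalIntegrable_const (ae_of_all _ fun t _ => ?_))
  simp only [pairing_eq_sum]
  exact continuous_finsetSum _ fun i _ => continuous_finsetSum _ fun j _ =>
    continuous_const.mul (continuous_const.sub
      ((hp.path.continuous_apply j i).comp (continuous_id.max continuous_const)))

theorem exists_abs_massDeriv_le (hβ : IsMixedModel β) (h : Fin m → ℝ) (hQ : ∀ i, Q i i ≤ 1)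
    (hp : CutPair Q μ Φ T) : ∃ C : ℝ, ∀ s, |massDeriv β h Q T μ Φ s| ≤ C := by
  obtain ⟨C, hC⟩ := hp.path.exists_abs_potential_le hβ h hQ
  obtain ⟨c, hc⟩ := hp.exists_abs_resolv_le
  have abs_integral_le (s : ℝ) :
      |∫ t in (0 : ℝ)..T, pairing (resolv Q μ Φ t) (Q - Φ (max s t))|
        ≤ m * (m * (c * Q.trace)) * |T - 0| := by
    rw [← Real.norm_eq_abs]
    exact intervalIntegral.norm_integral_le_of_norm_le_const fun t ht =>
      abs_pairing_le (hc t (hp.le_of_mem_uIoc ht)) (hp.path.abs_top_sub_apply_le _)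
  exact ⟨|potential β h Q| + C + m * (m * (c * Q.trace)) * |T - 0|, fun s =>
    (abs_sub _ _).trans (add_le_add ((abs_sub _ _).trans (by gcongr; exact hC s))
      (abs_integral_le s))⟩

variable {w : ℝ → ℝ} {W ε : ℝ}

theorem tilt (hp : CutPair Q μ Φ T) (hw : Measurable w) (hW : ∀ s, |w s| ≤ W)
    (hε : |ε| * W ≤ 1) (hmean : ∫ s, w s ∂μ = 0) : CutPair Q (tilt μ w ε) Φ T :=
  have := hp.prob
  { hp with
    prob := isProbabilityMeasure_tilt hw hW hε hmean
    compl := tilt_absolutelyContinuous μ w ε hp.compl }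

theorem hatTail_tilt (hp : CutPair Q μ Φ T) (hw : Measurable w) (hW : ∀ s, |w s| ≤ W)
    (hε : |ε| * W ≤ 1) (t : ℝ) :
    hatTail Q (VectorSpin.tilt μ w ε) Φ t
      = hatTail Q μ Φ t + ε • tail μ w (fun s => Q - Φ s) t := by
  have := hp.prob
  ext i j
  simp only [hatTail, tail, Matrix.add_apply, Matrix.smul_apply, Matrix.of_apply, smul_eq_mul,
    one_mul]
  exact integral_tilt hw hW hε (hp.path.integrable_hatTail t i j)
    (integrable_tail hw hW hp.path.measurable_top_sub_apply hp.path.abs_top_sub_apply_le t i j)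

theorem integrable_mul_top_sub_potential (hβ : IsMixedModel β) (h : Fin m → ℝ)
    (hQ : ∀ i, Q i i ≤ 1) (hp : CutPair Q μ Φ T) (hw : Measurable w) (hW : ∀ s, |w s| ≤ W) :
    Integrable (fun s => w s * (potential β h Q - potential β h (Φ s))) μ := by
  have := hp.prob
  obtain ⟨L, hL⟩ := hp.path.exists_lipschitzWith_potential hβ h hQ
  obtain ⟨C, hC⟩ := hp.path.exists_abs_potential_le hβ h hQ
  exact integrable_of_abs_le (C := W * (|potential β h Q| + C))
    (hw.mul (measurable_const.sub hL.continuous.measurable)) fun s => by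
      rw [abs_mul]
      exact mul_le_mul (hW s) ((abs_sub _ _).trans (by gcongr; exact hC s)) (abs_nonneg _)
        ((abs_nonneg _).trans (hW s))

theorem integral_mul_massDeriv (hβ : IsMixedModel β) (h : Fin m → ℝ) (hQ : ∀ i, Q i i ≤ 1)
    (hp : CutPair Q μ Φ T) (hw : Measurable w) (hW : ∀ s, |w s| ≤ W) :
    ∫ s, w s * massDeriv β h Q T μ Φ s ∂μ
      = (∫ s, w s * (potential β h Q - potential β h (Φ s)) ∂μ)
        - ∫ t in (0 : ℝ)..T, pairing (resolv Q μ Φ t) (tail μ w (fun s => Q - Φ s) t) := by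
  have := hp.prob
  obtain ⟨c, hc⟩ := hp.exists_abs_resolv_le
  obtain ⟨D, hD⟩ := hp.exists_abs_massDeriv_le hβ h hQ
  have integrable_massDeriv : Integrable (fun s => w s * massDeriv β h Q T μ Φ s) μ :=
    integrable_of_abs_le (C := W * D)
      (hw.mul (hp.continuous_massDeriv hβ h hQ).measurable) fun s => by
        rw [abs_mul]
        exact mul_le_mul (hW s) (hD s) (abs_nonneg _) ((abs_nonneg _).trans (hW s))
  rw [integral_pairing_tail hw hW hp.path.measurable_top_sub_apply
    hp.path.abs_top_sub_apply_le hp.measurable_resolv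
    (fun t ht => hc t (hp.le_of_mem_uIoc ht)), eq_sub_iff_add_eq', ← eq_sub_iff_add_eq,
    ← integral_sub (hp.integrable_mul_top_sub_potential hβ h hQ hw hW) integrable_massDeriv]
  refine integral_congr_ae (ae_of_all _ fun s => ?_)
  simp only [massDeriv]
  ring

theorem exists_reduced_tilt_le (hβ : IsMixedModel β) (h : Fin m → ℝ) (hQ : ∀ i, Q i i ≤ 1)
    (hp : CutPair Q μ Φ T) (hw : Measurable w) (hW : ∀ s, |w s| ≤ W) (hmean : ∫ s, w s ∂μ = 0) :
    ∃ K : ℝ, ∀ ε, |ε| * W ≤ 1 → reduced β h Q T (VectorSpin.tilt μ w ε) Φ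
      ≤ reduced β h Q T μ Φ + ε * (∫ s, w s * massDeriv β h Q T μ Φ s ∂μ) + ε ^ 2 * K := by
  have := hp.prob
  obtain ⟨K, hK⟩ := hp.exists_integral_pairing_inv_add_smul_le (R := fun _ => 0) (r := 0)
    (measurable_tail (μ := μ) hw hp.path.measurable_top_sub_apply) (by simp)
    (abs_tail_le hW hp.path.abs_top_sub_apply_le) (by simp)
  refine ⟨K, fun ε hε => ?_⟩
  have integral_le := hK ε fun t ht => by
    rw [← hp.hatTail_tilt hw hW hε]
    exact (hp.tilt hw hW hε hmean).hatTail_sub_posSemidef ht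
  have pairing_zero (A : Matrix (Fin m) (Fin m) ℝ) : pairing A 0 = 0 := by simp [pairing]
  simp only [smul_zero, add_zero, pairing_zero, intervalIntegral.integral_zero, zero_sub,
    mul_neg] at integral_le
  have integrable_potential : Integrable (fun s => potential β h Q - potential β h (Φ s)) μ := by
    simpa only [one_mul] using hp.integrable_mul_top_sub_potential hβ h hQ (w := fun _ => 1)
      measurable_const fun _ => abs_one.le
  rw [reduced, reduced, integral_tilt hw hW hε integrable_potential
    (hp.integrable_mul_top_sub_potential hβ h hQ hw hW),
    hp.integral_mul_massDeriv hβ h hQ hw hW]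
  simp only [hp.hatTail_tilt hw hW hε]
  linarith

theorem massDeriv_eq_of_mem_support (hβ : IsMixedModel β) (h : Fin m → ℝ)
    (hQ : ∀ i, Q i i ≤ 1) (hp : CutPair Q μ Φ T)
    (hmin : ∀ (w : ℝ → ℝ) (W ε : ℝ), Measurable w → (∀ s, |w s| ≤ W) → ∫ s, w s ∂μ = 0 →
      |ε| * W ≤ 1 → reduced β h Q T μ Φ ≤ reduced β h Q T (VectorSpin.tilt μ w ε) Φ)
    {s u : ℝ} (hs : s ∈ μ.support) (hu : u ∈ μ.support) :
    massDeriv β h Q T μ Φ s = massDeriv β h Q T μ Φ u := by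
  have := hp.prob
  have continuous := hp.continuous_massDeriv hβ h hQ
  obtain ⟨D, hD⟩ := hp.exists_abs_massDeriv_le hβ h hQ
  set mean := ∫ r, massDeriv β h Q T μ Φ r ∂μ with mean_def
  have measurable_w : Measurable fun r => mean - massDeriv β h Q T μ Φ r :=
    measurable_const.sub continuous.measurable
  have abs_w_le (r : ℝ) : |mean - massDeriv β h Q T μ Φ r| ≤ |mean| + D :=
    (abs_sub _ _).trans (by gcongr; exact hD r)
  have mean_w : ∫ r, (mean - massDeriv β h Q T μ Φ r) ∂μ = 0 := by
    rw [integral_sub (integrable_const _) (integrable_of_abs_le continuous.measurable hD),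
      integral_const, probReal_univ, one_smul, mean_def, sub_self]
  obtain ⟨K, hK⟩ := hp.exists_reduced_tilt_le hβ h hQ measurable_w abs_w_le mean_w
  have bound_pos : 0 < |mean| + D + 1 := by linarith [(abs_nonneg _).trans (abs_w_le 0)]
  have variation_nonneg : 0 ≤ ∫ r, (mean - massDeriv β h Q T μ Φ r)
      * massDeriv β h Q T μ Φ r ∂μ := by
    refine nonneg_of_forall_mul_add_sq_mul_nonneg (K := K) (one_div_pos.mpr bound_pos)
      fun ε hε hεW => ?_
    have small : |ε| * (|mean| + D) ≤ 1 := by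
      rw [le_div_iff₀ bound_pos] at hεW
      rw [abs_of_pos hε]
      linarith
    linarith [hmin _ _ ε measurable_w abs_w_le mean_w small, hK ε small]
  rw [eq_integral_of_mem_support continuous hD variation_nonneg hs,
    eq_integral_of_mem_support continuous hD variation_nonneg hu]

end CutPair

end MassDeriv

/-! ### Integration by parts -/

section IntegrationByParts

variable {m : ℕ} {A B : ℝ → Matrix (Fin m) (Fin m) ℝ} {a b : ℝ}

theorem integral_pairing_entryDeriv
    (hA : ∀ i j, AbsolutelyContinuousOnInterval (fun t => A t i j) a b)
    (hB : ∀ i j, AbsolutelyContinuousOnInterval (fun t => B t i j) a b) :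
    ∫ t in a..b, pairing (A t) (entryDeriv B t)
      = pairing (A b) (B b) - pairing (A a) (B a)
        - ∫ t in a..b, pairing (entryDeriv A t) (B t) := by
  have integrable_left (i j : Fin m) :
      IntervalIntegrable (fun t => A t i j * entryDeriv B t j i) volume a b :=
    (hB j i).intervalIntegrable_deriv.continuousOn_mul (hA i j).continuousOn
  have integrable_right (i j : Fin m) :
      IntervalIntegrable (fun t => entryDeriv A t i j * B t j i) volume a b :=
    (hA i j).intervalIntegrable_deriv.mul_continuousOn (hB j i).continuousOn
  have integral_sum {f : Fin m → Fin m → ℝ → ℝ}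
      (hf : ∀ i j, IntervalIntegrable (f i j) volume a b) :
      ∫ t in a..b, ∑ i, ∑ j, f i j t = ∑ i, ∑ j, ∫ t in a..b, f i j t := by
    rw [intervalIntegral.integral_finsetSum fun i _ => by
      simpa only [Finset.sum_fn] using IntervalIntegrable.sum Finset.univ fun j _ => hf i j]
    exact Finset.sum_congr rfl fun i _ => intervalIntegral.integral_finsetSum fun j _ => hf i j
  simp only [pairing_eq_sum]
  rw [integral_sum integrable_left, integral_sum integrable_right]
  simp only [← Finset.sum_sub_distrib]
  exact Finset.sum_congr rfl fun i _ => Finset.sum_congr rfl fun j _ =>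
    (hA i j).integral_mul_deriv_eq_deriv_mul (hB j i)

variable {K : ℝ≥0} {Φ : ℝ → Matrix (Fin m) (Fin m) ℝ}

theorem conj_apply (X P : Matrix (Fin m) (Fin m) ℝ) (i j : Fin m) :
    (X * P * X) i j = ∑ l, ∑ k, X l j • X i k • P k l := by
  simp only [Matrix.mul_apply, Finset.sum_mul, smul_eq_mul]
  exact Finset.sum_congr rfl fun l _ => Finset.sum_congr rfl fun k _ => by ring

theorem entryDeriv_conj {t : ℝ} (hΦ : ∀ i j, DifferentiableAt ℝ (fun s => Φ s i j) t)
    (X P : Matrix (Fin m) (Fin m) ℝ) :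
    entryDeriv (fun s => X * (Φ s - P) * X) t = X * entryDeriv Φ t * X := by
  ext i j
  simp only [entryDeriv, Matrix.of_apply, conj_apply]
  exact (HasDerivAt.fun_sum fun l _ => HasDerivAt.fun_sum fun k _ =>
    (((hΦ k l).hasDerivAt.sub_const (P k l)).const_smul (X i k)).const_smul (X l j)).deriv

theorem integral_pairing_conj_entryDeriv (hΦ : ∀ i j, LipschitzWith K fun t => Φ t i j)
    (X : Matrix (Fin m) (Fin m) ℝ) (u s : ℝ) :
    ∫ t in u..s, pairing (X * entryDeriv Φ t * X) (Φ t - Φ u)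
      = pairing (X * (Φ s - Φ u) * X) (Φ s - Φ u) / 2 := by
  have lipschitz_increment (i j : Fin m) : LipschitzWith (K + 0) fun t => (Φ t - Φ u) i j :=
    (hΦ i j).sub (LipschitzWith.const (Φ u i j))
  have conj_increment (i j : Fin m) :
      AbsolutelyContinuousOnInterval (fun t => (X * (Φ t - Φ u) * X) i j) u s := by
    simp only [conj_apply]
    exact (lipschitzWith_finsetSum _ fun l _ => lipschitzWith_finsetSum _ fun k _ =>
      (lipschitzWith_smul (X l j)).comp ((lipschitzWith_smul (X i k)).comp
        (lipschitz_increment k l))).lipschitzOnWith.absolutelyContinuousOnInterval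
  have by_parts := integral_pairing_entryDeriv conj_increment
    fun i j => (lipschitz_increment i j).lipschitzOnWith.absolutelyContinuousOnInterval
  have entryDeriv_increment (t : ℝ) : entryDeriv (fun r => Φ r - Φ u) t = entryDeriv Φ t := by
    ext i j
    exact deriv_sub_const _
  have integral_entryDeriv_conj :
      ∫ t in u..s, pairing (entryDeriv (fun r => X * (Φ r - Φ u) * X) t) (Φ t - Φ u)
        = ∫ t in u..s, pairing (X * entryDeriv Φ t * X) (Φ t - Φ u) := by
    refine intervalIntegral.integral_congr_ae ?_
    filter_upwards [ae_differentiableAt_apply hΦ] with t ht _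
    rw [entryDeriv_conj ht]
  rw [integral_entryDeriv_conj] at by_parts
  simp only [entryDeriv_increment, pairing_conj_comm X (Φ _ - Φ u) (entryDeriv Φ _), sub_self,
    mul_zero, zero_mul] at by_parts
  rw [pairing_eq_sum 0 0] at by_parts
  simp only [Matrix.zero_apply, mul_zero, Finset.sum_const_zero] at by_parts
  linarith

end IntegrationByParts

/-! ### Stationarity in the path -/

namespace CutPair

variable {m : ℕ} {Q : Matrix (Fin m) (Fin m) ℝ} {μ : Measure ℝ}
  {Φ Ψ : ℝ → Matrix (Fin m) (Fin m) ℝ} {T : ℝ} {L : ℝ≥0}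

theorem exists_lipschitzOnWith_inv_hatTail (hp : CutPair Q μ Φ T) :
    ∃ K : ℝ≥0, ∀ i j, LipschitzOnWith K (fun s => (hatTail Q μ Φ s)⁻¹ i j) (Iic T) := by
  have := hp.prob
  obtain ⟨K, hK⟩ := hp.path.exists_lipschitzWith_hatTail (μ := μ)
  set n := (Fintype.card (Fin m) : ℝ)
  set c := (Q - Φ T)⁻¹.trace
  refine ⟨_, fun i j => LipschitzOnWith.of_dist_le' (K := n * (n * (c * K) * c))
    fun s hs t ht => ?_⟩
  refine (abs_inv_sub_inv_apply_le (hp.hatTail_posDef hs) (hp.hatTail_posDef ht)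
    (hp.abs_inv_hatTail_le hs) (hp.abs_inv_hatTail_le ht)
    (fun k l => abs_sub_le_of_lipschitzWith (hK k l) t s) i j).trans_eq ?_
  rw [Real.dist_eq, abs_sub_comm s t]
  ring

theorem ae_hasDerivAt_hatTail (hp : CutPair Q μ Φ T) :
    ∀ᵐ t : ℝ, t ∈ Ioo 0 T → ∀ i j,
      HasDerivAt (fun s => hatTail Q μ Φ s i j) (-(distr μ t • entryDeriv Φ t) i j) t := by
  have := hp.prob
  obtain ⟨K, hK⟩ := hp.path.lipschitz
  have integrable (i j : Fin m) :
      IntervalIntegrable (fun s => distr μ s * deriv (fun r => Φ r i j) s) volume 0 m :=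
    intervalIntegrable_of_abs_le (C := 1 * K)
      ((distr_mono μ).measurable.mul (measurable_deriv _)) fun t _ => by
        rw [abs_mul, abs_of_nonneg (distr_nonneg μ t)]
        exact mul_le_mul (distr_le_one μ t) (abs_deriv_le_of_lipschitzWith (hK i j) t)
          (abs_nonneg _) zero_le_one
  have ae_hasDerivAt_integral := ae_all_iff.mpr fun i => ae_all_iff.mpr fun j =>
    (integrable i j).ae_hasDerivAt_integral
  filter_upwards [ae_hasDerivAt_integral] with t ht hmem i j
  have mem_uIcc : t ∈ uIcc (0 : ℝ) m := by
    rw [uIcc_of_le (Nat.cast_nonneg m)]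
    exact ⟨hmem.1.le, hmem.2.le.trans hp.lt.le⟩
  refine (ht i j mem_uIcc m right_mem_uIcc).neg.congr_of_eventuallyEq ?_
  filter_upwards [Iio_mem_nhds (hmem.2.trans hp.lt)] with s hs
  rw [Pi.neg_apply, ← intervalIntegral.integral_symm,
    integral_distr_mul_deriv hp.compl_top (hK i j) (le_of_lt hs), hp.path.eq_top m le_rfl]
  simp only [hatTail, tail, Matrix.of_apply, one_mul, Matrix.sub_apply]

theorem ae_hasDerivAt_inv_hatTail (hp : CutPair Q μ Φ T) :
    ∀ᵐ t : ℝ, t ∈ Ioo 0 T → ∀ i j,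
      HasDerivAt (fun s => (hatTail Q μ Φ s)⁻¹ i j) (distr μ t * resolv Q μ Φ t i j) t := by
  filter_upwards [hp.ae_hasDerivAt_hatTail] with t ht hmem i j
  refine (hasDerivAt_inv_apply (A' := -(distr μ t • entryDeriv Φ t)) (ht hmem)
    (hp.hatTail_posDef hmem.2.le).isUnit i j).congr_deriv ?_
  simp [resolv]

theorem integral_pairing_inv_hatTail (hp : CutPair Q μ Φ T)
    (hΨ : ∀ i j, LipschitzWith L fun t => Ψ t i j) (h0 : Ψ 0 = 0) (hT : Ψ T = 0) :
    ∫ t in (0 : ℝ)..T, pairing (hatTail Q μ Φ t)⁻¹ (entryDeriv Ψ t)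
      = -∫ t in (0 : ℝ)..T, distr μ t * pairing (resolv Q μ Φ t) (Ψ t) := by
  obtain ⟨K, hK⟩ := hp.exists_lipschitzOnWith_inv_hatTail
  have uIcc_subset : uIcc 0 T ⊆ Iic T := by
    rw [uIcc_of_le hp.pos.le]
    exact Icc_subset_Iic_self
  rw [integral_pairing_entryDeriv
    (fun i j => ((hK i j).mono uIcc_subset).absolutelyContinuousOnInterval)
    (fun i j => (hΨ i j).lipschitzOnWith.absolutelyContinuousOnInterval), h0, hT]
  have integral_entryDeriv_inv :
      ∫ t in (0 : ℝ)..T, pairing (entryDeriv (fun s => (hatTail Q μ Φ s)⁻¹) t) (Ψ t)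
        = ∫ t in (0 : ℝ)..T, distr μ t * pairing (resolv Q μ Φ t) (Ψ t) := by
    refine intervalIntegral.integral_congr_ae ?_
    filter_upwards [hp.ae_hasDerivAt_inv_hatTail, Measure.ae_ne volume T] with t ht htT hmem
    rw [uIoc_of_le hp.pos.le] at hmem
    have entryDeriv_eq : entryDeriv (fun s => (hatTail Q μ Φ s)⁻¹) t
        = distr μ t • resolv Q μ Φ t := by
      ext i j
      exact (ht ⟨hmem.1, lt_of_le_of_ne hmem.2 htT⟩ i j).deriv
    rw [entryDeriv_eq, pairing_smul_left]
  rw [integral_entryDeriv_inv]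
  simp [pairing]

end CutPair

section PathVariation

variable {m : ℕ} {Q : Matrix (Fin m) (Fin m) ℝ} {μ : Measure ℝ}
  {Φ Ψ : ℝ → Matrix (Fin m) (Fin m) ℝ} {T C : ℝ} {L : ℝ≥0}

theorem integrable_of_continuousOn_Icc [IsFiniteMeasure μ] {f : ℝ → ℝ} {a b : ℝ}
    (hμ : μ (Icc a b)ᶜ = 0) (hf : ContinuousOn f (Icc a b)) : Integrable f μ := by
  have restrict_eq : μ.restrict (Icc a b) = μ :=
    Measure.restrict_eq_self_of_ae_mem (ae_mem_Icc hμ)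
  rw [← restrict_eq]
  exact hf.integrableOn_compact isCompact_Icc

theorem pairing_tail_sub_distr_mul [IsFiniteMeasure μ] (hμ : ∀ᵐ r ∂μ, 0 ≤ r)
    (hΨ : ∀ i j, Measurable fun t => Ψ t i j) (hC : ∀ t i j, |Ψ t i j| ≤ C)
    (N : Matrix (Fin m) (Fin m) ℝ) (t : ℝ) :
    pairing N (tail μ (fun _ => 1) Ψ t) - distr μ t * pairing N (Ψ t)
      = ∫ s, (Ioi t).indicator (fun s => pairing N (Ψ s)) s ∂μ := by
  obtain ⟨n, -, hn⟩ := exists_forall_abs_apply_le N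
  have integrable_tail : Integrable (fun s => 1 * pairing N (Ψ (max s t))) μ :=
    integrable_of_abs_le (C := m * (m * (n * C)))
      ((measurable_pairing (A := fun _ => N) (fun i j => measurable_const) fun i j =>
        (hΨ i j).comp (measurable_id.max measurable_const)).const_mul 1) fun s => by
          rw [one_mul]
          exact abs_pairing_le hn (hC _)
  rw [pairing_tail measurable_const (fun _ => abs_one.le) hΨ hC, distr_eq_integral_indicator hμ,
    ← integral_mul_const, ← integral_sub integrable_tail
      (((integrable_const 1).indicator measurableSet_Iic).mul_const _)]
  refine integral_congr_ae (ae_of_all _ fun s => ?_)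
  rcases lt_or_ge t s with hts | hts
  · simp [hts, hts.le, not_le.mpr hts]
  · simp [hts, not_lt.mpr hts]

/-- The primitive of `Φ̂⁻¹ Φ' Φ̂⁻¹`. -/
def cumResolv (Q : Matrix (Fin m) (Fin m) ℝ) (μ : Measure ℝ) (Φ : ℝ → Matrix (Fin m) (Fin m) ℝ)
    (s : ℝ) : Matrix (Fin m) (Fin m) ℝ :=
  Matrix.of fun i j => ∫ t in (0 : ℝ)..s, resolv Q μ Φ t i j

/-- The gradient of `reduced` with respect to the position of the path at `s`, per unit of
`μ`-mass. -/
def pathGradient (β : ℕ → Fin m → ℝ) (h : Fin m → ℝ) (Q : Matrix (Fin m) (Fin m) ℝ)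
    (μ : Measure ℝ) (Φ : ℝ → Matrix (Fin m) (Fin m) ℝ) (s : ℝ) : Matrix (Fin m) (Fin m) ℝ :=
  cumResolv Q μ Φ s - (xiD β (Φ s) + Matrix.vecMulVec h h)

namespace CutPair

theorem intervalIntegrable_resolv (hp : CutPair Q μ Φ T) {a b : ℝ} (ha : a ≤ T) (hb : b ≤ T)
    (i j : Fin m) : IntervalIntegrable (fun t => resolv Q μ Φ t i j) volume a b := by
  obtain ⟨c, hc⟩ := hp.exists_abs_resolv_le
  exact intervalIntegrable_of_abs_le (hp.measurable_resolv i j) fun t ht =>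
    hc t (ht.2.trans (max_le ha hb)) i j

theorem pairing_cumResolv (hp : CutPair Q μ Φ T) {s : ℝ} (hs : s ≤ T)
    (D : Matrix (Fin m) (Fin m) ℝ) :
    pairing (cumResolv Q μ Φ s) D = ∫ t in (0 : ℝ)..s, pairing (resolv Q μ Φ t) D := by
  have integrable (i j : Fin m) :
      IntervalIntegrable (fun t => resolv Q μ Φ t i j * D j i) volume 0 s :=
    (hp.intervalIntegrable_resolv hp.pos.le hs i j).mul_const _
  simp only [pairing_eq_sum, cumResolv, Matrix.of_apply, ← intervalIntegral.integral_mul_const]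
  rw [intervalIntegral.integral_finsetSum fun i _ => by
    simpa only [Finset.sum_fn] using IntervalIntegrable.sum Finset.univ fun j _ => integrable i j]
  exact Finset.sum_congr rfl fun i _ =>
    (intervalIntegral.integral_finsetSum fun j _ => integrable i j).symm

theorem continuousOn_cumResolv (hp : CutPair Q μ Φ T) (i j : Fin m) :
    ContinuousOn (fun s => cumResolv Q μ Φ s i j) (Icc 0 T) := by
  have integrableOn : IntegrableOn (fun t => resolv Q μ Φ t i j) (uIcc 0 T) volume := by
    rw [uIcc_of_le hp.pos.le, integrableOn_Icc_iff_integrableOn_Ioc]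
    exact (hp.intervalIntegrable_resolv hp.pos.le le_rfl i j).1
  rw [← uIcc_of_le hp.pos.le]
  exact intervalIntegral.continuousOn_primitive_interval integrableOn

/-- Integration by parts, followed by an exchange of the integrals over `t` and `μ`. -/
theorem integral_pairing_inv_hatTail_add (hp : CutPair Q μ Φ T)
    (hΨ : ∀ i j, LipschitzWith L fun t => Ψ t i j) (hC : ∀ t i j, |Ψ t i j| ≤ C)
    (h0 : Ψ 0 = 0) (hT : Ψ T = 0) :
    (∫ t in (0 : ℝ)..T, pairing (hatTail Q μ Φ t)⁻¹ (entryDeriv Ψ t))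
        + ∫ t in (0 : ℝ)..T, pairing (resolv Q μ Φ t) (tail μ (fun _ => 1) Ψ t)
      = ∫ s, pairing (cumResolv Q μ Φ s) (Ψ s) ∂μ := by
  have := hp.prob
  obtain ⟨c, hc⟩ := hp.exists_abs_resolv_le
  have measurable_Ψ (i j : Fin m) : Measurable fun t => Ψ t i j := (hΨ i j).continuous.measurable
  have integrable_tail := hp.intervalIntegrable_pairing_resolv
    (measurable_tail (μ := μ) measurable_const measurable_Ψ)
    (abs_tail_le (fun _ => abs_one.le) hC) hp.pos.le le_rfl
  have measurable_pairing_Ψ := measurable_pairing hp.measurable_resolv measurable_Ψ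
  have integrable_distr : IntervalIntegrable
      (fun t => distr μ t * pairing (resolv Q μ Φ t) (Ψ t)) volume 0 T :=
    intervalIntegrable_of_abs_le ((distr_mono μ).measurable.mul measurable_pairing_Ψ)
      fun t ht => by
        rw [abs_mul, abs_of_nonneg (distr_nonneg μ t)]
        exact mul_le_mul (distr_le_one μ t) (abs_pairing_le (hc t (hp.le_of_mem_uIoc ht)) (hC t))
          (abs_nonneg _) zero_le_one
  rw [hp.integral_pairing_inv_hatTail hΨ h0 hT, neg_add_eq_sub,
    ← intervalIntegral.integral_sub integrable_tail integrable_distr]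
  simp only [pairing_tail_sub_distr_mul ((ae_mem_Icc hp.compl).mono fun _ hr => hr.1)
    measurable_Ψ hC]
  rw [intervalIntegral_integral_swap_of_abs_le (C := m * (m * (c * C)))]
  · refine integral_congr_ae ?_
    filter_upwards [ae_mem_Icc hp.compl] with s hs
    rw [hp.pairing_cumResolv hs.2, ← intervalIntegral_indicator_Iio _ hs.1 hs.2]
    exact intervalIntegral.integral_congr fun t _ => by simp [indicator]
  · have : Measurable fun q : ℝ × ℝ => {q : ℝ × ℝ | q.1 < q.2}.indicator
        (fun q => pairing (resolv Q μ Φ q.1) (Ψ q.2)) q :=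
      (measurable_pairing (fun i j => (hp.measurable_resolv i j).comp measurable_fst) fun i j =>
        (measurable_Ψ i j).comp measurable_snd).indicator
        (measurableSet_lt measurable_fst measurable_snd)
    exact this
  · exact fun t ht s =>
      (norm_indicator_le_norm_self (fun s => pairing (resolv Q μ Φ t) (Ψ s)) s).trans
        (abs_pairing_le (hc t (hp.le_of_mem_uIoc ht)) (hC s))

end CutPair

end PathVariation

section FirstVariation

variable {m : ℕ} {β : ℕ → Fin m → ℝ} {Q : Matrix (Fin m) (Fin m) ℝ} {μ : Measure ℝ}
  {Φ Ψ : ℝ → Matrix (Fin m) (Fin m) ℝ} {T C ε : ℝ} {L : ℝ≥0}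

theorem GlobalPath.hatTail_add_smul [IsFiniteMeasure μ] (hΦ : GlobalPath Q Φ)
    (hΨ : ∀ i j, Measurable fun t => Ψ t i j) (hC : ∀ t i j, |Ψ t i j| ≤ C) (ε t : ℝ) :
    hatTail Q μ (fun s => Φ s + ε • Ψ s) t
      = hatTail Q μ Φ t + ε • -tail μ (fun _ => 1) Ψ t := by
  ext i j
  have integrable_Ψ : Integrable (fun s => Ψ (max s t) i j) μ := by
    simpa only [one_mul] using
      integrable_tail (μ := μ) measurable_const (fun _ => abs_one.le) hΨ hC t i j
  simp only [hatTail, tail, one_mul, Matrix.add_apply, Matrix.smul_apply, Matrix.neg_apply,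
    Matrix.of_apply, smul_eq_mul, mul_neg]
  rw [← integral_const_mul, ← sub_eq_add_neg,
    ← integral_sub (hΦ.integrable_hatTail t i j) (integrable_Ψ.const_mul ε)]
  simp [sub_sub]

theorem entryDeriv_add_smul {t : ℝ} (hΦ : ∀ i j, DifferentiableAt ℝ (fun s => Φ s i j) t)
    (hΨ : ∀ i j, DifferentiableAt ℝ (fun s => Ψ s i j) t) :
    entryDeriv (fun s => Φ s + ε • Ψ s) t = entryDeriv Φ t + ε • entryDeriv Ψ t := by
  ext i j
  exact ((hΦ i j).hasDerivAt.add ((hΨ i j).hasDerivAt.const_mul ε)).deriv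

namespace CutPair

theorem integrable_potential (hβ : IsMixedModel β) (h : Fin m → ℝ) (hQ : ∀ i, Q i i ≤ 1)
    (hp : CutPair Q μ Φ T) : Integrable (fun s => potential β h (Φ s)) μ := by
  have := hp.prob
  obtain ⟨K, hK⟩ := hp.path.exists_lipschitzWith_potential hβ h hQ
  exact integrable_of_continuousOn_Icc hp.compl hK.continuous.continuousOn

theorem integrable_pairing_cumResolv (hp : CutPair Q μ Φ T)
    (hΨ : ∀ i j, Continuous fun s => Ψ s i j) :
    Integrable (fun s => pairing (cumResolv Q μ Φ s) (Ψ s)) μ := by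
  have := hp.prob
  simp only [pairing_eq_sum]
  exact integrable_of_continuousOn_Icc hp.compl <| continuousOn_finsetSum _ fun i _ =>
    continuousOn_finsetSum _ fun j _ =>
      (hp.continuousOn_cumResolv i j).mul (hΨ j i).continuousOn

theorem integrable_pairing_xiD_add (hβ : IsMixedModel β) (h : Fin m → ℝ) (hQ : ∀ i, Q i i ≤ 1)
    (hp : CutPair Q μ Φ T) (hΨ : ∀ i j, Continuous fun s => Ψ s i j) :
    Integrable (fun s => pairing (xiD β (Φ s) + Matrix.vecMulVec h h) (Ψ s)) μ := by
  have := hp.prob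
  simp only [pairing_eq_sum]
  exact integrable_of_continuousOn_Icc hp.compl <| continuousOn_finsetSum _ fun i _ =>
    continuousOn_finsetSum _ fun j _ =>
      (((continuousOn_mixtureDeriv (hβ.summable_xiCoeff i j)).comp
        (hp.path.continuous_apply i j).continuousOn fun s _ =>
          abs_le.mp (hp.path.abs_apply_le_one hQ s i j)).add continuousOn_const).mul
        (hΨ j i).continuousOn

theorem integral_pairing_pathGradient (hβ : IsMixedModel β) (h : Fin m → ℝ)
    (hQ : ∀ i, Q i i ≤ 1) (hp : CutPair Q μ Φ T) (hΨ : ∀ i j, Continuous fun s => Ψ s i j) :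
    ∫ s, pairing (pathGradient β h Q μ Φ s) (Ψ s) ∂μ
      = (∫ s, pairing (cumResolv Q μ Φ s) (Ψ s) ∂μ)
        - ∫ s, pairing (xiD β (Φ s) + Matrix.vecMulVec h h) (Ψ s) ∂μ := by
  simp only [pathGradient, pairing_sub_left]
  exact integral_sub (hp.integrable_pairing_cumResolv hΨ)
    (hp.integrable_pairing_xiD_add hβ h hQ hΨ)

theorem integral_potential_add_smul_le (hβ : IsMixedModel β) (h : Fin m → ℝ)
    (hQ : ∀ i, Q i i ≤ 1) (hp : CutPair Q μ Φ T) (hΨ : ∀ i j, Continuous fun s => Ψ s i j)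
    (hsign : ∀ s, (Ψ s).PosSemidef ∨ (-Ψ s).PosSemidef) (hε : 0 < ε)
    (hpε : CutPair Q μ (fun s => Φ s + ε • Ψ s) T) :
    ∫ s, (potential β h Q - potential β h (Φ s + ε • Ψ s)) ∂μ
      ≤ (∫ s, (potential β h Q - potential β h (Φ s)) ∂μ)
        - ε * ∫ s, pairing (xiD β (Φ s) + Matrix.vecMulVec h h) (Ψ s) ∂μ := by
  have := hp.prob
  have integrable_base : Integrable (fun s => potential β h Q - potential β h (Φ s)) μ :=
    (integrable_const _).sub (hp.integrable_potential hβ h hQ)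
  have integrable_slope := (hp.integrable_pairing_xiD_add hβ h hQ hΨ).const_mul ε
  rw [← integral_const_mul, ← integral_sub integrable_base integrable_slope]
  refine integral_mono ((integrable_const _).sub (hpε.integrable_potential hβ h hQ))
    (integrable_base.sub integrable_slope) fun s => ?_
  have increment : Φ s - (Φ s + ε • Ψ s) = -(ε • Ψ s) := by abel
  have sign : (Φ s - (Φ s + ε • Ψ s)).PosSemidef ∨ (-(Φ s - (Φ s + ε • Ψ s))).PosSemidef := by
    rw [increment, neg_neg, ← smul_neg]
    exact (hsign s).symm.imp (·.smul hε.le) (·.smul hε.le)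
  have convexity := potential_sub_le_pairing hβ h (hpε.path.posSemidef s) (hp.path.posSemidef s)
    (hpε.path.abs_apply_le_one hQ s) (hp.path.abs_apply_le_one hQ s) sign
  rw [increment, ← smul_neg, pairing_smul_right, ← neg_one_smul ℝ (Ψ s), pairing_smul_right]
    at convexity
  linarith

theorem exists_reduced_add_smul_le (hβ : IsMixedModel β) (h : Fin m → ℝ) (hQ : ∀ i, Q i i ≤ 1)
    (hp : CutPair Q μ Φ T) (hΨ : ∀ i j, LipschitzWith L fun t => Ψ t i j)
    (hC : ∀ t i j, |Ψ t i j| ≤ C) (h0 : Ψ 0 = 0) (hT : Ψ T = 0)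
    (hsign : ∀ s, (Ψ s).PosSemidef ∨ (-Ψ s).PosSemidef) :
    ∃ K : ℝ, ∀ ε, 0 < ε → CutPair Q μ (fun s => Φ s + ε • Ψ s) T →
      reduced β h Q T μ (fun s => Φ s + ε • Ψ s)
        ≤ reduced β h Q T μ Φ + ε * (∫ s, pairing (pathGradient β h Q μ Φ s) (Ψ s) ∂μ)
          + ε ^ 2 * K := by
  have := hp.prob
  obtain ⟨LΦ, hLΦ⟩ := hp.path.lipschitz
  have continuous_Ψ (i j : Fin m) := (hΨ i j).continuous
  have measurable_Ψ (i j : Fin m) := (continuous_Ψ i j).measurable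
  obtain ⟨K, hK⟩ := hp.exists_integral_pairing_inv_add_smul_le
    (B := fun t => -tail μ (fun _ => 1) Ψ t) (R := entryDeriv Ψ)
    (fun i j => (measurable_tail measurable_const measurable_Ψ i j).neg)
    (measurable_entryDeriv Ψ)
    (fun t i j => (abs_neg _).trans_le (abs_tail_le (fun _ => abs_one.le) hC t i j))
    (abs_entryDeriv_le hΨ)
  refine ⟨K, fun ε hε hpε => ?_⟩
  have hatTail_eq := hp.path.hatTail_add_smul (μ := μ) measurable_Ψ hC ε
  have integral_le := hK ε fun t ht => by
    rw [← hatTail_eq t]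
    simpa only [hT, smul_zero, add_zero] using hpε.hatTail_sub_posSemidef ht
  have integral_eq : ∫ t in (0 : ℝ)..T, pairing (hatTail Q μ (fun s => Φ s + ε • Ψ s) t)⁻¹
        (entryDeriv (fun s => Φ s + ε • Ψ s) t)
      = ∫ t in (0 : ℝ)..T, pairing (hatTail Q μ Φ t + ε • -tail μ (fun _ => 1) Ψ t)⁻¹
        (entryDeriv Φ t + ε • entryDeriv Ψ t) := by
    refine intervalIntegral.integral_congr_ae ?_
    filter_upwards [ae_differentiableAt_apply hLΦ, ae_differentiableAt_apply hΨ] with t hΦt hΨt _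
    rw [hatTail_eq, entryDeriv_add_smul hΦt hΨt]
  have pairing_neg_right (A B : Matrix (Fin m) (Fin m) ℝ) : pairing A (-B) = -pairing A B := by
    rw [← neg_one_smul ℝ B, pairing_smul_right, neg_one_mul]
  simp only [pairing_neg_right, intervalIntegral.integral_neg, sub_neg_eq_add,
    hp.integral_pairing_inv_hatTail_add hΨ hC h0 hT] at integral_le
  rw [reduced, reduced, integral_eq, hp.integral_pairing_pathGradient hβ h hQ continuous_Ψ]
  linarith [hp.integral_potential_add_smul_le hβ h hQ continuous_Ψ hsign hε hpε]

theorem integral_pairing_pathGradient_nonneg (hβ : IsMixedModel β) (h : Fin m → ℝ)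
    (hQ : ∀ i, Q i i ≤ 1) (hp : CutPair Q μ Φ T) (hΨ : ∀ i j, LipschitzWith L fun t => Ψ t i j)
    (hC : ∀ t i j, |Ψ t i j| ≤ C) (h0 : Ψ 0 = 0) (hT : Ψ T = 0)
    (hsign : ∀ s, (Ψ s).PosSemidef ∨ (-Ψ s).PosSemidef) {ε₀ : ℝ} (hε₀ : 0 < ε₀)
    (hmin : ∀ ε, 0 < ε → ε ≤ ε₀ → CutPair Q μ (fun s => Φ s + ε • Ψ s) T ∧
      reduced β h Q T μ Φ ≤ reduced β h Q T μ (fun s => Φ s + ε • Ψ s)) :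
    0 ≤ ∫ s, pairing (pathGradient β h Q μ Φ s) (Ψ s) ∂μ := by
  obtain ⟨K, hK⟩ := hp.exists_reduced_add_smul_le hβ h hQ hΨ hC h0 hT hsign
  refine nonneg_of_forall_mul_add_sq_mul_nonneg (K := K) hε₀ fun ε hε hle => ?_
  obtain ⟨hpε, reduced_le⟩ := hmin ε hε hle
  linarith [hK ε hε hpε]

end CutPair

end FirstVariation

/-! ### Stability -/

section Stability

variable {m : ℕ} {β : ℕ → Fin m → ℝ} {Q : Matrix (Fin m) (Fin m) ℝ} {μ : Measure ℝ}
  {Φ : ℝ → Matrix (Fin m) (Fin m) ℝ} {T u s : ℝ}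

/-- The quadratic form `⟨ξ''(Q), D^{∘2}⟩ - ⟨Q⁻¹ D, Q⁻¹ D⟩` of the stability condition. -/
def stabForm (β : ℕ → Fin m → ℝ) (Q D : Matrix (Fin m) (Fin m) ℝ) : ℝ :=
  pairing (xiDD β Q) (D ⊙ D) - pairing (Q⁻¹ * D) (Q⁻¹ * D)

theorem stabForm_smul (β : ℕ → Fin m → ℝ) (Q D : Matrix (Fin m) (Fin m) ℝ) (c : ℝ) :
    stabForm β Q (c • D) = c ^ 2 * stabForm β Q D := by
  have hadamard_smul : (c • D) ⊙ (c • D) = c ^ 2 • (D ⊙ D) := by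
    ext i j
    simp only [Matrix.hadamard_apply, Matrix.smul_apply, smul_eq_mul]
    ring
  rw [stabForm, stabForm, hadamard_smul, pairing_smul_right, Matrix.mul_smul, pairing_smul_left,
    pairing_smul_right]
  ring

theorem tendsto_stabForm (β : ℕ → Fin m → ℝ) (Q : Matrix (Fin m) (Fin m) ℝ) {α : Type*}
    {l : Filter α} {D : α → Matrix (Fin m) (Fin m) ℝ} {V : Matrix (Fin m) (Fin m) ℝ}
    (hD : ∀ i j, Tendsto (fun t => D t i j) l (𝓝 (V i j))) :
    Tendsto (fun t => stabForm β Q (D t)) l (𝓝 (stabForm β Q V)) := by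
  have tendsto_mul (i j : Fin m) :
      Tendsto (fun t => (Q⁻¹ * D t) i j) l (𝓝 ((Q⁻¹ * V) i j)) := by
    simp only [Matrix.mul_apply]
    exact tendsto_finsetSum _ fun k _ => (hD k j).const_mul _
  exact (tendsto_pairing (A := fun _ => xiDD β Q) (fun i j => tendsto_const_nhds)
    fun i j => (hD i j).mul (hD i j)).sub (tendsto_pairing tendsto_mul tendsto_mul)

theorem exists_stabForm_sub_le
    (hdiff : ∀ i j, DifferentiableWithinAt ℝ (fun t => Φ t i j) (Icc (0 : ℝ) m) u)
    (hlt : stabForm β Q (pathDeriv Φ u) < 0) :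
    ∃ c > 0, ∃ δ > 0, ∀ s ∈ Icc (0 : ℝ) m, |s - u| < δ → s ≠ u →
      stabForm β Q (Φ s - Φ u) ≤ -c * (s - u) ^ 2 := by
  have tendsto_slope (i j : Fin m) : Tendsto (fun s => ((s - u)⁻¹ • (Φ s - Φ u)) i j)
      (𝓝[Icc (0 : ℝ) m \ {u}] u) (𝓝 (pathDeriv Φ u i j)) :=
    hasDerivWithinAt_iff_tendsto_slope.mp (hdiff i j).hasDerivWithinAt
  obtain ⟨b, deriv_lt, b_neg⟩ := exists_between hlt
  obtain ⟨δ, hδ, ball_subset⟩ := Metric.mem_nhdsWithin_iff.mp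
    ((tendsto_stabForm β Q tendsto_slope).eventually (gt_mem_nhds deriv_lt))
  refine ⟨-b, neg_pos.mpr b_neg, δ, hδ, fun s hs hsδ hsu => ?_⟩
  have slope_lt : stabForm β Q ((s - u)⁻¹ • (Φ s - Φ u)) < b :=
    ball_subset ⟨by rwa [Metric.mem_ball, Real.dist_eq], hs, hsu⟩
  calc stabForm β Q (Φ s - Φ u)
      = stabForm β Q ((s - u)⁻¹ • (Φ s - Φ u)) * (s - u) ^ 2 := by
        have := sub_ne_zero.mpr hsu
        rw [stabForm_smul]
        field_simp
    _ ≤ - -b * (s - u) ^ 2 := by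
        rw [neg_neg]
        exact mul_le_mul_of_nonneg_right slope_lt.le (sq_nonneg _)

theorem GlobalPath.sub_posSemidef_or (hΦ : GlobalPath Q Φ) (s u : ℝ) :
    (Φ s - Φ u).PosSemidef ∨ (-(Φ s - Φ u)).PosSemidef := by
  rw [neg_sub]
  exact (le_total u s).imp (hΦ.mono u s) (hΦ.mono s u)

theorem GlobalPath.abs_sub_apply_le (hΦ : GlobalPath Q Φ) (s u : ℝ) (i j : Fin m) :
    |(Φ s - Φ u) i j| ≤ Q.trace + Q.trace := by
  rw [← sub_sub_sub_cancel_left (Φ u) (Φ s) Q]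
  exact (abs_sub _ _).trans
    (add_le_add (hΦ.abs_top_sub_apply_le u i j) (hΦ.abs_top_sub_apply_le s i j))

namespace CutPair

theorem massDeriv_eq_sub_pairing_cumResolv (hp : CutPair Q μ Φ T) (h : Fin m → ℝ)
    (hs : s ∈ Icc 0 T) :
    massDeriv β h Q T μ Φ s = potential β h Q - potential β h (Φ s)
      - pairing (cumResolv Q μ Φ s) (Q - Φ s)
      - ∫ t in s..T, pairing (resolv Q μ Φ t) (Q - Φ t) := by
  have integrable {a b : ℝ} (ha : a ≤ T) (hb : b ≤ T) :=
    hp.intervalIntegrable_pairing_resolv (hp.measurable_top_sub_max s)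
      (fun t => hp.path.abs_top_sub_apply_le (max s t)) ha hb
  have left : ∫ t in (0 : ℝ)..s, pairing (resolv Q μ Φ t) (Q - Φ (max s t))
      = pairing (cumResolv Q μ Φ s) (Q - Φ s) := by
    rw [hp.pairing_cumResolv hs.2]
    refine intervalIntegral.integral_congr fun t ht => ?_
    rw [uIcc_of_le hs.1] at ht
    simp only [max_eq_left ht.2]
  have right : ∫ t in s..T, pairing (resolv Q μ Φ t) (Q - Φ (max s t))
      = ∫ t in s..T, pairing (resolv Q μ Φ t) (Q - Φ t) := by
    refine intervalIntegral.integral_congr fun t ht => ?_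
    rw [uIcc_of_le hs.2] at ht
    simp only [max_eq_right ht.1]
  rw [massDeriv, ← intervalIntegral.integral_add_adjacent_intervals
    (integrable hp.pos.le hs.2) (integrable hs.2 le_rfl), left, right]
  ring

/-- The two first variations differ by a Taylor remainder of the potential and an integral which
is quadratic in `s - u`. -/
theorem pairing_pathGradient_add_massDeriv_sub (hp : CutPair Q μ Φ T) (h : Fin m → ℝ)
    (hu : u ∈ Icc 0 T) (hs : s ∈ Icc 0 T) :
    pairing (pathGradient β h Q μ Φ s) (Φ u - Φ s)
        + (massDeriv β h Q T μ Φ s - massDeriv β h Q T μ Φ u)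
      = pairing (xiD β (Φ s) + Matrix.vecMulVec h h) (Φ s - Φ u)
        - (potential β h (Φ s) - potential β h (Φ u))
        - ∫ t in u..s, pairing (resolv Q μ Φ t) (Φ t - Φ u) := by
  have integrable_const {a b : ℝ} (ha : a ≤ T) (hb : b ≤ T) :=
    hp.intervalIntegrable_pairing_resolv (B := fun _ => Q - Φ u) (fun _ _ => measurable_const)
      (fun _ => hp.path.abs_top_sub_apply_le u) ha hb
  have integrable_path {a b : ℝ} (ha : a ≤ T) (hb : b ≤ T) :=
    hp.intervalIntegrable_pairing_resolv hp.path.measurable_top_sub_apply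
      hp.path.abs_top_sub_apply_le ha hb
  have cumResolv_sub : pairing (cumResolv Q μ Φ s) (Q - Φ u)
      - pairing (cumResolv Q μ Φ u) (Q - Φ u)
      = ∫ t in u..s, pairing (resolv Q μ Φ t) (Q - Φ u) := by
    rw [hp.pairing_cumResolv hs.2, hp.pairing_cumResolv hu.2]
    exact intervalIntegral.integral_interval_sub_left (integrable_const hp.pos.le hs.2)
      (integrable_const hp.pos.le hu.2)
  have tail_sub : (∫ t in u..T, pairing (resolv Q μ Φ t) (Q - Φ t))
      - ∫ t in s..T, pairing (resolv Q μ Φ t) (Q - Φ t)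
      = ∫ t in u..s, pairing (resolv Q μ Φ t) (Q - Φ t) :=
    sub_eq_of_eq_add (intervalIntegral.integral_add_adjacent_intervals
      (integrable_path hu.2 hs.2) (integrable_path hs.2 le_rfl)).symm
  have increment_eq : ∫ t in u..s, pairing (resolv Q μ Φ t) (Φ t - Φ u)
      = (∫ t in u..s, pairing (resolv Q μ Φ t) (Q - Φ u))
        - ∫ t in u..s, pairing (resolv Q μ Φ t) (Q - Φ t) := by
    rw [← intervalIntegral.integral_sub (integrable_const hu.2 hs.2) (integrable_path hu.2 hs.2)]
    exact intervalIntegral.integral_congr fun t _ => by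
      simp only [← pairing_sub_right, sub_sub_sub_cancel_left]
  rw [hp.massDeriv_eq_sub_pairing_cumResolv h hs, hp.massDeriv_eq_sub_pairing_cumResolv h hu,
    pathGradient, pairing_sub_left, increment_eq, ← cumResolv_sub, ← tail_sub]
  simp only [pairing_sub_right]
  ring

theorem exists_abs_pairing_resolv_sub_le (hp : CutPair Q μ Φ T) (hu : u ≤ T) :
    ∃ C : ℝ, ∀ t ≤ T, |pairing (resolv Q μ Φ t) (Φ t - Φ u)
      - pairing ((hatTail Q μ Φ u)⁻¹ * entryDeriv Φ t * (hatTail Q μ Φ u)⁻¹) (Φ t - Φ u)|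
        ≤ C * |t - u| ^ 2 := by
  obtain ⟨K, hK⟩ := hp.path.lipschitz
  obtain ⟨L, hL⟩ := hp.exists_lipschitzOnWith_inv_hatTail
  set c := (Q - Φ T)⁻¹.trace
  set X := (hatTail Q μ Φ u)⁻¹
  set n := (Fintype.card (Fin m) : ℝ)
  refine ⟨m * (m * ((n * (n * (L * K) * c) + n * (n * (c * K) * L)) * K)), fun t ht => ?_⟩
  set Y := (hatTail Q μ Φ t)⁻¹ with Y_def
  have abs_X_le (i j : Fin m) : |X i j| ≤ c := hp.abs_inv_hatTail_le hu i j
  have abs_Y_le (i j : Fin m) : |Y i j| ≤ c := hp.abs_inv_hatTail_le ht i j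
  have abs_Y_sub_X_le (i j : Fin m) : |(Y - X) i j| ≤ L * |t - u| :=
    (hL i j).dist_le_mul t ht u hu
  have abs_increment_le (i j : Fin m) : |(Φ t - Φ u) i j| ≤ K * |t - u| :=
    abs_sub_le_of_lipschitzWith (hK i j) t u
  have resolv_sub : resolv Q μ Φ t - X * entryDeriv Φ t * X
      = (Y - X) * entryDeriv Φ t * Y + X * entryDeriv Φ t * (Y - X) := by
    rw [resolv, ← Y_def]
    noncomm_ring
  rw [← pairing_sub_left, resolv_sub]
  refine (abs_pairing_le (fun i j => (abs_add_le _ _).trans (add_le_add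
    (abs_mul_apply_le (abs_mul_apply_le abs_Y_sub_X_le (abs_entryDeriv_le hK t)) abs_Y_le i j)
    (abs_mul_apply_le (abs_mul_apply_le abs_X_le (abs_entryDeriv_le hK t)) abs_Y_sub_X_le i j)))
    abs_increment_le).trans_eq ?_
  ring

/-- Freezing `Φ̂` at `u` costs a cubic error, after which the integral is explicit and
`Φ̂(u) ≤ Q` applies. -/
theorem exists_integral_resolv_ge (hp : CutPair Q μ Φ T) (hu : u ≤ T) :
    ∃ C : ℝ, ∀ s ≤ T, pairing (Q⁻¹ * (Φ s - Φ u)) (Q⁻¹ * (Φ s - Φ u)) / 2 - C * |s - u| ^ 3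
      ≤ ∫ t in u..s, pairing (resolv Q μ Φ t) (Φ t - Φ u) := by
  have := hp.prob
  obtain ⟨K, hK⟩ := hp.path.lipschitz
  obtain ⟨C, hC⟩ := hp.exists_abs_pairing_resolv_sub_le hu
  have C_nonneg : 0 ≤ C := by
    simpa using (abs_nonneg _).trans (hC (u - 1) (by linarith))
  refine ⟨C, fun s hs => ?_⟩
  set X := (hatTail Q μ Φ u)⁻¹
  have abs_X_le : ∀ i j, |X i j| ≤ (Q - Φ T)⁻¹.trace := hp.abs_inv_hatTail_le hu
  have measurable_increment (i j : Fin m) : Measurable fun t => (Φ t - Φ u) i j :=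
    ((hp.path.continuous_apply i j).sub continuous_const).measurable
  have abs_increment_le (t : ℝ) := hp.path.abs_sub_apply_le t u
  have integrable_resolv :=
    hp.intervalIntegrable_pairing_resolv measurable_increment abs_increment_le hu hs
  have integrable_frozen : IntervalIntegrable
      (fun t => pairing (X * entryDeriv Φ t * X) (Φ t - Φ u)) volume u s :=
    intervalIntegrable_of_abs_le (measurable_pairing (measurable_mul_apply (measurable_mul_apply
      (fun i j => measurable_const) (measurable_entryDeriv Φ)) fun i j => measurable_const)
      measurable_increment) fun t _ => abs_pairing_le (abs_mul_apply_le
        (abs_mul_apply_le abs_X_le (abs_entryDeriv_le hK t)) abs_X_le) (abs_increment_le t)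
  have abs_sub_le : |(∫ t in u..s, pairing (resolv Q μ Φ t) (Φ t - Φ u))
      - ∫ t in u..s, pairing (X * entryDeriv Φ t * X) (Φ t - Φ u)| ≤ C * |s - u| ^ 3 := by
    rw [← intervalIntegral.integral_sub integrable_resolv integrable_frozen, pow_succ,
      ← mul_assoc, ← Real.norm_eq_abs]
    refine intervalIntegral.norm_integral_le_of_norm_le_const fun t ht => ?_
    refine (hC t (ht.2.trans (max_le hu hs))).trans ?_
    gcongr C * ?_ ^ 2
    exact abs_sub_left_of_mem_uIcc (uIoc_subset_uIcc ht)
  have frozen_ge : pairing (Q⁻¹ * (Φ s - Φ u)) (Q⁻¹ * (Φ s - Φ u))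
      ≤ pairing (X * (Φ s - Φ u) * X) (Φ s - Φ u) := by
    simpa only [pairing, mul_assoc] using trace_inv_mul_mul_inv_mul_mono (hp.hatTail_posDef hu)
      (hp.path.top_sub_hatTail_posSemidef u)
      ((hp.path.posSemidef s).isHermitian.sub (hp.path.posSemidef u).isHermitian)
  rw [integral_pairing_conj_entryDeriv hK] at abs_sub_le
  linarith [(abs_le.mp abs_sub_le).1]

theorem exists_pairing_pathGradient_le (hβ : IsMixedModel β) (h : Fin m → ℝ)
    (hQ : ∀ i, Q i i ≤ 1) (hp : CutPair Q μ Φ T) (hu : u ∈ Icc 0 T) :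
    ∃ C : ℝ, ∀ s ∈ Icc 0 T, massDeriv β h Q T μ Φ s = massDeriv β h Q T μ Φ u →
      pairing (pathGradient β h Q μ Φ s) (Φ u - Φ s)
        ≤ stabForm β Q (Φ s - Φ u) / 2 + C * |s - u| ^ 3 := by
  obtain ⟨C, hC⟩ := hp.exists_integral_resolv_ge hu.2
  refine ⟨C, fun s hs massDeriv_eq => ?_⟩
  have abs_Q_le (i j : Fin m) : |Q i j| ≤ 1 := by
    rw [← hp.path.eq_top m le_rfl]
    exact hp.path.abs_apply_le_one hQ m i j
  have identity := hp.pairing_pathGradient_add_massDeriv_sub (β := β) h hu hs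
  have taylor := pairing_sub_potential_sub_le hβ h (hp.path.posSemidef u) (hp.path.posSemidef s)
    (hp.path.le_top u) (hp.path.le_top s) (hp.path.abs_apply_le_one hQ u)
    (hp.path.abs_apply_le_one hQ s) abs_Q_le (hp.path.sub_posSemidef_or s u)
  rw [stabForm]
  linarith [hC s hs.2]

theorem exists_pairing_pathGradient_neg (hβ : IsMixedModel β) (h : Fin m → ℝ)
    (hQ : ∀ i, Q i i ≤ 1) (hp : CutPair Q μ Φ T) (hu : u ∈ Icc 0 T)
    (hdiff : ∀ i j, DifferentiableWithinAt ℝ (fun t => Φ t i j) (Icc (0 : ℝ) m) u)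
    (hlt : stabForm β Q (pathDeriv Φ u) < 0) :
    ∃ δ > 0, ∀ s ∈ Icc 0 T, |s - u| < δ → s ≠ u →
      massDeriv β h Q T μ Φ s = massDeriv β h Q T μ Φ u →
        pairing (pathGradient β h Q μ Φ s) (Φ u - Φ s) < 0 := by
  obtain ⟨c, hc, δ, hδ, stab_le⟩ := exists_stabForm_sub_le hdiff hlt
  obtain ⟨C, gradient_le⟩ := hp.exists_pairing_pathGradient_le hβ h hQ hu
  refine ⟨min δ (c / (4 * (|C| + 1))), lt_min hδ (by positivity), fun s hs hsδ hsu heq => ?_⟩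
  obtain ⟨hsδ, hsC⟩ := lt_min_iff.mp hsδ
  have dist_pos : 0 < |s - u| := abs_pos.mpr (sub_ne_zero.mpr hsu)
  have cubic_le : C * |s - u| ≤ c / 4 := by
    rw [lt_div_iff₀ (by positivity)] at hsC
    nlinarith [le_abs_self C]
  calc pairing (pathGradient β h Q μ Φ s) (Φ u - Φ s)
      ≤ stabForm β Q (Φ s - Φ u) / 2 + C * |s - u| ^ 3 := gradient_le s hs heq
    _ ≤ -c * |s - u| ^ 2 / 2 + c / 4 * |s - u| ^ 2 := by
        rw [pow_succ' |s - u| 2, ← mul_assoc]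
        have := stab_le s ⟨hs.1, hs.2.trans hp.lt.le⟩ hsδ hsu
        rw [← sq_abs] at this
        gcongr
    _ < 0 := by
        have : 0 < c * |s - u| ^ 2 := by positivity
        linarith

end CutPair

end Stability

/-! ### Contractions towards a point -/

theorem lipschitzOnWith_mul_of_abs_le {α : Type*} [PseudoMetricSpace α] {f g : α → ℝ} {s : Set α}
    {K L A B : ℝ≥0} (hf : LipschitzOnWith K f s) (hg : LipschitzOnWith L g s)
    (hA : ∀ t ∈ s, |f t| ≤ A) (hB : ∀ t ∈ s, |g t| ≤ B) :
    LipschitzOnWith (A * L + K * B) (fun t => f t * g t) s := by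
  refine LipschitzOnWith.of_dist_le_mul fun x hx y hy => ?_
  have hfxy := hf.dist_le_mul x hx y hy
  have hgxy := hg.dist_le_mul x hx y hy
  rw [Real.dist_eq] at hfxy hgxy ⊢
  calc |f x * g x - f y * g y| = |f x * (g x - g y) + (f x - f y) * g y| := by ring_nf
    _ ≤ |f x| * |g x - g y| + |f x - f y| * |g y| := by
        rw [← abs_mul, ← abs_mul]
        exact abs_add_le _ _
    _ ≤ A * (L * dist x y) + K * dist x y * B := by
        gcongr
        exacts [hA x hx, hB y hy]
    _ = (A * L + K * B : ℝ≥0) * dist x y := by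
        push_cast
        ring

theorem exists_lipschitzOnWith_mul {α : Type*} [PseudoMetricSpace α] {f g : α → ℝ} {s : Set α}
    (hs : IsCompact s) (hf : ∃ K, LipschitzOnWith K f s) (hg : ∃ K, LipschitzOnWith K g s) :
    ∃ K, LipschitzOnWith K (fun t => f t * g t) s := by
  obtain ⟨K, hK⟩ := hf
  obtain ⟨L, hL⟩ := hg
  obtain ⟨A, hA⟩ := hs.exists_bound_of_continuousOn hK.continuousOn
  obtain ⟨B, hB⟩ := hs.exists_bound_of_continuousOn hL.continuousOn
  exact ⟨_, lipschitzOnWith_mul_of_abs_le hK hL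
    (fun t ht => (hA t ht).trans (Real.le_coe_toNNReal A))
    fun t ht => (hB t ht).trans (Real.le_coe_toNNReal B)⟩

/-- A smooth bump function, positive on `(u - δ, u + δ)` and zero elsewhere. Unlike Mathlib's
`ContDiffBump` it is decreasing in the distance to `u` by its very definition. -/
def bump (u δ t : ℝ) : ℝ := Real.smoothTransition (1 - ((t - u) / δ) ^ 2)

section Bump

variable {u δ s t : ℝ}

theorem bump_nonneg (u δ t : ℝ) : 0 ≤ bump u δ t := Real.smoothTransition.nonneg _

theorem bump_le_one (u δ t : ℝ) : bump u δ t ≤ 1 := Real.smoothTransition.le_one _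

theorem abs_bump_le_one (u δ t : ℝ) : |bump u δ t| ≤ 1 := by
  rw [abs_of_nonneg (bump_nonneg u δ t)]
  exact bump_le_one u δ t

theorem bump_eq_zero (hδ : 0 < δ) (ht : δ ≤ |t - u|) : bump u δ t = 0 := by
  refine Real.smoothTransition.zero_of_nonpos (sub_nonpos.mpr ?_)
  rw [one_le_sq_iff_one_le_abs, abs_div, abs_of_pos hδ]
  exact (one_le_div hδ).mpr ht

theorem bump_pos (hδ : 0 < δ) (ht : |t - u| < δ) : 0 < bump u δ t := by
  refine Real.smoothTransition.pos_of_pos (sub_pos.mpr ?_)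
  rw [sq_lt_one_iff_abs_lt_one, abs_div, abs_of_pos hδ]
  exact (div_lt_one hδ).mpr ht

theorem bump_le_bump (h : |s - u| ≤ |t - u|) : bump u δ t ≤ bump u δ s := by
  refine Real.smoothTransition.monotone ?_
  simp only [div_pow]
  gcongr ?_ - ?_ / _
  exact sq_le_sq.mpr h

theorem contDiff_bump (u δ : ℝ) {n : ℕ∞} : ContDiff ℝ n (bump u δ) :=
  Real.smoothTransition.contDiff.comp
    (contDiff_const.sub (((contDiff_id.sub contDiff_const).div_const δ).pow 2))

theorem hasDerivAt_bump (u δ t : ℝ) : HasDerivAt (bump u δ) (deriv (bump u δ) t) t :=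
  ((contDiff_bump u δ (n := 1)).differentiable one_ne_zero t).hasDerivAt

theorem hasCompactSupport_bump (hδ : 0 < δ) : HasCompactSupport (bump u δ) :=
  HasCompactSupport.intro (isCompact_closedBall u δ) fun t ht => by
    rw [Metric.mem_closedBall, Real.dist_eq, not_le] at ht
    exact bump_eq_zero hδ ht.le

theorem exists_lipschitzWith_bump (hδ : 0 < δ) : ∃ K, LipschitzWith K (bump u δ) :=
  (contDiff_bump u δ (n := 1)).lipschitzWith_of_hasCompactSupport (hasCompactSupport_bump hδ)
    one_ne_zero

theorem exists_lipschitzWith_deriv_bump (hδ : 0 < δ) : ∃ K, LipschitzWith K (deriv (bump u δ)) :=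
  (((contDiff_bump u δ (n := 2)).deriv' : ContDiff ℝ 1 _)).lipschitzWith_of_hasCompactSupport
    (hasCompactSupport_bump hδ).deriv one_ne_zero

theorem deriv_bump_mul_sub_nonpos (u δ t : ℝ) : deriv (bump u δ) t * (t - u) ≤ 0 := by
  have smooth := Real.smoothTransition.contDiff (n := 1)
  have inner : HasDerivAt (fun t : ℝ => 1 - ((t - u) / δ) ^ 2) (-(2 * (t - u) / δ ^ 2)) t :=
    (((((hasDerivAt_id t).sub_const u).div_const δ).pow 2).const_sub 1).congr_deriv
      (by simp only [id_eq]; ring)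
  have outer := (smooth.differentiable one_ne_zero (1 - ((t - u) / δ) ^ 2)).hasDerivAt
  rw [show deriv (bump u δ) t = _ from (outer.comp t inner).deriv]
  have transition_nonneg := Real.smoothTransition.monotone.deriv_nonneg
    (x := 1 - ((t - u) / δ) ^ 2)
  calc deriv Real.smoothTransition (1 - ((t - u) / δ) ^ 2) * -(2 * (t - u) / δ ^ 2) * (t - u)
      = -(2 * deriv Real.smoothTransition (1 - ((t - u) / δ) ^ 2) * ((t - u) / δ) ^ 2) := by ring
    _ ≤ 0 := neg_nonpos.mpr (by positivity)

end Bump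

/-- The displacement of `f` towards its value at `u`, by the factor `1 - ε η` where `η` is the
bump function of radius `δ`. It is applied to matrix paths and, with `f = id`, to time. -/
def pull {E : Type*} [AddCommGroup E] [Module ℝ E] (f : ℝ → E) (u δ ε t : ℝ) : E :=
  f u + (1 - ε * bump u δ t) • (f t - f u)

section Pull

variable {E : Type*} [AddCommGroup E] [Module ℝ E] {u δ ε : ℝ}

theorem pull_eq_add (f : ℝ → E) (u δ ε t : ℝ) :
    pull f u δ ε t = f t + ε • (bump u δ t • (f u - f t)) := by
  rw [pull]
  module

theorem pull_eq_self (f : ℝ → E) (hδ : 0 < δ) (ε : ℝ) {t : ℝ} (ht : δ ≤ |t - u|) :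
    pull f u δ ε t = f t := by
  rw [pull_eq_add, bump_eq_zero hδ ht, zero_smul, smul_zero, add_zero]

theorem one_sub_mul_bump_nonneg (hε₁ : ε ≤ 1) (t : ℝ) : 0 ≤ 1 - ε * bump u δ t :=
  sub_nonneg.mpr (mul_le_one₀ hε₁ (bump_nonneg u δ t) (bump_le_one u δ t))

/-- The derivative of `pull f u δ ε` at `t`, given the derivative `f'` of `f` there. -/
def pullDeriv (f : ℝ → ℝ) (f' u δ ε t : ℝ) : ℝ :=
  (1 - ε * bump u δ t) * f' - ε * deriv (bump u δ) t * (f t - f u)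

theorem hasDerivWithinAt_pull {f : ℝ → ℝ} {f' t : ℝ} {s : Set ℝ} (hf : HasDerivWithinAt f f' s t)
    (u δ ε : ℝ) : HasDerivWithinAt (pull f u δ ε) (pullDeriv f f' u δ ε t) s t :=
  (((((hasDerivAt_bump u δ t).const_mul ε).const_sub 1).hasDerivWithinAt.mul
    (hf.sub_const (f u))).const_add (f u)).congr_deriv (by rw [pullDeriv]; ring)

theorem hasDerivAt_pull_id (u δ ε t : ℝ) :
    HasDerivAt (pull id u δ ε) (pullDeriv id 1 u δ ε t) t :=
  hasDerivWithinAt_univ.mp (hasDerivWithinAt_pull (hasDerivWithinAt_id t univ) u δ ε)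

theorem half_le_pullDeriv_id (hε : 0 ≤ ε) (hε₁ : ε ≤ 1 / 2) (t : ℝ) :
    1 / 2 ≤ pullDeriv id 1 u δ ε t := by
  have bump_le := mul_le_mul_of_nonneg_left (bump_le_one u δ t) hε
  have slope_le := mul_nonpos_of_nonneg_of_nonpos hε (deriv_bump_mul_sub_nonpos u δ t)
  rw [← mul_assoc] at slope_le
  simp only [pullDeriv, id_eq]
  linarith

theorem exists_lipschitzOnWith_pullDeriv {f f' : ℝ → ℝ} {s : Set ℝ} (hs : IsCompact s)
    (hδ : 0 < δ) (hf : ∃ K, LipschitzOnWith K f s) (hf' : ∃ K, LipschitzOnWith K f' s) (ε : ℝ) :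
    ∃ K, LipschitzOnWith K (fun t => pullDeriv f (f' t) u δ ε t) s := by
  obtain ⟨K, hK⟩ := hf
  obtain ⟨B, hB⟩ := exists_lipschitzWith_bump (u := u) hδ
  obtain ⟨D, hD⟩ := exists_lipschitzWith_deriv_bump (u := u) hδ
  have factor : LipschitzOnWith (0 + ‖ε‖₊ * B) (fun t => 1 - ε * bump u δ t) s :=
    ((LipschitzWith.const 1).sub ((lipschitzWith_smul ε).comp hB)).lipschitzOnWith
  have slope : LipschitzOnWith (‖ε‖₊ * D) (fun t => ε * deriv (bump u δ) t) s :=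
    ((lipschitzWith_smul ε).comp hD).lipschitzOnWith
  obtain ⟨L, hL⟩ := exists_lipschitzOnWith_mul hs ⟨_, factor⟩ hf'
  obtain ⟨M, hM⟩ := exists_lipschitzOnWith_mul hs ⟨_, slope⟩
    ⟨K + 0, hK.sub (LipschitzWith.const (f u)).lipschitzOnWith⟩
  exact ⟨L + M, hL.sub hM⟩

theorem continuous_pull_id (u δ ε : ℝ) : Continuous (pull id u δ ε) :=
  continuous_iff_continuousAt.mpr fun t => (hasDerivAt_pull_id u δ ε t).continuousAt

theorem strictMono_pull_id (hε : 0 ≤ ε) (hε₁ : ε ≤ 1 / 2) : StrictMono (pull id u δ ε) :=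
  strictMono_of_hasDerivAt_pos (hasDerivAt_pull_id u δ ε) fun t =>
    one_half_pos.trans_le (half_le_pullDeriv_id hε hε₁ t)

theorem surjective_pull_id (hδ : 0 < δ) (u ε : ℝ) : Function.Surjective (pull id u δ ε) := by
  refine (continuous_pull_id u δ ε).surjective ?_ ?_
  · refine tendsto_id.congr' ?_
    filter_upwards [eventually_ge_atTop (u + δ)] with t ht
    exact (pull_eq_self id hδ ε (le_abs.mpr (.inl (le_sub_iff_add_le'.mpr ht)))).symm
  · refine tendsto_id.congr' ?_
    filter_upwards [eventually_le_atBot (u - δ)] with t ht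
    exact (pull_eq_self id hδ ε (le_abs.mpr (.inr (by linarith)))).symm

/-- The radii for which `pull · u δ ε` modifies a path only inside `[0, T]`. At `u = 0` the
modification is one-sided. -/
structure GoodRadius (u δ T : ℝ) : Prop where
  pos : 0 < δ
  nonneg : 0 ≤ u
  left : u = 0 ∨ δ ≤ u
  right : u + δ ≤ T

namespace GoodRadius

variable {T : ℝ}

theorem le_abs_of_ge (hr : GoodRadius u δ T) {t : ℝ} (ht : T ≤ t) : δ ≤ |t - u| :=
  le_abs.mpr (.inl (by linarith [hr.right]))

theorem pull_eq_of_nonpos (hr : GoodRadius u δ T) (f : ℝ → E) (ε : ℝ) {t : ℝ} (ht : t ≤ 0)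
    (hf : f t = f 0) : pull f u δ ε t = f t := by
  rcases hr.left with rfl | hδ
  · rw [pull, hf, sub_self, smul_zero, add_zero]
  · exact pull_eq_self f hr.pos ε (le_abs.mpr (.inr (by linarith)))

end GoodRadius

end Pull

section PullPath

variable {m : ℕ} {Q : Matrix (Fin m) (Fin m) ℝ} {μ : Measure ℝ}
  {Φ : ℝ → Matrix (Fin m) (Fin m) ℝ} {u δ T ε : ℝ}

namespace GlobalPath

theorem exists_lipschitzWith_bump_smul (hΦ : GlobalPath Q Φ) (hδ : 0 < δ) :
    ∃ K, ∀ i j, LipschitzWith K fun t => (bump u δ t • (Φ u - Φ t)) i j := by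
  obtain ⟨K, hK⟩ := hΦ.lipschitz
  obtain ⟨L, hL⟩ := exists_lipschitzWith_bump (u := u) hδ
  refine ⟨1 * (0 + K) + L * (Q.trace + Q.trace).toNNReal, fun i j => ?_⟩
  rw [← lipschitzOnWith_univ]
  refine lipschitzOnWith_mul_of_abs_le hL.lipschitzOnWith
    ((LipschitzWith.const (Φ u i j)).sub (hK i j)).lipschitzOnWith
    (fun t _ => abs_bump_le_one u δ t) fun t _ => ?_
  exact (hΦ.abs_sub_apply_le u t i j).trans (Real.le_coe_toNNReal _)

theorem pull_sub_pull_posSemidef (hΦ : GlobalPath Q Φ) (hε : 0 ≤ ε) (hε₁ : ε ≤ 1) {s t : ℝ}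
    (hst : s ≤ t) : (pull Φ u δ ε t - pull Φ u δ ε s).PosSemidef := by
  have factor_nonneg := one_sub_mul_bump_nonneg (u := u) (δ := δ) hε₁
  rcases le_total u s with hus | hsu
  · have split : pull Φ u δ ε t - pull Φ u δ ε s = (1 - ε * bump u δ t) • (Φ t - Φ s)
        + (ε * (bump u δ s - bump u δ t)) • (Φ s - Φ u) := by
      simp only [pull]
      module
    rw [split]
    refine ((hΦ.mono s t hst).smul (factor_nonneg t)).add ((hΦ.mono u s hus).smul ?_)
    refine mul_nonneg hε (sub_nonneg.mpr (bump_le_bump ?_))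
    rw [abs_of_nonneg (by linarith), abs_of_nonneg (by linarith)]
    linarith
  rcases le_total t u with htu | hut
  · have split : pull Φ u δ ε t - pull Φ u δ ε s = (1 - ε * bump u δ s) • (Φ t - Φ s)
        + (ε * (bump u δ t - bump u δ s)) • (Φ u - Φ t) := by
      simp only [pull]
      module
    rw [split]
    refine ((hΦ.mono s t hst).smul (factor_nonneg s)).add ((hΦ.mono t u htu).smul ?_)
    refine mul_nonneg hε (sub_nonneg.mpr (bump_le_bump ?_))
    rw [abs_of_nonpos (by linarith), abs_of_nonpos (by linarith)]
    linarith
  · have split : pull Φ u δ ε t - pull Φ u δ ε s = (1 - ε * bump u δ t) • (Φ t - Φ u)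
        + (1 - ε * bump u δ s) • (Φ u - Φ s) := by
      simp only [pull]
      module
    rw [split]
    exact ((hΦ.mono u t hut).smul (factor_nonneg t)).add ((hΦ.mono s u hsu).smul (factor_nonneg s))

protected theorem pull (hΦ : GlobalPath Q Φ) (hr : GoodRadius u δ T) (hT : T ≤ m) (hε : 0 ≤ ε)
    (hε₁ : ε ≤ 1) : GlobalPath Q (pull Φ u δ ε) where
  lipschitz := by
    obtain ⟨K, hK⟩ := hΦ.lipschitz
    obtain ⟨L, hL⟩ := hΦ.exists_lipschitzWith_bump_smul (u := u) hr.pos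
    refine ⟨K + ‖ε‖₊ * L, fun i j => ?_⟩
    simp only [pull_eq_add]
    exact (hK i j).add ((lipschitzWith_smul ε).comp (hL i j))
  mono _ _ := hΦ.pull_sub_pull_posSemidef hε hε₁
  eq_zero t ht := by
    rw [hr.pull_eq_of_nonpos Φ ε ht ((hΦ.eq_zero t ht).trans (hΦ.eq_zero 0 le_rfl).symm),
      hΦ.eq_zero t ht]
  eq_top t ht := by rw [pull_eq_self Φ hr.pos ε (hr.le_abs_of_ge (hT.trans ht)), hΦ.eq_top t ht]

end GlobalPath

namespace CutPair

protected theorem pull (hp : CutPair Q μ Φ T) (hr : GoodRadius u δ T) (hε : 0 ≤ ε)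
    (hε₁ : ε ≤ 1) : CutPair Q μ (pull Φ u δ ε) T where
  path := hp.path.pull hr hp.lt.le hε hε₁
  prob := hp.prob
  compl := hp.compl
  pos := hp.pos
  lt := hp.lt
  posDef := by
    rw [pull_eq_self Φ hr.pos ε (hr.le_abs_of_ge le_rfl)]
    exact hp.posDef

theorem integral_bump_mul_pairing_nonneg {β : ℕ → Fin m → ℝ} (hβ : IsMixedModel β)
    (h : Fin m → ℝ) (hQ : ∀ i, Q i i ≤ 1) (hp : CutPair Q μ Φ T) (hr : GoodRadius u δ T)
    {ε₀ : ℝ} (hε₀ : 0 < ε₀) (hε₀₁ : ε₀ ≤ 1)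
    (hmin : ∀ ε, 0 < ε → ε ≤ ε₀ → reduced β h Q T μ Φ ≤ reduced β h Q T μ (pull Φ u δ ε)) :
    0 ≤ ∫ s, bump u δ s * pairing (pathGradient β h Q μ Φ s) (Φ u - Φ s) ∂μ := by
  obtain ⟨L, hL⟩ := hp.path.exists_lipschitzWith_bump_smul (u := u) hr.pos
  simp only [← pairing_smul_right]
  refine hp.integral_pairing_pathGradient_nonneg hβ h hQ hL (C := 1 * (Q.trace + Q.trace))
    (fun t i j => ?_) ?_ ?_ (fun s => ?_) hε₀ fun ε hε hε' => ?_
  · rw [Matrix.smul_apply, smul_eq_mul, abs_mul]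
    exact mul_le_mul (abs_bump_le_one u δ t) (hp.path.abs_sub_apply_le u t i j) (abs_nonneg _)
      zero_le_one
  · rcases hr.left with rfl | hδ
    · rw [sub_self, smul_zero]
    · rw [bump_eq_zero hr.pos (by rwa [zero_sub, abs_neg, abs_of_nonneg hr.nonneg]), zero_smul]
  · rw [bump_eq_zero hr.pos (hr.le_abs_of_ge le_rfl), zero_smul]
  · rw [← smul_neg]
    exact (hp.path.sub_posSemidef_or u s).imp (·.smul (bump_nonneg u δ s))
      (·.smul (bump_nonneg u δ s))
  · rw [← funext fun s => pull_eq_add Φ u δ ε s]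
    exact ⟨hp.pull hr hε.le (hε'.trans hε₀₁), hmin ε hε hε'⟩

theorem integrable_bump_mul_pairing {β : ℕ → Fin m → ℝ} (hβ : IsMixedModel β)
    (h : Fin m → ℝ) (hQ : ∀ i, Q i i ≤ 1) (hp : CutPair Q μ Φ T) (hδ : 0 < δ) :
    Integrable (fun s => bump u δ s * pairing (pathGradient β h Q μ Φ s) (Φ u - Φ s)) μ := by
  obtain ⟨L, hL⟩ := hp.path.exists_lipschitzWith_bump_smul (u := u) hδ
  simp only [← pairing_smul_right]
  simp only [pathGradient, pairing_sub_left]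
  exact (hp.integrable_pairing_cumResolv fun i j => (hL i j).continuous).sub
    (hp.integrable_pairing_xiD_add hβ h hQ fun i j => (hL i j).continuous)

end CutPair

end PullPath

/-! ### Reparametrization -/

/-- Increasing differentiable changes of time on the line that fix `0`, `T` and `m`. -/
structure IsReparam (m : ℕ) (T : ℝ) (e : ℝ ≃o ℝ) (e' : ℝ → ℝ) : Prop where
  hasDerivAt : ∀ t, HasDerivAt e (e' t) t
  half_le : ∀ t, 1 / 2 ≤ e' t
  zero : e 0 = 0
  cut : e T = T
  top : e m = m

section Reparam

variable {m : ℕ} {Q : Matrix (Fin m) (Fin m) ℝ} {μ : Measure ℝ}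
  {Φ : ℝ → Matrix (Fin m) (Fin m) ℝ} {T : ℝ} {e : ℝ ≃o ℝ} {e' : ℝ → ℝ}

namespace IsReparam

theorem symm_zero (he : IsReparam m T e e') : e.symm 0 = 0 := by
  rw [OrderIso.symm_apply_eq, he.zero]

theorem symm_cut (he : IsReparam m T e e') : e.symm T = T := by
  rw [OrderIso.symm_apply_eq, he.cut]

theorem symm_top (he : IsReparam m T e e') : e.symm m = m := by
  rw [OrderIso.symm_apply_eq, he.top]

theorem deriv_pos (he : IsReparam m T e e') (t : ℝ) : 0 < e' t :=
  one_half_pos.trans_le (he.half_le t)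

theorem hasDerivAt_symm (he : IsReparam m T e e') (t : ℝ) :
    HasDerivAt e.symm (e' (e.symm t))⁻¹ t :=
  HasDerivAt.of_local_left_inverse e.symm.continuous.continuousAt (he.hasDerivAt _)
    (he.deriv_pos _).ne' (Eventually.of_forall e.apply_symm_apply)

theorem lipschitzWith_symm (he : IsReparam m T e e') : LipschitzWith 2 e.symm := by
  refine lipschitzWith_of_nnnorm_deriv_le (fun t => (he.hasDerivAt_symm t).differentiableAt)
    fun t => ?_
  rw [(he.hasDerivAt_symm t).deriv, ← NNReal.coe_le_coe, coe_nnnorm, norm_inv, Real.norm_eq_abs,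
    abs_of_pos (he.deriv_pos _), NNReal.coe_ofNat, inv_le_comm₀ (he.deriv_pos _) two_pos,
    ← one_div]
  exact he.half_le _

theorem mapsTo_symm_Icc (he : IsReparam m T e e') :
    MapsTo e.symm (Icc (0 : ℝ) m) (Icc (0 : ℝ) m) := fun _ ht =>
  ⟨he.symm_zero ▸ e.symm.monotone ht.1, he.symm_top ▸ e.symm.monotone ht.2⟩

theorem preimage_Icc (he : IsReparam m T e e') (a : ℝ) : e ⁻¹' Icc 0 (e a) = Icc 0 a := by
  rw [e.preimage_Icc, he.symm_zero, e.symm_apply_apply]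

theorem distr_map (he : IsReparam m T e e') (μ : Measure ℝ) (a : ℝ) :
    distr (μ.map e) (e a) = distr μ a := by
  rw [distr, distr, map_measureReal_apply e.continuous.measurable measurableSet_Icc,
    he.preimage_Icc]

theorem smul_entryDeriv_comp_symm (he : IsReparam m T e e') {t : ℝ}
    (hΦ : ∀ i j, DifferentiableAt ℝ (fun s => Φ s i j) t) :
    e' t • entryDeriv (fun s => Φ (e.symm s)) (e t) = entryDeriv Φ t := by
  ext i j
  have hasDerivAt_symm := he.hasDerivAt_symm (e t)
  have hasDerivAt_path : HasDerivAt (fun s => Φ s i j) (entryDeriv Φ t i j) (e.symm (e t)) := by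
    rw [e.symm_apply_apply]
    exact (hΦ i j).hasDerivAt
  have chain : entryDeriv (fun s => Φ (e.symm s)) (e t) i j = _ :=
    (hasDerivAt_path.comp (e t) hasDerivAt_symm).deriv
  rw [Matrix.smul_apply, chain, e.symm_apply_apply, smul_eq_mul]
  field_simp [(he.deriv_pos t).ne']

end IsReparam

theorem integral_map_orderIso (e : ℝ ≃o ℝ) (μ : Measure ℝ) (f : ℝ → ℝ) :
    ∫ s, f s ∂(μ.map e) = ∫ s, f (e s) ∂μ :=
  e.toHomeomorph.measurableEmbedding.integral_map f

theorem symm_apply_mem_support_of_mem_support_map (e : ℝ ≃o ℝ) {t : ℝ}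
    (ht : t ∈ (μ.map e).support) : e.symm t ∈ μ.support := by
  rw [Measure.mem_support_iff_forall] at ht ⊢
  intro U hU
  have image_mem : e.symm ⁻¹' U ∈ 𝓝 t := e.symm.continuous.continuousAt.preimage_mem_nhds hU
  have measure_eq : μ.map e (e.symm ⁻¹' U) = μ U := by
    rw [show μ.map e = μ.map e.toHomeomorph from rfl,
      e.toHomeomorph.measurableEmbedding.map_apply]
    congr 1
    ext s
    simp
  exact measure_eq ▸ ht _ image_mem

theorem hatTail_map (e : ℝ ≃o ℝ) (t : ℝ) :
    hatTail Q (μ.map e) (fun s => Φ (e.symm s)) (e t) = hatTail Q μ Φ t := by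
  ext i j
  simp only [hatTail, tail, Matrix.of_apply, one_mul, integral_map_orderIso, ← e.monotone.map_max,
    e.symm_apply_apply]

theorem GlobalPath.reparam (hΦ : GlobalPath Q Φ) (he : IsReparam m T e e') :
    GlobalPath Q fun t => Φ (e.symm t) where
  lipschitz := by
    obtain ⟨K, hK⟩ := hΦ.lipschitz
    exact ⟨K * 2, fun i j => (hK i j).comp he.lipschitzWith_symm⟩
  mono s t hst := hΦ.mono _ _ (e.symm.monotone hst)
  eq_zero t ht := hΦ.eq_zero _ (he.symm_zero ▸ e.symm.monotone ht)
  eq_top t ht := hΦ.eq_top _ (he.symm_top ▸ e.symm.monotone ht)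

theorem CutPair.reparam (hp : CutPair Q μ Φ T) (he : IsReparam m T e e') :
    CutPair Q (μ.map e) (fun t => Φ (e.symm t)) T where
  path := hp.path.reparam he
  prob :=
    have := hp.prob
    Measure.isProbabilityMeasure_map e.continuous.measurable.aemeasurable
  compl := by
    have preimage_eq := he.preimage_Icc T
    rw [he.cut] at preimage_eq
    rw [Measure.map_apply e.continuous.measurable measurableSet_Icc.compl, preimage_compl,
      preimage_eq]
    exact hp.compl
  pos := hp.pos
  lt := hp.lt
  posDef := by
    rw [he.symm_cut]
    exact hp.posDef

theorem CutPair.reduced_reparam (β : ℕ → Fin m → ℝ) (h : Fin m → ℝ) (hp : CutPair Q μ Φ T)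
    (he : IsReparam m T e e') :
    reduced β h Q T (μ.map e) (fun t => Φ (e.symm t)) = reduced β h Q T μ Φ := by
  rw [reduced, reduced, integral_map_orderIso]
  simp only [e.symm_apply_apply]
  congr 1
  rw [intervalIntegral.integral_of_le hp.pos.le, intervalIntegral.integral_of_le hp.pos.le]
  have image_eq : e '' Ioc 0 T = Ioc 0 T := by rw [e.image_Ioc, he.zero, he.cut]
  have change_of_variables := integral_image_eq_integral_abs_deriv_smul
    (s := Ioc 0 T) (f := e) (f' := e') measurableSet_Ioc
    (fun t _ => (he.hasDerivAt t).hasDerivWithinAt) e.injective.injOn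
    fun t => pairing (hatTail Q (μ.map e) (fun t => Φ (e.symm t)) t)⁻¹
      (entryDeriv (fun t => Φ (e.symm t)) t)
  rw [image_eq] at change_of_variables
  rw [change_of_variables]
  obtain ⟨K, hK⟩ := hp.path.lipschitz
  refine integral_congr_ae (ae_restrict_of_ae ?_)
  filter_upwards [ae_differentiableAt_apply hK] with t ht
  rw [hatTail_map, abs_of_pos (he.deriv_pos t), smul_eq_mul, ← pairing_smul_right,
    he.smul_entryDeriv_comp_symm ht]

end Reparam

/-- The contraction of the line towards `u`, as an order isomorphism. -/
def pullIso {u δ ε : ℝ} (hδ : 0 < δ) (hε : 0 ≤ ε) (hε₁ : ε ≤ 1 / 2) : ℝ ≃o ℝ :=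
  (strictMono_pull_id hε hε₁).orderIsoOfSurjective (pull id u δ ε) (surjective_pull_id hδ u ε)

theorem GoodRadius.isReparam {u δ T ε : ℝ} {m : ℕ} (hr : GoodRadius u δ T) (hT : T ≤ m)
    (hε : 0 ≤ ε) (hε₁ : ε ≤ 1 / 2) :
    IsReparam m T (pullIso (u := u) hr.pos hε hε₁) (pullDeriv id 1 u δ ε) where
  hasDerivAt := hasDerivAt_pull_id u δ ε
  half_le := half_le_pullDeriv_id hε hε₁
  zero := hr.pull_eq_of_nonpos id ε le_rfl rfl
  cut := pull_eq_self id hr.pos ε (hr.le_abs_of_ge le_rfl)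
  top := pull_eq_self id hr.pos ε (hr.le_abs_of_ge hT)

/-! ### Admissible pairs -/

section Admissible

variable {m : ℕ} {Q : Matrix (Fin m) (Fin m) ℝ} {μ : Measure ℝ}
  {Φ : ℝ → Matrix (Fin m) (Fin m) ℝ} {T a : ℝ}

theorem distr_eq_one_iff [IsProbabilityMeasure μ] : distr μ a = 1 ↔ μ (Icc 0 a)ᶜ = 0 := by
  rw [prob_compl_eq_zero_iff measurableSet_Icc, distr, measureReal_def, ENNReal.toReal_eq_one_iff]

theorem topPoint_le (ha : a ∈ Icc (0 : ℝ) m) (h : distr μ a = 1) : topPoint m μ ≤ a :=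
  csInf_le ⟨0, fun _ ht => ht.1.1⟩ ⟨ha, h⟩

theorem IsPair.distr_top (hp : IsPair Q μ Φ) : distr μ m = 1 :=
  have := hp.prob
  distr_eq_one_iff.mpr hp.compl

theorem IsPair.topPoint_mem (hp : IsPair Q μ Φ) : topPoint m μ ∈ Icc (0 : ℝ) m :=
  ⟨le_csInf ⟨m, ⟨Nat.cast_nonneg m, le_rfl⟩, hp.distr_top⟩ fun _ ht => ht.1.1, hp.topPoint_lt.le⟩

theorem IsPair.exists_distr_eq_one (hp : IsPair Q μ Φ) (hT : topPoint m μ < T) :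
    ∃ a ∈ Icc (0 : ℝ) m, distr μ a = 1 ∧ a < T := by
  obtain ⟨a, ⟨ha, distr_eq⟩, haT⟩ :=
    exists_lt_of_csInf_lt (s := {t | t ∈ Icc (0 : ℝ) m ∧ distr μ t = 1})
      ⟨m, ⟨Nat.cast_nonneg m, le_rfl⟩, hp.distr_top⟩ hT
  exact ⟨a, ha, distr_eq, haT⟩

theorem IsPair.exists_isCutoff (hp : IsPair Q μ Φ) (hΦ : GlobalPath Q Φ) :
    ∃ T, IsCutoff Q μ Φ T := by
  have continuous_det : Continuous fun t => (Q - Φ t).det :=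
    Continuous.matrix_det (continuous_matrix fun i j =>
      continuous_const.sub (hΦ.continuous_apply i j))
  have det_pos : ∀ᶠ t in 𝓝[>] (topPoint m μ), 0 < (Q - Φ t).det :=
    (continuous_det.tendsto _).mono_left nhdsWithin_le_nhds |>.eventually
      (lt_mem_nhds hp.det_pos)
  obtain ⟨T, hdet, hT⟩ := (det_pos.and (Ioo_mem_nhdsGT hp.topPoint_lt)).exists
  exact ⟨T, hT.1, hT.2, hdet⟩

theorem IsPair.cutPair (hp : IsPair Q μ Φ) (hΦ : GlobalPath Q Φ) (hT : IsCutoff Q μ Φ T) :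
    CutPair Q μ Φ T where
  path := hΦ
  prob := hp.prob
  compl := by
    have := hp.prob
    obtain ⟨a, -, distr_eq, haT⟩ := hp.exists_distr_eq_one hT.1
    exact measure_mono_null (compl_subset_compl.mpr (Icc_subset_Icc_right haT.le))
      (distr_eq_one_iff.mp distr_eq)
  pos := hp.topPoint_mem.1.trans_lt hT.1
  lt := hT.2.1
  posDef := posDef_of_posSemidef_of_det_pos (hΦ.le_top T) hT.2.2

theorem CutPair.isCutoff (hp : CutPair Q μ Φ T) (hT : topPoint m μ < T) : IsCutoff Q μ Φ T :=
  ⟨hT, hp.lt, hp.posDef.det_pos⟩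

theorem CutPair.isPair (hp : CutPair Q μ Φ T) (hT : topPoint m μ < T) : IsPair Q μ Φ where
  prob := hp.prob
  compl := hp.compl_top
  topPoint_lt := hT.trans hp.lt
  det_pos := by
    refine (posDef_of_le hp.posDef (Y := Q - Φ (topPoint m μ)) ?_).det_pos
    rw [sub_sub_sub_cancel_left]
    exact hp.path.mono (topPoint m μ) T hT.le

theorem GlobalPath.isMonotonePath (hΦ : GlobalPath Q Φ) : IsMonotonePath Q Φ where
  posSemidef t _ := hΦ.posSemidef t
  mono s _ t _ hst := hΦ.mono s t hst
  zero := hΦ.eq_zero 0 le_rfl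
  top := hΦ.eq_top m le_rfl

theorem GlobalPath.isTracePath (hΦ : GlobalPath Q Φ)
    (htr : ∀ t ∈ Icc (0 : ℝ) m, (Φ t).trace = t) : IsTracePath Q Φ where
  toIsMonotonePath := hΦ.isMonotonePath
  trace := htr
  lipschitz i j := by
    have abs_sub_le : ∀ s ∈ Icc (0 : ℝ) m, ∀ t ∈ Icc (0 : ℝ) m, s ≤ t →
        |Φ t i j - Φ s i j| ≤ |t - s| := by
      intro s hs t ht hst
      have entry_le_trace := abs_apply_le_trace_of_posSemidef (hΦ.mono s t hst) i j
      rw [Matrix.trace_sub, htr s hs, htr t ht] at entry_le_trace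
      exact entry_le_trace.trans (le_abs_self _)
    refine LipschitzOnWith.of_dist_le_mul fun s hs t ht => ?_
    rw [Real.dist_eq, Real.dist_eq, NNReal.coe_one, one_mul]
    rcases le_total s t with hst | hst
    · rw [abs_sub_comm, abs_sub_comm s]
      exact abs_sub_le s hs t ht hst
    · exact abs_sub_le t ht s hs hst

theorem lipschitzOnWith_congr {α β : Type*} [PseudoEMetricSpace α] [PseudoEMetricSpace β]
    {f g : α → β} {K : ℝ≥0} {s : Set α} (h : EqOn f g s) (hf : LipschitzOnWith K f s) :
    LipschitzOnWith K g s := fun x hx y hy => by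
  rw [← h hx, ← h hy]
  exact hf hx hy

theorem exists_uniform_lipschitzOnWith {f : Fin m → Fin m → ℝ → ℝ} {s : Set ℝ}
    (h : ∀ i j, ∃ K, LipschitzOnWith K (f i j) s) :
    ∃ K, ∀ i j, LipschitzOnWith K (f i j) s := by
  choose L hL using h
  refine ⟨∑ i, ∑ j, L i j, fun i j => (hL i j).weaken ?_⟩
  exact (Finset.single_le_sum (f := fun j => L i j) (fun _ _ => zero_le)
      (Finset.mem_univ j)).trans
    (Finset.single_le_sum (f := fun i => ∑ j, L i j) (fun _ _ => zero_le) (Finset.mem_univ i))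

theorem GlobalPath.isSmoothPath (hΦ : GlobalPath Q Φ) (hm : (0 : ℝ) < m)
    {Φ' : ℝ → Matrix (Fin m) (Fin m) ℝ}
    (hderiv : ∀ i j, ∀ t ∈ Icc (0 : ℝ) m,
      HasDerivWithinAt (fun s => Φ s i j) (Φ' t i j) (Icc (0 : ℝ) m) t)
    (hlip : ∀ i j, ∃ K, LipschitzOnWith K (fun t => Φ' t i j) (Icc (0 : ℝ) m))
    (htr : ∀ t ∈ μ.support, (Φ t).trace = t) : IsSmoothPath Q μ Φ := by
  have pathDeriv_eq (i j) :
      EqOn (fun t => Φ' t i j) (fun t => pathDeriv Φ t i j) (Icc (0 : ℝ) m) := fun t ht =>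
    ((hderiv i j t ht).derivWithin (uniqueDiffOn_Icc hm t ht)).symm
  have lipschitz_pathDeriv (i j) :
      ∃ K, LipschitzOnWith K (fun t => pathDeriv Φ t i j) (Icc (0 : ℝ) m) := by
    obtain ⟨K, hK⟩ := hlip i j
    exact ⟨K, lipschitzOnWith_congr (pathDeriv_eq i j) hK⟩
  refine
    { hΦ.isMonotonePath with
      contDiff i j := ?_
      lipschitz := ?_
      lipschitz_deriv := exists_uniform_lipschitzOnWith lipschitz_pathDeriv
      trace := htr }
  · obtain ⟨K, hK⟩ := lipschitz_pathDeriv i j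
    exact (contDiffOn_one_iff_derivWithin (uniqueDiffOn_Icc hm)).mpr
      ⟨fun t ht => (hderiv i j t ht).differentiableWithinAt, hK.continuousOn⟩
  · obtain ⟨K, hK⟩ := hΦ.lipschitz
    exact ⟨K, fun i j => (hK i j).lipschitzOnWith⟩

end Admissible

section Congr

variable {m : ℕ} {Q : Matrix (Fin m) (Fin m) ℝ} {μ : Measure ℝ}
  {Φ Ψ : ℝ → Matrix (Fin m) (Fin m) ℝ}

theorem pathDeriv_congr (h : EqOn Φ Ψ (Icc (0 : ℝ) m)) :
    EqOn (pathDeriv Φ) (pathDeriv Ψ) (Icc (0 : ℝ) m) := by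
  intro t ht
  ext i j
  exact derivWithin_congr (fun s hs => by rw [h hs]) (by rw [h ht])

theorem hatPath_congr (h : EqOn Φ Ψ (Icc (0 : ℝ) m)) :
    EqOn (hatPath μ Φ) (hatPath μ Ψ) (Icc (0 : ℝ) m) := by
  intro t ht
  ext i j
  refine intervalIntegral.integral_congr fun s hs => ?_
  rw [uIcc_of_le ht.2] at hs
  simp only [pathDeriv_congr h ⟨ht.1.trans hs.1, hs.2⟩]

theorem crisantiSommers_congr (β : ℕ → Fin m → ℝ) (k : Fin m → ℝ)
    (h : EqOn Φ Ψ (Icc (0 : ℝ) m)) {T : ℝ} (hT : T ∈ Icc (0 : ℝ) m) :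
    crisantiSommers β k T μ Φ = crisantiSommers β k T μ Ψ := by
  have zero_le_top : (0 : ℝ) ≤ m := Nat.cast_nonneg m
  rw [crisantiSommers, crisantiSommers, h ⟨zero_le_top, le_rfl⟩, h hT]
  congr 2
  · congr 1
    refine intervalIntegral.integral_congr fun s hs => ?_
    rw [uIcc_of_le zero_le_top] at hs
    simp only [pathDeriv_congr h hs, h hs]
  · refine intervalIntegral.integral_congr fun s hs => ?_
    rw [uIcc_of_le hT.1] at hs
    have hs' : s ∈ Icc (0 : ℝ) m := ⟨hs.1, hs.2.trans hT.2⟩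
    simp only [pathDeriv_congr h hs', hatPath_congr h hs']

theorem IsPair.congr (hp : IsPair Q μ Φ) (h : EqOn Φ Ψ (Icc (0 : ℝ) m)) : IsPair Q μ Ψ :=
  ⟨hp.prob, hp.compl, hp.topPoint_lt, h hp.topPoint_mem ▸ hp.det_pos⟩

theorem IsMonotonePath.congr (hp : IsMonotonePath Q Φ) (h : EqOn Φ Ψ (Icc (0 : ℝ) m)) :
    IsMonotonePath Q Ψ where
  posSemidef t ht := h ht ▸ hp.posSemidef t ht
  mono s hs t ht hst := h hs ▸ h ht ▸ hp.mono s hs t ht hst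
  zero := h ⟨le_rfl, Nat.cast_nonneg m⟩ ▸ hp.zero
  top := h ⟨Nat.cast_nonneg m, le_rfl⟩ ▸ hp.top

theorem IsTracePath.congr (hp : IsTracePath Q Φ) (h : EqOn Φ Ψ (Icc (0 : ℝ) m)) :
    IsTracePath Q Ψ where
  toIsMonotonePath := hp.toIsMonotonePath.congr h
  lipschitz i j := lipschitzOnWith_congr (fun t ht => by simp only [h ht]) (hp.lipschitz i j)
  trace t ht := h ht ▸ hp.trace t ht

theorem IsSmoothPath.congr (hp : IsSmoothPath Q μ Φ) (h : EqOn Φ Ψ (Icc (0 : ℝ) m))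
    (hμ : μ.support ⊆ Icc (0 : ℝ) m) : IsSmoothPath Q μ Ψ where
  toIsMonotonePath := hp.toIsMonotonePath.congr h
  contDiff i j := (hp.contDiff i j).congr fun t ht => by rw [h ht]
  lipschitz := by
    obtain ⟨K, hK⟩ := hp.lipschitz
    exact ⟨K, fun i j => lipschitzOnWith_congr (fun t ht => by simp only [h ht]) (hK i j)⟩
  lipschitz_deriv := by
    obtain ⟨K, hK⟩ := hp.lipschitz_deriv
    exact ⟨K, fun i j =>
      lipschitzOnWith_congr (fun t ht => by simp only [pathDeriv_congr h ht]) (hK i j)⟩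
  trace t ht := h (hμ ht) ▸ hp.trace t ht

/-- The path `Φ` on `[0, m]`, continued to the whole line by its values at the endpoints. -/
def extend (Φ : ℝ → Matrix (Fin m) (Fin m) ℝ) : ℝ → Matrix (Fin m) (Fin m) ℝ :=
  IccExtend (Nat.cast_nonneg m) ((Icc (0 : ℝ) m).domRestrict Φ)

theorem eqOn_extend (Φ : ℝ → Matrix (Fin m) (Fin m) ℝ) : EqOn Φ (extend Φ) (Icc (0 : ℝ) m) :=
  fun _ ht => (IccExtend_of_mem _ ((Icc (0 : ℝ) m).domRestrict Φ) ht).symm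

theorem IsMonotonePath.globalPath_extend (hp : IsMonotonePath Q Φ)
    (hlip : ∃ K, ∀ i j, LipschitzOnWith K (fun t => Φ t i j) (Icc (0 : ℝ) m)) :
    GlobalPath Q (extend Φ) where
  lipschitz := by
    obtain ⟨K, hK⟩ := hlip
    exact ⟨K * 1, fun i j => (hK i j).to_restrict.comp (LipschitzWith.projIcc _)⟩
  mono s t hst := hp.mono _ (projIcc _ _ _ s).2 _ (projIcc _ _ _ t).2 (monotone_projIcc _ hst)
  eq_zero _ ht := (IccExtend_of_le_left _ _ ht).trans hp.zero
  eq_top _ ht := (IccExtend_of_right_le _ _ ht).trans hp.top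

end Congr

section Variation

variable {m : ℕ} {Q : Matrix (Fin m) (Fin m) ℝ} {μ : Measure ℝ}
  {Φ : ℝ → Matrix (Fin m) (Fin m) ℝ} {u δ T ε : ℝ}

theorem trace_pull (hu : (Φ u).trace = u) {t : ℝ} (ht : (Φ t).trace = t) :
    (pull Φ u δ ε t).trace = pull id u δ ε t := by
  simp only [pull, Matrix.trace_add, Matrix.trace_smul, Matrix.trace_sub, hu, ht, id_eq]

theorem IsTracePath.pull (hS : IsTracePath Q Φ) (hΦ : GlobalPath Q Φ) (hr : GoodRadius u δ T)
    (hT : T ≤ m) (hε : 0 ≤ ε) (hε₁ : ε ≤ 1 / 2) :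
    IsTracePath Q fun t =>
      VectorSpin.pull Φ u δ ε ((pullIso (u := u) hr.pos hε hε₁).symm t) := by
  have hre := hr.isReparam hT hε hε₁
  refine ((hΦ.pull hr hT hε (hε₁.trans one_half_lt_one.le)).reparam hre).isTracePath
    fun t ht => ?_
  have hu : u ∈ Icc (0 : ℝ) m := ⟨hr.nonneg, by linarith [hr.right, hr.pos]⟩
  rw [trace_pull (hS.trace u hu) (hS.trace _ (hre.mapsTo_symm_Icc ht))]
  exact (pullIso (u := u) hr.pos hε hε₁).apply_symm_apply t

theorem exists_lipschitzOnWith_inv {f : ℝ → ℝ} {s : Set ℝ} {c : ℝ} (hc : 0 < c)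
    (hf : ∃ K, LipschitzOnWith K f s) (hlow : ∀ t ∈ s, c ≤ f t) :
    ∃ K, LipschitzOnWith K (fun t => (f t)⁻¹) s := by
  obtain ⟨K, hK⟩ := hf
  refine ⟨K * (c⁻¹ * c⁻¹).toNNReal, LipschitzOnWith.of_dist_le_mul fun x hx y hy => ?_⟩
  have hfx : 0 < f x := hc.trans_le (hlow x hx)
  have hfy : 0 < f y := hc.trans_le (hlow y hy)
  rw [NNReal.coe_mul, Real.coe_toNNReal _ (by positivity), dist_inv_inv₀ hfx.ne' hfy.ne',
    Real.norm_of_nonneg hfx.le, Real.norm_of_nonneg hfy.le, div_eq_mul_inv, mul_inv,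
    mul_right_comm]
  exact mul_le_mul (hK.dist_le_mul x hx y hy)
    (mul_le_mul (inv_anti₀ hc (hlow x hx)) (inv_anti₀ hc (hlow y hy)) (by positivity)
      (by positivity)) (by positivity) (by positivity)

theorem IsSmoothPath.hasDerivWithinAt (hS : IsSmoothPath Q μ Φ) (i j : Fin m) {t : ℝ}
    (ht : t ∈ Icc (0 : ℝ) m) :
    HasDerivWithinAt (fun s => Φ s i j) (pathDeriv Φ t i j) (Icc (0 : ℝ) m) t :=
  ((hS.contDiff i j).differentiableOn one_ne_zero t ht).hasDerivWithinAt

theorem IsSmoothPath.of_support_subset {ν : Measure ℝ} (hS : IsSmoothPath Q μ Φ)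
    (h : ν.support ⊆ μ.support) : IsSmoothPath Q ν Φ :=
  { hS with trace := fun t ht => hS.trace t (h ht) }

theorem IsSmoothPath.pull (hS : IsSmoothPath Q μ Φ) (hΦ : GlobalPath Q Φ)
    (hu : u ∈ μ.support) (hr : GoodRadius u δ T) (hT : T ≤ m) (hε : 0 ≤ ε) (hε₁ : ε ≤ 1 / 2) :
    IsSmoothPath Q (μ.map (pullIso (u := u) hr.pos hε hε₁))
      fun t => VectorSpin.pull Φ u δ ε ((pullIso (u := u) hr.pos hε hε₁).symm t) := by
  set e := pullIso (u := u) hr.pos hε hε₁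
  have hre : IsReparam m T e (pullDeriv id 1 u δ ε) := hr.isReparam hT hε hε₁
  have top_pos : (0 : ℝ) < m := by linarith [hr.right, hr.pos, hr.nonneg]
  obtain ⟨K, hK⟩ := hS.lipschitz
  obtain ⟨L, hL⟩ := hS.lipschitz_deriv
  refine ((hΦ.pull hr hT hε (hε₁.trans one_half_lt_one.le)).reparam hre).isSmoothPath top_pos
    (Φ' := fun t => Matrix.of fun i j =>
      pullDeriv (fun s => Φ s i j) (pathDeriv Φ (e.symm t) i j) u δ ε (e.symm t)
        * (pullDeriv id 1 u δ ε (e.symm t))⁻¹)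
    (fun i j t ht => ?_) (fun i j => ?_) fun t ht => ?_
  · exact (hasDerivWithinAt_pull (hS.hasDerivWithinAt i j (hre.mapsTo_symm_Icc ht)) u δ ε).comp t
      (hre.hasDerivAt_symm t).hasDerivWithinAt hre.mapsTo_symm_Icc
  · have lipschitz_numerator := exists_lipschitzOnWith_pullDeriv (u := u)
      (isCompact_Icc (a := (0 : ℝ)) (b := m)) hr.pos ⟨K, hK i j⟩ ⟨L, hL i j⟩ ε
    have lipschitz_inv := exists_lipschitzOnWith_inv one_half_pos
      (exists_lipschitzOnWith_pullDeriv (u := u) (isCompact_Icc (a := (0 : ℝ)) (b := m)) hr.pos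
        ⟨1, LipschitzWith.id.lipschitzOnWith⟩ ⟨0, (LipschitzWith.const 1).lipschitzOnWith⟩ ε)
      fun t _ => hre.half_le t
    obtain ⟨M, hM⟩ := exists_lipschitzOnWith_mul isCompact_Icc lipschitz_numerator lipschitz_inv
    exact ⟨M * 2, hM.comp hre.lipschitzWith_symm.lipschitzOnWith hre.mapsTo_symm_Icc⟩
  · rw [trace_pull (hS.trace u hu) (hS.trace _ (symm_apply_mem_support_of_mem_support_map e ht))]
    exact e.apply_symm_apply t

/-- Classes of pairs that contain the variations of `(μ, Φ)` at `u`, provided these satisfy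
the standing conditions: reweightings of `μ`, and contractions of `Φ` near `u` after the change of
time that restores the trace. -/
structure IsVariationClosed (Q : Matrix (Fin m) (Fin m) ℝ)
    (𝒜 : Measure ℝ → (ℝ → Matrix (Fin m) (Fin m) ℝ) → Prop) (μ : Measure ℝ)
    (Φ : ℝ → Matrix (Fin m) (Fin m) ℝ) (u : ℝ) : Prop where
  of_absolutelyContinuous : ∀ ν, ν ≪ μ → IsPair Q ν Φ → 𝒜 ν Φ
  pull : ∀ {δ T ε : ℝ} (hr : GoodRadius u δ T) (hε : 0 ≤ ε) (hε₁ : ε ≤ 1 / 2), T ≤ m →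
    IsPair Q (μ.map (pullIso (u := u) hr.pos hε hε₁))
      (fun t => pull Φ u δ ε ((pullIso (u := u) hr.pos hε hε₁).symm t)) →
    𝒜 (μ.map (pullIso (u := u) hr.pos hε hε₁))
      fun t => pull Φ u δ ε ((pullIso (u := u) hr.pos hε hε₁).symm t)

theorem IsTracePath.isVariationClosed (hS : IsTracePath Q Φ) (hΦ : GlobalPath Q Φ)
    (μ : Measure ℝ) (u : ℝ) : IsVariationClosed Q (TracePair Q) μ Φ u where
  of_absolutelyContinuous _ _ hν := ⟨hν, hS⟩
  pull hr hε hε₁ hT hν := ⟨hν, hS.pull hΦ hr hT hε hε₁⟩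

theorem IsSmoothPath.isVariationClosed (hS : IsSmoothPath Q μ Φ) (hΦ : GlobalPath Q Φ)
    (hu : u ∈ μ.support) : IsVariationClosed Q (SmoothPair Q) μ Φ u where
  of_absolutelyContinuous _ hac hν := ⟨hν, hS.of_support_subset hac.support_mono⟩
  pull hr hε hε₁ hT hν := ⟨hν, hS.pull hΦ hu hr hT hε hε₁⟩

end Variation

/-! ### Minimizers -/

section Minimizer

variable {m : ℕ} {β : ℕ → Fin m → ℝ} {h : Fin m → ℝ} {Q : Matrix (Fin m) (Fin m) ℝ}
  {μ ν : Measure ℝ} {Φ Ψ : ℝ → Matrix (Fin m) (Fin m) ℝ} {u δ T : ℝ}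
  {𝒜 : Measure ℝ → (ℝ → Matrix (Fin m) (Fin m) ℝ) → Prop}

theorem support_subset_Icc (hμ : μ (Icc 0 T)ᶜ = 0) : μ.support ⊆ Icc 0 T :=
  Measure.support_subset_of_isClosed isClosed_Icc hμ

namespace IsMinimizer

protected theorem congr (hmin : IsMinimizer β h Q 𝒜 μ Φ) (hp : IsPair Q μ Φ)
    (hΨ : 𝒜 μ Ψ) (hΦΨ : EqOn Φ Ψ (Icc (0 : ℝ) m)) : IsMinimizer β h Q 𝒜 μ Ψ := by
  refine ⟨hΨ, fun ν Θ hΘ T S hT hS => ?_⟩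
  have T_mem : T ∈ Icc (0 : ℝ) m := ⟨hp.topPoint_mem.1.trans hT.1.le, hT.2.1.le⟩
  rw [← crisantiSommers_congr β h hΦΨ T_mem]
  exact hmin.2 ν Θ hΘ T S ⟨hT.1, hT.2.1, hΦΨ T_mem ▸ hT.2.2⟩ hS

theorem reduced_le (hβ : IsMixedModel β) (hQ : ∀ i, Q i i ≤ 1)
    (hmin : IsMinimizer β h Q 𝒜 μ Φ) (hp : CutPair Q μ Φ T) (hμT : topPoint m μ < T)
    (hq : CutPair Q ν Ψ T) (hνT : topPoint m ν < T) (hΨT : Ψ T = Φ T) (h𝒜 : 𝒜 ν Ψ) :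
    reduced β h Q T μ Φ ≤ reduced β h Q T ν Ψ := by
  have := hp.prob
  have := hq.prob
  have T_mem : T ∈ Icc (0 : ℝ) m := ⟨hp.pos.le, hp.lt.le⟩
  have functional_le := hmin.2 ν Ψ h𝒜 T T (hp.isCutoff hμT) (hq.isCutoff hνT)
  rw [hp.path.crisantiSommers_eq hβ h hQ hp.compl_top T_mem,
    hq.path.crisantiSommers_eq hβ h hQ hq.compl_top T_mem, hΨT] at functional_le
  linarith

theorem reduced_le_tilt (hβ : IsMixedModel β) (hQ : ∀ i, Q i i ≤ 1)
    (hmin : IsMinimizer β h Q 𝒜 μ Φ) (h𝒜 : IsVariationClosed Q 𝒜 μ Φ u)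
    (hp : CutPair Q μ Φ T) (hT : topPoint m μ < T) {w : ℝ → ℝ} {W ε : ℝ} (hw : Measurable w)
    (hW : ∀ s, |w s| ≤ W) (hmean : ∫ s, w s ∂μ = 0) (hε : |ε| * W ≤ 1) :
    reduced β h Q T μ Φ ≤ reduced β h Q T (tilt μ w ε) Φ := by
  have hq : CutPair Q (tilt μ w ε) Φ T := hp.tilt hw hW hε hmean
  have := hp.prob
  have := hq.prob
  have hac := tilt_absolutelyContinuous μ w ε
  obtain ⟨a, ha, distr_eq, haT⟩ := (hp.isPair hT).exists_distr_eq_one hT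
  have topPoint_lt : topPoint m (tilt μ w ε) < T :=
    (topPoint_le ha (distr_eq_one_iff.mpr (hac (distr_eq_one_iff.mp distr_eq)))).trans_lt haT
  exact hmin.reduced_le hβ hQ hp hT hq topPoint_lt rfl
    (h𝒜.of_absolutelyContinuous _ hac (hq.isPair topPoint_lt))

theorem reduced_le_pull (hβ : IsMixedModel β) (hQ : ∀ i, Q i i ≤ 1)
    (hmin : IsMinimizer β h Q 𝒜 μ Φ) (h𝒜 : IsVariationClosed Q 𝒜 μ Φ u)
    (hp : CutPair Q μ Φ T) (hT : topPoint m μ < T) (hr : GoodRadius u δ T) {ε : ℝ} (hε : 0 ≤ ε)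
    (hε₁ : ε ≤ 1 / 2) :
    reduced β h Q T μ Φ ≤ reduced β h Q T μ (pull Φ u δ ε) := by
  set e := pullIso (u := u) hr.pos hε hε₁
  have he : IsReparam m T e (pullDeriv id 1 u δ ε) := hr.isReparam hp.lt.le hε hε₁
  have hpull := hp.pull hr hε (hε₁.trans one_half_lt_one.le)
  obtain ⟨a, ha, distr_eq, haT⟩ := (hp.isPair hT).exists_distr_eq_one hT
  have e_lt : e a < T := he.cut ▸ e.strictMono haT
  have e_mem : e a ∈ Icc (0 : ℝ) m :=
    ⟨he.zero ▸ e.monotone ha.1, e_lt.le.trans hp.lt.le⟩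
  have topPoint_lt : topPoint m (μ.map e) < T :=
    (topPoint_le e_mem ((he.distr_map μ a).trans distr_eq)).trans_lt e_lt
  have hq := hpull.reparam he
  rw [← hpull.reduced_reparam β h he]
  refine hmin.reduced_le hβ hQ hp hT hq topPoint_lt ?_
    (h𝒜.pull hr hε hε₁ hp.lt.le (hq.isPair topPoint_lt))
  rw [he.symm_cut, pull_eq_self Φ hr.pos ε (hr.le_abs_of_ge le_rfl)]

end IsMinimizer

theorem exists_goodRadius_le (hu : 0 ≤ u) (huT : u < T) (hδ : 0 < δ) :
    ∃ r ≤ δ, GoodRadius u r T := by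
  rcases hu.eq_or_lt with rfl | hu₀
  · refine ⟨min δ T, min_le_left _ _, lt_min hδ huT, le_rfl, .inl rfl, ?_⟩
    linarith [min_le_right δ T]
  · refine ⟨min δ (min u (T - u)), min_le_left _ _, lt_min hδ (lt_min hu₀ (sub_pos.mpr huT)), hu,
      .inr ((min_le_right _ _).trans (min_le_left _ _)), ?_⟩
    linarith [(min_le_right δ (min u (T - u))).trans (min_le_right u (T - u))]

theorem measure_singleton_ne_zero_of_integral_bump_mul_nonneg {f : ℝ → ℝ} (hδ : 0 < δ)
    (hu : u ∈ μ.support) (hint : Integrable (fun s => bump u δ s * f s) μ)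
    (hnonneg : 0 ≤ ∫ s, bump u δ s * f s ∂μ)
    (hneg : ∀ s ∈ μ.support, |s - u| < δ → s ≠ u → f s < 0) : μ {u} ≠ 0 := by
  intro measure_eq_zero
  have ae_ne : ∀ᵐ s ∂μ, s ≠ u := by simpa [ae_iff] using measure_eq_zero
  have ae_neg : ∀ᵐ s ∂μ, |s - u| < δ → f s < 0 := by
    filter_upwards [ae_ne, Measure.support_mem_ae] with s hs hsupp hd
    exact hneg s hsupp hd hs
  have ae_nonneg : 0 ≤ᵐ[μ] fun s => -(bump u δ s * f s) := by
    filter_upwards [ae_neg] with s hs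
    rcases lt_or_ge |s - u| δ with hd | hd
    · exact neg_nonneg.mpr (mul_nonpos_of_nonneg_of_nonpos (bump_nonneg u δ s) (hs hd).le)
    · simp [bump_eq_zero hδ hd]
  have ae_eq_zero : (fun s => -(bump u δ s * f s)) =ᵐ[μ] 0 := by
    refine (integral_eq_zero_iff_of_nonneg_ae ae_nonneg hint.neg).mp (le_antisymm ?_ ?_)
    · rw [integral_neg]
      exact neg_nonpos.mpr hnonneg
    · exact integral_nonneg_of_ae ae_nonneg
  have ae_notMem_ball : ∀ᵐ s ∂μ, s ∉ Metric.ball u δ := by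
    filter_upwards [ae_neg, ae_eq_zero] with s hs hzero hmem
    exact (mul_neg_of_pos_of_neg (bump_pos hδ hmem) (hs hmem)).ne (neg_eq_zero.mp hzero)
  exact ((Measure.mem_support_iff_forall u).mp hu _ (Metric.ball_mem_nhds u hδ)).ne'
    (measure_eq_zero_iff_ae_notMem.mpr ae_notMem_ball)

theorem IsMinimizer.measure_singleton_ne_zero (hβ : IsMixedModel β) (hQ : ∀ i, Q i i ≤ 1)
    (hmin : IsMinimizer β h Q 𝒜 μ Φ) (h𝒜 : IsVariationClosed Q 𝒜 μ Φ u) (hΦ : GlobalPath Q Φ)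
    (hpair : IsPair Q μ Φ) (hu : u ∈ μ.support)
    (hdiff : ∀ i j, DifferentiableWithinAt ℝ (fun t => Φ t i j) (Icc (0 : ℝ) m) u)
    (hlt : stabForm β Q (pathDeriv Φ u) < 0) : μ {u} ≠ 0 := by
  obtain ⟨T, hT⟩ := hpair.exists_isCutoff hΦ
  have hp := hpair.cutPair hΦ hT
  have := hp.prob
  obtain ⟨a, -, distr_eq, haT⟩ := hpair.exists_distr_eq_one hT.1
  have u_mem := support_subset_Icc (distr_eq_one_iff.mp distr_eq) hu
  have u_lt : u < T := u_mem.2.trans_lt haT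
  have massDeriv_const : ∀ s ∈ μ.support, massDeriv β h Q T μ Φ s = massDeriv β h Q T μ Φ u :=
    fun s hs => hp.massDeriv_eq_of_mem_support hβ h hQ (fun w W ε hw hW hmean hε =>
      hmin.reduced_le_tilt hβ hQ h𝒜 hp hT.1 hw hW hmean hε) hs hu
  obtain ⟨δ₀, hδ₀, pairing_neg⟩ :=
    hp.exists_pairing_pathGradient_neg hβ h hQ ⟨u_mem.1, u_lt.le⟩ hdiff hlt
  obtain ⟨δ, hδ, hr⟩ := exists_goodRadius_le u_mem.1 u_lt hδ₀
  refine measure_singleton_ne_zero_of_integral_bump_mul_nonneg hr.pos hu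
    (hp.integrable_bump_mul_pairing hβ h hQ hr.pos)
    (hp.integral_bump_mul_pairing_nonneg hβ h hQ hr one_half_pos one_half_lt_one.le
      fun ε hε hε₁ => hmin.reduced_le_pull hβ hQ h𝒜 hp hT.1 hr hε.le hε₁)
    fun s hs hsu hne => ?_
  exact pairing_neg s (support_subset_Icc hp.compl hs) (hsu.trans_le hδ) hne (massDeriv_const s hs)

end Minimizer

theorem hasJumpAt_distr {μ : Measure ℝ} [IsFiniteMeasure μ] {u : ℝ} (hu : 0 ≤ u)
    (h : μ {u} ≠ 0) : HasJumpAt (distr μ) u := by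
  have distr_mono := distr_mono μ
  have tendsto_left := distr_mono.tendsto_nhdsLT u
  have tendsto_right := distr_mono.tendsto_nhdsGT u
  refine ⟨_, _, tendsto_left, tendsto_right, fun limits_eq => h ?_⟩
  have add_singleton_le : ∀ s < u, distr μ s + μ.real {u} ≤ distr μ u := fun s hs => by
    have disjoint : Disjoint (Icc 0 s) {u} :=
      disjoint_singleton_right.mpr fun hmem => hmem.2.not_gt hs
    rw [distr, distr, ← measureReal_union disjoint (measurableSet_singleton u)]
    exact measureReal_mono (union_subset (Icc_subset_Icc_right hs.le)
      (singleton_subset_iff.mpr ⟨hu, le_rfl⟩))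
  have left_limit_add_le : sSup (distr μ '' Iio u) + μ.real {u} ≤ distr μ u :=
    le_of_tendsto (tendsto_left.add_const _) (eventually_nhdsWithin_of_forall add_singleton_le)
  have le_right_limit : distr μ u ≤ sInf (distr μ '' Ioi u) :=
    ge_of_tendsto tendsto_right (eventually_nhdsWithin_of_forall fun _ ht => distr_mono ht.le)
  exact (measureReal_eq_zero_iff (measure_ne_top μ {u})).mp
    (le_antisymm (by linarith) measureReal_nonneg)

theorem IsMinimizer.hasJumpAt_distr {m : ℕ} {β : ℕ → Fin m → ℝ} {h : Fin m → ℝ}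
    {Q : Matrix (Fin m) (Fin m) ℝ} {μ : Measure ℝ} {Φ : ℝ → Matrix (Fin m) (Fin m) ℝ} {u : ℝ}
    {𝒜 : Measure ℝ → (ℝ → Matrix (Fin m) (Fin m) ℝ) → Prop} (hβ : IsMixedModel β)
    (hQ : ∀ i, Q i i ≤ 1) (hmin : IsMinimizer β h Q 𝒜 μ Φ) (hpair : IsPair Q μ Φ)
    (hext : 𝒜 μ (extend Φ)) (hpath : GlobalPath Q (extend Φ))
    (h𝒜 : IsVariationClosed Q 𝒜 μ (extend Φ) u) (hu : u ∈ μ.support)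
    (hdiff : ∀ i j, DifferentiableWithinAt ℝ (fun t => Φ t i j) (Icc (0 : ℝ) m) u)
    (hlt : stabForm β Q (pathDeriv Φ u) < 0) : HasJumpAt (distr μ) u := by
  have := hpair.prob
  have u_mem := support_subset_Icc hpair.compl hu
  refine VectorSpin.hasJumpAt_distr u_mem.1 ((hmin.congr hpair hext (eqOn_extend Φ)
    ).measure_singleton_ne_zero hβ hQ h𝒜 hpath (hpair.congr (eqOn_extend Φ)) hu (fun i j => ?_) ?_)
  · exact (hdiff i j).congr (fun t ht => by rw [eqOn_extend Φ ht]) (by rw [eqOn_extend Φ u_mem])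
  · rwa [← pathDeriv_congr (eqOn_extend Φ) u_mem]

end VectorSpin

end

theorem mainTheorem10_general {m : ℕ}
    (β : ℕ → Fin m → ℝ) (hβ : VectorSpin.IsMixedModel β)
    (h : Fin m → ℝ)
    (Q : Matrix (Fin m) (Fin m) ℝ) (hQ : ∀ i, Q i i ≤ 1)
    (μP : Measure ℝ) (Φ : ℝ → Matrix (Fin m) (Fin m) ℝ)
    (hmin : VectorSpin.IsMinimizer β h Q (VectorSpin.TracePair Q) μP Φ ∨
      VectorSpin.IsMinimizer β h Q (VectorSpin.SmoothPair Q) μP Φ)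
    (u₀ : ℝ) (hu₀ : u₀ ∈ μP.support)
    (hdiff : ∀ i j, DifferentiableWithinAt ℝ (fun t => Φ t i j) (Icc (0 : ℝ) m) u₀)
    (hlt : VectorSpin.pairing (VectorSpin.xiDD β Q)
        (VectorSpin.pathDeriv Φ u₀ ⊙ VectorSpin.pathDeriv Φ u₀) <
      VectorSpin.pairing (Q⁻¹ * VectorSpin.pathDeriv Φ u₀) (Q⁻¹ * VectorSpin.pathDeriv Φ u₀)) :
    VectorSpin.HasJumpAt (VectorSpin.distr μP) u₀ := by
  have extend_eq := VectorSpin.eqOn_extend Φ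
  rcases hmin with hmin | hmin
  · obtain ⟨hpair, hpath⟩ := hmin.1
    have hpath' := hpath.congr extend_eq
    have hglobal := hpath.globalPath_extend ⟨1, hpath.lipschitz⟩
    exact hmin.hasJumpAt_distr hβ hQ hpair ⟨hpair.congr extend_eq, hpath'⟩ hglobal
      (hpath'.isVariationClosed hglobal μP u₀) hu₀ hdiff (sub_neg.mpr hlt)
  · obtain ⟨hpair, hpath⟩ := hmin.1
    have hpath' := hpath.congr extend_eq (VectorSpin.support_subset_Icc hpair.compl)
    have hglobal := hpath.globalPath_extend hpath.lipschitz
    exact hmin.hasJumpAt_distr hβ hQ hpair ⟨hpair.congr extend_eq, hpath'⟩ hglobal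
      (hpath'.isVariationClosed hglobal hu₀) hu₀ hdiff (sub_neg.mpr hlt)

theorem mainTheorem10 {m : ℕ} (hm : 1 ≤ m)
    (β : ℕ → Fin m → ℝ) (hβ : VectorSpin.IsMixedEvenModel β)
    (h : Fin m → ℝ)
    (Q : Matrix (Fin m) (Fin m) ℝ) (hQ : VectorSpin.IsConstraint Q)
    (μP : Measure ℝ) (Φ : ℝ → Matrix (Fin m) (Fin m) ℝ)
    (hmin : VectorSpin.IsMinimizer β h Q (VectorSpin.TracePair Q) μP Φ ∨
      VectorSpin.IsMinimizer β h Q (VectorSpin.SmoothPair Q) μP Φ)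
    (u₀ : ℝ) (hu₀ : u₀ ∈ μP.support)
    (hdiff : ∀ i j, DifferentiableWithinAt ℝ (fun t => Φ t i j) (Icc (0 : ℝ) m) u₀)
    (hlt : VectorSpin.pairing (VectorSpin.xiDD β Q)
        (VectorSpin.pathDeriv Φ u₀ ⊙ VectorSpin.pathDeriv Φ u₀) <
      VectorSpin.pairing (Q⁻¹ * VectorSpin.pathDeriv Φ u₀) (Q⁻¹ * VectorSpin.pathDeriv Φ u₀)) :
    VectorSpin.HasJumpAt (VectorSpin.distr μP) u₀ :=
  mainTheorem10_general β hβ.summable h Q (fun i => (hQ.diag i).le) μP Φ hmin u₀ hu₀ hdiff hlt
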